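/- Let $a\in[\pi/2,\pi)$. For complex-valued $p,q\in L_2(0,\pi)$ vanishing a.e. on $(0,a)$ put $$B=\begin{bmatrix}0&1\\-1&0\end{bmatrix},\qquad Q(x)=\begin{bmatrix}q(x)&p(x)\\p(x)&-q(x)\end{bmatrix},$$ and for $j\in\{1,2\}$ let $\mathcal B_{1,j}(Q)$ be the boundary value problem $$By'(x)+Q(x)y(x-a)=\lambda y(x),\quad 0<x<\pi,\qquad y_1(0)=y_j(\pi)=0,$$ where $y=(y_1,y_2)^T$ is absolutely continuous on $[0,\pi]$ and the equation holds a.e. The spectrum of $\mathcal B_{1,j}(Q)$ is the collection of its eigenvalues, each counted with its multiplicity as a zero of the characteristic function $\lambda\mapsto y_j(\pi,\lambda)$, where $y(\cdot,\lambda)$ is the solution with $y(0,\lambda)=(0,1)^T$. Let $\{\lambda_{n,1}\}_{n\in\mathbb Z}$ and $\{\lambda_{n,2}\}_{n\in\mathbb Z}$ be sequences of complex numbers. There exist such $p,q$ for which these sequences, each member repeated according to its multiplicity, are the full spectra of $\mathcal B_{1,1}(Q)$ and $\mathcal B_{1,2}(Q)$, respectively, if and only if, after a suitable renumbering of each of the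 two sequences by a permutation of $\mathbb Z$, the following two conditions hold: (i) for $j=1,2$, $\lambda_{n,j}=n+\frac{1-j}2+\varkappa_{n,j}$ with $\sum_{n\in\mathbb Z}|\varkappa_{n,j}|^2<\infty$; (ii) the entire functions $\Delta_1(\lambda)+\sin\lambda\pi$ and $\Delta_2(\lambda)-\cos\lambda\pi$ have exponential type at most $\pi-a$, where $$\Delta_1(\lambda)=\pi(\lambda_{0,1}-\lambda)\prod_{n\in\mathbb Z\setminus\{0\}}\frac{\lambda_{n,1}-\lambda}{n}\exp\Big(\frac{\lambda}{n}\Big),\qquad \Delta_2(\lambda)=\prod_{n\in\mathbb Z}\frac{\lambda_{n,2}-\lambda}{n-1/2}\exp\Big(\frac{\lambda}{n-1/2}\Big).$$ (An entire function $f$ has exponential type at most $\sigma$ if for every $\varepsilon>0$ there is $C$ with $|f(\lambda)|\le Ce^{(\sigma+\varepsilon)|\lambda|}$ for all $\lambda\in\mathbb C$.) -/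

import Mathlib

namespace DelayDirac

/-- The constant matrix `B` of the Dirac-type system. -/
def matB : Matrix (Fin 2) (Fin 2) ℂ := !![0, 1; -1, 0]

/-- The potential matrix `Q(x)` with `q₁₁ = -q₂₂ = q` and `q₁₂ = q₂₁ = p`. -/
def matQ (p q : ℝ → ℂ) (x : ℝ) : Matrix (Fin 2) (Fin 2) ℂ :=
  !![q x, p x; p x, -(q x)]

/-- Admissible entries of `Q`: complex-valued functions in `L₂(0, π)` that vanish
almost everywhere on `(0, a)`. -/
structure IsPotential (a : ℝ) (p : ℝ → ℂ) : Prop where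
  memLp : MeasureTheory.MemLp p 2 (MeasureTheory.volume.restrict (Set.Ioo 0 Real.pi))
  eq_zero : ∀ᵐ x ∂(MeasureTheory.volume.restrict (Set.Ioo 0 a)), p x = 0

/-- `y` is a solution on `[0, π]` of `B y'(x) + Q(x) y(x - a) = l y(x)`, `0 < x < π`:
it is absolutely continuous on `[0, π]` and satisfies the equation almost everywhere.
(The values of `y` on negative arguments do not matter, because `Q = 0` on `(0, a)`.) -/
structure IsSolution (a : ℝ) (p q : ℝ → ℂ) (l : ℂ) (y : ℝ → Fin 2 → ℂ) : Prop where
  absCont : AbsolutelyContinuousOnInterval y 0 Real.pi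
  equation : ∀ᵐ x ∂(MeasureTheory.volume.restrict (Set.Ioo 0 Real.pi)),
    DifferentiableAt ℝ y x ∧
      Matrix.mulVec matB (deriv y x) + Matrix.mulVec (matQ p q x) (y (x - a)) = l • y x

/-- `l` is an eigenvalue of the boundary value problem with the boundary conditions
`y_ν(0) = y_j(π) = 0`. The indices `0, 1 : Fin 2` stand for the components `1, 2`. -/
def IsEigenvalue (a : ℝ) (p q : ℝ → ℂ) (ν j : Fin 2) (l : ℂ) : Prop :=
  ∃ y : ℝ → Fin 2 → ℂ, IsSolution a p q l y ∧ y 0 ν = 0 ∧ y Real.pi j = 0 ∧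
    ∃ x ∈ Set.Icc 0 Real.pi, y x ≠ 0

/-- `D` is the characteristic function of the boundary value problem
`y_ν(0) = y_j(π) = 0`: `D(l)` is the value at `π` of the `j`-th component of that column of
the fundamental matrix-solution (equal to the identity matrix at `x = 0`) which satisfies
the boundary condition at `0`. -/
def IsCharacteristicFunction (a : ℝ) (p q : ℝ → ℂ) (ν j : Fin 2) (D : ℂ → ℂ) : Prop :=
  ∀ l : ℂ, ∃ y : ℝ → Fin 2 → ℂ,
    IsSolution a p q l y ∧ y 0 = Pi.single (1 - ν) 1 ∧ D l = y Real.pi j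

/-- The sequence `μ` is, in some order, the full spectrum of the boundary value problem
`y_ν(0) = y_j(π) = 0`: its members are exactly the eigenvalues, and each eigenvalue is repeated
according to its multiplicity, that is, its order as a zero of the characteristic function. -/
def IsSpectrum (a : ℝ) (p q : ℝ → ℂ) (ν j : Fin 2) (μ : ℤ → ℂ) : Prop :=
  (∀ z : ℂ, IsEigenvalue a p q ν j z ↔ ∃ n : ℤ, μ n = z) ∧
    ∃ D : ℂ → ℂ, IsCharacteristicFunction a p q ν j D ∧
      ∀ z : ℂ, analyticOrderAt D z = Set.encard {n : ℤ | μ n = z}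

/-- The entire function `f` has exponential type at most `σ`. -/
def ExpTypeLE (f : ℂ → ℂ) (σ : ℝ) : Prop :=
  Differentiable ℂ f ∧
    ∀ ε : ℝ, 0 < ε → ∃ C : ℝ, ∀ z : ℂ, ‖f z‖ ≤ C * Real.exp ((σ + ε) * ‖z‖)

/-- The canonical product `π (μ₀ - l) ∏_{n ≠ 0} ((μₙ - l) / n) exp (l / n)`. It converges
absolutely if `μₙ = n + ϰₙ` with `ϰ ∈ l₂`. -/
noncomputable def prod1 (μ : ℤ → ℂ) (l : ℂ) : ℂ :=
  (Real.pi : ℂ) * (μ 0 - l) *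
    ∏' n : {n : ℤ // n ≠ 0}, (μ n - l) / ((n : ℤ) : ℂ) * Complex.exp (l / ((n : ℤ) : ℂ))

/-- The canonical product `∏_n ((μₙ - l) / (n - 1/2)) exp (l / (n - 1/2))`. It converges
absolutely if `μₙ = n - 1/2 + ϰₙ` with `ϰ ∈ l₂`. -/
noncomputable def prod2 (μ : ℤ → ℂ) (l : ℂ) : ℂ :=
  ∏' n : ℤ, (μ n - l) / ((n : ℂ) - 1 / 2) * Complex.exp (l / ((n : ℂ) - 1 / 2))

/-- The two conditions of the characterization, for sequences in the given numbering. -/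
structure SpectralConditions (a : ℝ) (μ₁ μ₂ : ℤ → ℂ) : Prop where
  /-- `μ₁ n = n + ϰ₁ n` with `ϰ₁ ∈ l₂` -/
  asymp1 : Memℓp (fun n : ℤ => μ₁ n - (n : ℂ)) 2
  /-- `μ₂ n = n - 1/2 + ϰ₂ n` with `ϰ₂ ∈ l₂` -/
  asymp2 : Memℓp (fun n : ℤ => μ₂ n - ((n : ℂ) - 1 / 2)) 2
  type1 : ExpTypeLE (fun l => prod1 μ₁ l + Complex.sin (l * Real.pi)) (Real.pi - a)
  type2 : ExpTypeLE (fun l => prod2 μ₂ l - Complex.cos (l * Real.pi)) (Real.pi - a)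

end DelayDirac

/-! ### Entire functions compared with the sine far from the integers -/

namespace DelayDirac

open Filter Topology Bornology Set

/-! Since `a ≥ π/2`, the delayed argument `x - a` stays in `[0, a]` whenever `Q(x)` matters, and
there the solution is a free exponential. The combinations `y₂ ± i y₁` therefore satisfy scalar
first-order equations with known sources and are given in closed form by `wave`. With `b = π - a`,
the characteristic functions are `-sin λπ + ∫ u₁(s) exp(iλs) ds` and `cos λπ + ∫ u₂(s) exp(iλs) ds`,
the integrals over `(-b, b)` (`sol_pi_zero`, `sol_pi_one`). The pair `(u₁, u₂)` depends linearly on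
`(p, q)`, and every pair in `L₂(-b, b)` arises (`exists_isPotential_density_pair`).

What remains is a statement about zeros of perturbed sines. The main tool is a Liouville argument:
if two entire functions are both comparable with `sin πz` at distance at least `1/4` from the
integers, and one divides the other, they are proportional (`eq_mul_of_analyticOrderAt_le`).
Canonical products and functions `-sin + f`, with `f` a Fourier integral, are both comparable with
the sine in this sense.

Necessity: `f = o(sin)` away from the integers, so all but finitely many integers `n` have exactly
one nearby zero, at distance at most `|f(n)|`, and `(f(n))` is in `ℓ₂` by Parseval. The zeros can
then be numbered with `ℓ₂` deviations, and the Liouville argument identifies the canonical product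
with the characteristic function (`exists_perm_prod1_eq`).

Sufficiency: the values of `prod1` at the integers are in `ℓ₂`, so Riesz-Fischer gives a Fourier
integral over `(-π, π)` with the same values. The difference between `prod1 + sin` and this integral
is divisible by the sine and small compared with it, hence zero. The type condition and Paley-Wiener
shrink the support to `(-b, b)` (`exists_prod1_add_sin_eq_expInt`).

The second spectrum reduces to the first by the translation `λ ↦ λ + 1/2` (`prod2_eq_neg_prod1`). -/

/-- The complex numbers at distance at least `1/4` from all integers. -/
def offInt : Set ℂ := {z | ∀ n : ℤ, 1 / 4 ≤ ‖z - n‖}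

/-- The filter of points that go to infinity at distance at least `1/4` from all integers. -/
noncomputable def farFilter : Filter ℂ := cobounded ℂ ⊓ 𝓟 offInt

lemma tendsto_mul_I_farFilter :
    Tendsto (fun y : ℝ => (y : ℂ) * Complex.I) atTop farFilter := by
  refine tendsto_inf.2 ⟨?_, tendsto_principal.2 ?_⟩
  · rw [← tendsto_norm_atTop_iff_cobounded]
    simpa using tendsto_abs_atTop_atTop
  · filter_upwards [eventually_ge_atTop 1] with y hy n
    have h := Complex.abs_im_le_norm ((y : ℂ) * Complex.I - n)
    simp only [Complex.sub_im, Complex.mul_im, Complex.ofReal_re, Complex.I_im, mul_one,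
      Complex.ofReal_im, Complex.I_re, mul_zero, add_zero, Complex.intCast_im, sub_zero] at h
    have := le_abs_self y
    linarith

instance : farFilter.NeBot := tendsto_mul_I_farFilter.neBot

lemma eventually_farFilter {p : ℂ → Prop} :
    (∀ᶠ z in farFilter, p z) ↔ ∃ R : ℝ, ∀ z ∈ offInt, R ≤ ‖z‖ → p z := by
  rw [farFilter, eventually_inf_principal, (hasBasis_cobounded_norm).eventually_iff]
  simp only [true_and]
  exact ⟨fun ⟨R, h⟩ => ⟨R, fun z hz hR => h hR hz⟩, fun ⟨R, h⟩ => ⟨R, fun z hR hz => h z hz hR⟩⟩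

lemma sphere_subset_offInt (n : ℤ) {r : ℝ} (h : 1 / 4 ≤ r) (h' : r ≤ 3 / 4) :
    Metric.sphere (n : ℂ) r ⊆ offInt := by
  intro z hz m
  rw [mem_sphere_iff_norm] at hz
  rcases eq_or_ne m n with rfl | hmn
  · rw [hz]; exact h
  have h1 : (1 : ℝ) ≤ ‖((n - m : ℤ) : ℂ)‖ := by
    rw [Complex.norm_intCast]
    exact_mod_cast Int.one_le_abs (sub_ne_zero.2 hmn.symm)
  have h2 : ((n - m : ℤ) : ℂ) = (z - m) - (z - n) := by push_cast; ring
  have h3 := norm_sub_le (z - m) (z - n)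
  rw [← h2, hz] at h3
  linarith

/-- Measuring from the integer nearest to `Re z` makes the bounds on sums over `n` uniform in `z`.
The constant `8` is not sharp. -/
lemma one_add_abs_sub_round_le {z : ℂ} (hz : z ∈ offInt) (n : ℤ) :
    (1 + |(n : ℝ) - round z.re|) / 8 ≤ ‖z - n‖ := by
  rcases eq_or_ne n (round z.re) with h | h
  · have := hz n
    rw [h] at this ⊢
    simp only [sub_self, abs_zero, add_zero]
    linarith
  · have h1 : (1 : ℝ) ≤ |(n : ℝ) - round z.re| := by
      exact_mod_cast Int.one_le_abs (sub_ne_zero.2 h)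
    have h2 := abs_sub_round z.re
    have h3 := Complex.abs_re_le_norm (z - n)
    simp only [Complex.sub_re, Complex.intCast_re] at h3
    have h4 := abs_sub_le (n : ℝ) z.re (round z.re)
    rw [abs_sub_comm (n : ℝ) z.re] at h4
    linarith

lemma summable_inv_one_add_abs_sq : Summable fun m : ℤ => ((1 + |(m : ℝ)|) ^ 2)⁻¹ := by
  have h := (Real.summable_one_div_int_pow (p := 2)).2 one_lt_two
  refine Summable.of_norm_bounded_eventually h ?_
  have : ∀ᶠ m : ℤ in cofinite, m ≠ 0 := (Set.finite_singleton 0).compl_mem_cofinite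
  filter_upwards [this] with m hm
  have : 0 < |(m : ℝ)| := abs_pos.2 (by exact_mod_cast hm)
  rw [Real.norm_of_nonneg (by positivity), one_div]
  rw [← sq_abs (m : ℝ)]
  gcongr
  linarith

lemma inv_norm_sub_sq_le {z : ℂ} (hz : z ∈ offInt) (n : ℤ) :
    (‖z - n‖ ^ 2)⁻¹ ≤ 64 * ((1 + |((n - round z.re : ℤ) : ℝ)|) ^ 2)⁻¹ := by
  have h := one_add_abs_sub_round_le hz n
  have h0 : 0 < 1 + |(n : ℝ) - round z.re| := by positivity
  calc (‖z - n‖ ^ 2)⁻¹ ≤ (((1 + |(n : ℝ) - round z.re|) / 8) ^ 2)⁻¹ := by gcongr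
    _ = _ := by push_cast; field_simp; norm_num

lemma summable_inv_norm_sub_sq {z : ℂ} (hz : z ∈ offInt) :
    Summable fun n : ℤ => (‖z - n‖ ^ 2)⁻¹ := by
  refine Summable.of_nonneg_of_le (fun n => by positivity) (inv_norm_sub_sq_le hz) ?_
  exact ((Equiv.subRight (round z.re)).summable_iff.2 summable_inv_one_add_abs_sq).mul_left 64

lemma tsum_inv_norm_sub_sq_le {z : ℂ} (hz : z ∈ offInt) :
    ∑' n : ℤ, (‖z - n‖ ^ 2)⁻¹ ≤ 64 * ∑' m : ℤ, ((1 + |(m : ℝ)|) ^ 2)⁻¹ := by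
  rw [← (Equiv.subRight (round z.re)).tsum_eq fun m : ℤ => ((1 + |(m : ℝ)|) ^ 2)⁻¹,
    ← tsum_mul_left]
  exact Summable.tsum_le_tsum (inv_norm_sub_sq_le hz) (summable_inv_norm_sub_sq hz)
    (((Equiv.subRight (round z.re)).summable_iff.2 summable_inv_one_add_abs_sq).mul_left 64)

/-- Young's inequality with a free weight: a small `t` is affordable in front of a sum that is only
bounded, if the tail of the squares is made small compared with `t`. -/
lemma div_le_of_pos (x y : ℝ) {t : ℝ} (ht : 0 < t) : x / y ≤ x ^ 2 / t + t * (y ^ 2)⁻¹ := by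
  have h : 0 ≤ (x / t - y⁻¹) ^ 2 + (x / t) ^ 2 + (y⁻¹) ^ 2 := by positivity
  have h1 : x ^ 2 / t + t * (y ^ 2)⁻¹ - x / y = t / 2 * ((x / t - y⁻¹) ^ 2 + (x / t) ^ 2 + (y⁻¹) ^ 2) := by
    field_simp
    ring
  have := mul_nonneg (half_pos ht).le h
  linarith

variable {E : Type*} [NormedAddCommGroup E]

lemma summable_norm_div_norm_sub {k : ℤ → E} (hk : Summable fun n => ‖k n‖ ^ 2) {z : ℂ}
    (hz : z ∈ offInt) : Summable fun n : ℤ => ‖k n‖ / ‖z - n‖ := by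
  refine Summable.of_nonneg_of_le (fun n => by positivity)
    (fun n => div_le_of_pos _ _ one_pos) ?_
  exact (hk.div_const 1).add ((summable_inv_norm_sub_sq hz).mul_left 1)

/-- Outside a finite set of indices the weighted Young inequality bounds the sum uniformly in `z`;
each of the finitely many remaining terms tends to zero. -/
lemma tendsto_tsum_norm_div_norm_sub {k : ℤ → E} (hk : Summable fun n => ‖k n‖ ^ 2) :
    Tendsto (fun z : ℂ => ∑' n : ℤ, ‖k n‖ / ‖z - n‖) farFilter (𝓝 0) := by
  set A : ℝ := 64 * ∑' m : ℤ, ((1 + |(m : ℝ)|) ^ 2)⁻¹ with hA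
  have hA0 : 0 ≤ A := mul_nonneg (by norm_num) (tsum_nonneg fun m => by positivity)
  rw [Metric.tendsto_nhds]
  intro ε hε
  obtain ⟨t, ht, htA⟩ : ∃ t : ℝ, 0 < t ∧ t * A < ε / 3 := by
    refine ⟨ε / 3 / (A + 1), by positivity, ?_⟩
    rw [div_mul_eq_mul_div, div_lt_iff₀ (by positivity)]
    nlinarith
  obtain ⟨S, hS⟩ : ∃ S : Finset ℤ, ∑' n : {n // n ∉ S}, ‖k n‖ ^ 2 < t * (ε / 3) :=
    ((tendsto_tsum_compl_atTop_zero fun n => ‖k n‖ ^ 2).eventually_lt_const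
      (by positivity : 0 < t * (ε / 3))).exists
  have hfin : Tendsto (fun z : ℂ => ∑ n ∈ S, ‖k n‖ / ‖z - n‖) farFilter (𝓝 0) := by
    rw [← Finset.sum_const_zero (s := S)]
    refine tendsto_finsetSum _ fun n _ => ?_
    refine Tendsto.div_atTop tendsto_const_nhds ?_
    have : Tendsto (fun z : ℂ => ‖z - n‖) (cobounded ℂ) atTop := by
      refine tendsto_norm_cobounded_atTop.comp ?_
      simp [sub_eq_add_neg]
    exact this.mono_left inf_le_left
  filter_upwards [hfin.eventually_lt_const (by positivity : 0 < ε / 3),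
    (show ∀ᶠ z in farFilter, z ∈ offInt from eventually_farFilter.2 ⟨0, fun z hz _ => hz⟩)]
    with z hz hzoff
  have hs := summable_norm_div_norm_sub hk hzoff
  rw [dist_zero_right, Real.norm_of_nonneg (tsum_nonneg fun n => by positivity),
    ← hs.sum_add_tsum_subtype_compl S]
  have h1 : ∑' n : {n // n ∉ S}, ‖k n‖ / ‖z - (n : ℤ)‖ ≤
      ∑' n : {n // n ∉ S}, (‖k n‖ ^ 2 / t + t * (‖z - (n : ℤ)‖ ^ 2)⁻¹) := by
    refine Summable.tsum_le_tsum (fun n => div_le_of_pos _ _ ht) (hs.subtype _) ?_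
    exact ((hk.subtype _).div_const t).add
      (((summable_inv_norm_sub_sq hzoff).subtype _).mul_left t)
  have hsum : ∑' n : {n // n ∉ S}, (‖k n‖ ^ 2 / t + t * (‖z - (n : ℤ)‖ ^ 2)⁻¹) =
      (∑' n : {n // n ∉ S}, ‖k n‖ ^ 2) / t + t * ∑' n : {n // n ∉ S}, (‖z - (n : ℤ)‖ ^ 2)⁻¹ := by
    rw [← tsum_div_const, ← tsum_mul_left]
    exact Summable.tsum_add ((hk.subtype _).div_const t)
      (((summable_inv_norm_sub_sq hzoff).subtype _).mul_left t)
  rw [hsum] at h1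
  have h2 : (∑' n : {n // n ∉ S}, ‖k n‖ ^ 2) / t < ε / 3 := by
    rw [div_lt_iff₀ ht]; linarith
  have h3 : ∑' n : {n // n ∉ S}, (‖z - (n : ℤ)‖ ^ 2)⁻¹ ≤ A :=
    ((summable_inv_norm_sub_sq hzoff).tsum_subtype_le (fun n : ℤ => (‖z - n‖ ^ 2)⁻¹) _
      (fun n => by positivity)).trans (tsum_inv_norm_sub_sq_le hzoff)
  have h4 := mul_le_mul_of_nonneg_left h3 ht.le
  linarith

lemma norm_le_of_norm_le_sphere {f : ℂ → ℂ} (hf : Differentiable ℂ f) {c : ℂ} {r C : ℝ}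
    (hr : 0 < r) (h : ∀ z ∈ Metric.sphere c r, ‖f z‖ ≤ C) {z : ℂ} (hz : z ∈ Metric.closedBall c r) :
    ‖f z‖ ≤ C := by
  refine Complex.norm_le_of_forall_mem_frontier_norm_le (U := Metric.ball c r)
    Metric.isBounded_ball hf.diffContOnCl ?_ (by rwa [closure_ball _ hr.ne'])
  rwa [frontier_ball _ hr.ne']

/-- An entire function that has a limit along `farFilter` is constant. -/
lemma eq_const_of_tendsto_farFilter {h : ℂ → ℂ} (hh : Differentiable ℂ h) {c : ℂ}
    (hc : Tendsto h farFilter (𝓝 c)) (z : ℂ) : h z = c := by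
  obtain ⟨R, hR⟩ := eventually_farFilter.1
    (hc.norm.eventually_le_const (lt_add_one ‖c‖))
  obtain ⟨M, hM⟩ := (isCompact_closedBall (0 : ℂ) (R + 1)).exists_bound_of_continuousOn
    hh.continuous.continuousOn
  -- A point within `1/4` of an integer is handled by the maximum principle on the circle of radius
  -- `1/4` about that integer, which lies in `offInt`. Moving to the circle costs less than `1/2`,
  -- whence the margin in `R + 1`.
  have hb : ∀ w, ‖h w‖ ≤ max M (‖c‖ + 1) := by
    intro w
    by_cases hw : ‖w‖ ≤ R + 1
    · exact (hM w (by simpa using hw)).trans (le_max_left _ _)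
    refine le_trans ?_ (le_max_right _ _)
    by_cases hoff : w ∈ offInt
    · exact hR w hoff (by linarith)
    obtain ⟨n, hn⟩ : ∃ n : ℤ, ‖w - n‖ < 1 / 4 := by simpa [offInt] using hoff
    refine norm_le_of_norm_le_sphere hh (c := n) (r := 1 / 4) (by norm_num) (fun v hv => ?_)
      (by rw [mem_closedBall_iff_norm]; exact hn.le)
    refine hR v (sphere_subset_offInt n le_rfl (by norm_num) hv) ?_
    rw [mem_sphere_iff_norm] at hv
    have h1 : ‖w‖ ≤ ‖w - n‖ + ‖v - n‖ + ‖v‖ := by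
      calc ‖w‖ = ‖(w - n) - (v - n) + v‖ := by ring_nf
        _ ≤ ‖(w - n) - (v - n)‖ + ‖v‖ := norm_add_le _ _
        _ ≤ _ := by gcongr; exact norm_sub_le _ _
    linarith
  obtain ⟨c', hc'⟩ := hh.exists_eq_const_of_bounded
    (isBounded_iff_forall_norm_le.2 ⟨_, by rintro _ ⟨w, rfl⟩; exact hb w⟩)
  have : c' = c := by
    subst hc'
    exact tendsto_nhds_unique tendsto_const_nhds hc
  rw [hc', ← this]
  rfl

/-- If the entire function `F` vanishes at least to the order of the entire function `G`
everywhere, then `F` is an entire multiple of `G`. -/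
lemma exists_eq_mul_of_analyticOrderAt_le {F G : ℂ → ℂ} (hF : Differentiable ℂ F)
    (hG : Differentiable ℂ G) (hG0 : ∀ z, analyticOrderAt G z ≠ ⊤)
    (hle : ∀ z, analyticOrderAt G z ≤ analyticOrderAt F z) :
    ∃ h : ℂ → ℂ, Differentiable ℂ h ∧ ∀ z, F z = h z * G z := by
  have key : ∀ z, ∃ u : ℂ → ℂ, AnalyticAt ℂ u z ∧
      (∀ᶠ w in 𝓝 z, F w = u w * G w) ∧ ∀ᶠ w in 𝓝[≠] z, F w / G w = u w := by
    intro z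
    obtain ⟨g, hg, hgz, hGg⟩ := (hG.analyticAt z).analyticOrderAt_ne_top.1 (hG0 z)
    have hn : (analyticOrderNatAt G z : ℕ∞) ≤ analyticOrderAt F z := by
      rw [Nat.cast_analyticOrderNatAt (hG0 z)]; exact hle z
    obtain ⟨f, hf, hFf⟩ := (natCast_le_analyticOrderAt (hF.analyticAt z)).1 hn
    have hgne : ∀ᶠ w in 𝓝 z, g w ≠ 0 := hg.continuousAt.eventually_ne hgz
    refine ⟨fun w => f w / g w, hf.div hg hgz, ?_, ?_⟩
    · filter_upwards [hGg, hFf, hgne] with w h1 h2 h3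
      rw [h1, h2, smul_eq_mul, smul_eq_mul]
      field_simp
    · filter_upwards [hGg.filter_mono nhdsWithin_le_nhds, hFf.filter_mono nhdsWithin_le_nhds,
        hgne.filter_mono nhdsWithin_le_nhds, self_mem_nhdsWithin] with w h1 h2 h3 h4
      have h5 : (w - z) ^ analyticOrderNatAt G z ≠ 0 := pow_ne_zero _ (sub_ne_zero.2 h4)
      rw [h1, h2, smul_eq_mul, smul_eq_mul, mul_div_mul_left _ _ h5]
  choose u hu1 hu2 hu3 using key
  have hlim : ∀ z, Tendsto (fun w => F w / G w) (𝓝[≠] z) (𝓝 (u z z)) := fun z =>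
    ((hu1 z).continuousAt.tendsto.mono_left nhdsWithin_le_nhds).congr'
      ((hu3 z).mono fun w hw => hw.symm)
  -- The local quotients glue along the diagonal: at a point `w ≠ z` close to `z`, both `u w w` and
  -- `u z w` are the limit of `F / G` at `w`.
  have heq : ∀ z, (fun w => u w w) =ᶠ[𝓝 z] u z := by
    intro z
    have h1 : ∀ᶠ w in 𝓝[≠] z, u w w = u z w := by
      have h2 := eventually_nhdsWithin_iff.1 (hu3 z)
      filter_upwards [eventually_nhdsWithin_of_eventually_nhds h2.eventually_nhds,
        eventually_nhdsWithin_of_eventually_nhds (hu1 z).eventually_analyticAt,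
        self_mem_nhdsWithin] with w h3 h4 h5
      refine tendsto_nhds_unique (hlim w) ?_
      refine (h4.continuousAt.tendsto.mono_left nhdsWithin_le_nhds).congr' ?_
      filter_upwards [h3.filter_mono nhdsWithin_le_nhds,
        (eventually_ne_nhds h5).filter_mono nhdsWithin_le_nhds] with v h6 h7
      exact (h6 h7).symm
    rw [eventually_nhdsWithin_iff] at h1
    filter_upwards [h1] with w hw
    by_cases h : w = z
    · rw [h]
    · exact hw h
  refine ⟨fun z => u z z, fun z => ?_, fun z => (hu2 z).self_of_nhds⟩
  exact ((hu1 z).congr (heq z).symm).differentiableAt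

/-- An entire function comparable with the sine far from the integers has isolated zeros. -/
lemma analyticOrderAt_ne_top_of_tendsto {G : ℂ → ℂ} (hG : Differentiable ℂ G) {c : ℂ}
    (hc : Tendsto (fun z => G z / Complex.sin (z * Real.pi)) farFilter (𝓝 c)) (hc0 : c ≠ 0)
    (z : ℂ) : analyticOrderAt G z ≠ ⊤ := by
  intro htop
  have h0 : ∀ w, G w = 0 := fun w =>
    (hG.differentiableOn.analyticOnNhd isOpen_univ).eqOn_zero_of_preconnected_of_eventuallyEq_zero
      isPreconnected_univ (mem_univ z) (analyticOrderAt_eq_top.1 htop) (mem_univ w)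
  obtain ⟨w, hw⟩ := (hc.eventually_ne hc0).exists
  exact hw (by rw [h0, zero_div])

/-- Two entire functions comparable with the sine far from the integers are proportional, if one
vanishes at least to the order of the other everywhere. -/
theorem eq_mul_of_analyticOrderAt_le {F G : ℂ → ℂ} (hF : Differentiable ℂ F)
    (hG : Differentiable ℂ G) (hle : ∀ z, analyticOrderAt G z ≤ analyticOrderAt F z) {cF cG : ℂ}
    (hcF : Tendsto (fun z => F z / Complex.sin (z * Real.pi)) farFilter (𝓝 cF))
    (hcG : Tendsto (fun z => G z / Complex.sin (z * Real.pi)) farFilter (𝓝 cG)) (hcG0 : cG ≠ 0)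
    (z : ℂ) : F z = cF / cG * G z := by
  have hne := hcG.eventually_ne hcG0
  obtain ⟨h, hh, hFh⟩ := exists_eq_mul_of_analyticOrderAt_le hF hG
    (analyticOrderAt_ne_top_of_tendsto hG hcG hcG0) hle
  rw [hFh, eq_const_of_tendsto_farFilter hh ((hcF.div hcG hcG0).congr' ?_) z]
  filter_upwards [hne] with w hw
  have h1 : Complex.sin (w * Real.pi) ≠ 0 := fun h0 => hw (by rw [h0, div_zero])
  have h2 : G w ≠ 0 := fun h0 => hw (by rw [h0, zero_div])
  simp only [Pi.div_apply, hFh]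
  field_simp

end DelayDirac

/-! ### Infinite products of entire functions and the orders of their zeros -/

namespace DelayDirac

open Filter Topology Bornology Set

section InfiniteProducts

variable {ι : Type*}

lemma norm_tprod_one_add_sub_one_le {x : ι → ℂ} (hx : Summable fun i => ‖x i‖) :
    ‖∏' i, (1 + x i) - 1‖ ≤ Real.exp (∑' i, ‖x i‖) - 1 := by
  have h := (multipliable_one_add_of_summable hx).hasProd
  refine le_of_tendsto ((h.sub_const 1).norm) (Eventually.of_forall fun s => ?_)
  refine (Finset.norm_prod_one_add_sub_one_le s x).trans ?_
  gcongr
  exact hx.sum_le_tsum s fun i _ => norm_nonneg _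

/-- Entire functions `a i` for which `∑ a i` converges normally on bounded sets. -/
structure NormallySummable (a : ι → ℂ → ℂ) : Prop where
  differentiable : ∀ i, Differentiable ℂ (a i)
  bound : ∀ R : ℝ, ∃ u : ι → ℝ, Summable u ∧ ∀ᶠ i in cofinite, ∀ z : ℂ, ‖z‖ ≤ R → ‖a i z‖ ≤ u i

variable {a : ι → ℂ → ℂ}

lemma NormallySummable.summable_norm (ha : NormallySummable a) (z : ℂ) :
    Summable fun i => ‖a i z‖ := by
  obtain ⟨u, hu, h⟩ := ha.bound ‖z‖
  refine hu.of_norm_bounded_eventually ?_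
  filter_upwards [h] with i hi
  simpa using hi z le_rfl

lemma NormallySummable.multipliable (ha : NormallySummable a) (z : ℂ) :
    Multipliable fun i => 1 + a i z :=
  multipliable_one_add_of_summable (ha.summable_norm z)

lemma NormallySummable.differentiable_tprod (ha : NormallySummable a) :
    Differentiable ℂ fun z => ∏' i, (1 + a i z) := by
  intro z
  obtain ⟨u, hu, h⟩ := ha.bound (‖z‖ + 1)
  have hd := (hu.hasProdLocallyUniformlyOn_one_add (K := Metric.ball (0 : ℂ) (‖z‖ + 1))
    Metric.isOpen_ball (f := a) ?_ fun i => (ha.differentiable i).continuous.continuousOn)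
  · rw [hasProdLocallyUniformlyOn_iff_tendstoLocallyUniformlyOn] at hd
    have := hd.differentiableOn (Eventually.of_forall fun s =>
      DifferentiableOn.fun_finsetProd fun i _ =>
        ((ha.differentiable i).const_add 1).differentiableOn) Metric.isOpen_ball
    exact this.differentiableAt (Metric.isOpen_ball.mem_nhds (by simp))
  · filter_upwards [h] with i hi w hw
    exact hi w (by simpa using (mem_ball_zero_iff.1 hw).le)

lemma analyticOrderAt_finsetProd {s : Finset ι} {f : ι → ℂ → ℂ} {z : ℂ}
    (hf : ∀ i ∈ s, AnalyticAt ℂ (f i) z) :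
    analyticOrderAt (fun w => ∏ i ∈ s, f i w) z = ∑ i ∈ s, analyticOrderAt (f i) z := by
  classical
  induction s using Finset.induction_on with
  | empty => simp [analyticOrderAt_eq_zero]
  | insert i s hi ih =>
    simp only [Finset.prod_insert hi, Finset.sum_insert hi]
    rw [← ih fun j hj => hf j (Finset.mem_insert_of_mem hj)]
    exact analyticOrderAt_mul (hf i (Finset.mem_insert_self i s))
      (Finset.analyticAt_fun_prod s fun j hj => hf j (Finset.mem_insert_of_mem hj))

lemma NormallySummable.finite_zeros (ha : NormallySummable a) (z : ℂ) :
    {i | 1 + a i z = 0}.Finite := by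
  have h : ∀ᶠ i in cofinite, 1 + a i z ≠ 0 := by
    filter_upwards [(ha.summable_norm z).tendsto_cofinite_zero.eventually_lt_const one_pos]
      with i hi h0
    rw [eq_neg_of_add_eq_zero_right h0] at hi
    simp at hi
  simpa [eventually_cofinite] using h

/-- If all the zeros of the factors are simple, then the order of a zero of the product is the
number of factors that vanish. -/
lemma NormallySummable.analyticOrderAt_tprod (ha : NormallySummable a) (z : ℂ)
    (hs : ∀ i, 1 + a i z = 0 → analyticOrderAt (fun w => 1 + a i w) z = 1) :
    analyticOrderAt (fun w => ∏' i, (1 + a i w)) z = {i | 1 + a i z = 0}.encard := by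
  classical
  set S := (ha.finite_zeros z).toFinset with hS
  have hmem : ∀ i, i ∈ S ↔ 1 + a i z = 0 := fun i => by simp [hS]
  -- Replacing the finitely many factors that vanish at `z` by `1` leaves a product that is nonzero
  -- at `z`, so the order comes from a finite product.
  set b : ι → ℂ → ℂ := fun i w => if i ∈ S then 0 else a i w with hb
  have hbn : NormallySummable b := by
    refine ⟨fun i => ?_, fun R => ?_⟩
    · by_cases hi : i ∈ S
      · simp [hb, hi]
      · simpa [hb, hi] using ha.differentiable i
    · obtain ⟨u, hu, h⟩ := ha.bound R
      refine ⟨u, hu, ?_⟩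
      filter_upwards [h, S.finite_toSet.compl_mem_cofinite] with i hi hiS w hw
      have : i ∉ S := hiS
      simpa [hb, this] using hi w hw
  have hfac : (fun w => ∏' i, (1 + a i w)) =
      (fun w => ∏ i ∈ S, (1 + a i w)) * fun w => ∏' i, (1 + b i w) := by
    funext w
    have h1 : ∀ i, 1 + a i w = (if i ∈ S then 1 + a i w else 1) * (1 + b i w) := fun i => by
      by_cases hi : i ∈ S <;> simp [hb, hi]
    have h2 : ∏ i ∈ S, (1 + a i w) = ∏ i ∈ S, if i ∈ S then 1 + a i w else 1 :=
      Finset.prod_congr rfl fun i hi => by simp [hi]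
    rw [Pi.mul_apply, h2, tprod_congr h1]
    have h3 : HasProd (fun i => if i ∈ S then 1 + a i w else 1)
        (∏ i ∈ S, if i ∈ S then 1 + a i w else 1) :=
      hasProd_prod_of_ne_finset_one fun i hi => by simp [hi]
    exact (h3.mul (hbn.multipliable w).hasProd).tprod_eq
  have han : ∀ i, AnalyticAt ℂ (fun w => 1 + a i w) z := fun i =>
    ((ha.differentiable i).const_add 1).analyticAt z
  rw [hfac, analyticOrderAt_mul (Finset.analyticAt_fun_prod S fun i _ => han i)
    (hbn.differentiable_tprod.analyticAt z), analyticOrderAt_finsetProd fun i _ => han i,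
    Finset.sum_congr rfl fun i hi => hs i ((hmem i).1 hi)]
  have h0 : analyticOrderAt (fun w => ∏' i, (1 + b i w)) z = 0 := by
    rw [(hbn.differentiable_tprod.analyticAt z).analyticOrderAt_eq_zero]
    refine tprod_one_add_ne_zero_of_summable (fun i => ?_) (hbn.summable_norm z)
    by_cases hi : i ∈ S
    · simp [hb, hi]
    · simpa [hb, hi] using fun h => hi ((hmem i).2 h)
  have hSset : {i | 1 + a i z = 0} = (S : Set ι) := by
    ext i; simp [hS]
  rw [h0, add_zero, hSset, encard_coe_eq_coe_finsetCard]
  simp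

end InfiniteProducts

section CanonicalProducts

variable {ι : Type*}

/-- The factors of a canonical product of genus one, minus one. -/
noncomputable def factorSubOne (ρ μ : ι → ℂ) (i : ι) (l : ℂ) : ℂ :=
  (μ i - l) / ρ i * Complex.exp (l / ρ i) - 1

lemma one_add_factorSubOne (ρ μ : ι → ℂ) (i : ι) (l : ℂ) :
    1 + factorSubOne ρ μ i l = (μ i - l) / ρ i * Complex.exp (l / ρ i) := by
  simp [factorSubOne]

/-- The exponential in a genus-one Weierstrass factor cancels the linear term. -/
lemma norm_one_sub_mul_exp_sub_one_le {w : ℂ} (hw : ‖w‖ ≤ 1) :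
    ‖(1 - w) * Complex.exp w - 1‖ ≤ 3 * ‖w‖ ^ 2 := by
  have h1 := Complex.norm_exp_sub_one_sub_id_le hw
  have h2 : (1 - w) * Complex.exp w - 1 = (1 - w) * (Complex.exp w - 1 - w) - w ^ 2 := by ring
  have h3 : ‖1 - w‖ ≤ 2 := (norm_sub_le _ _).trans (by rw [norm_one]; linarith)
  rw [h2]
  calc _ ≤ ‖1 - w‖ * ‖Complex.exp w - 1 - w‖ + ‖w‖ ^ 2 := by
        refine (norm_sub_le _ _).trans ?_
        rw [norm_mul, norm_pow]
    _ ≤ 2 * ‖w‖ ^ 2 + ‖w‖ ^ 2 := by gcongr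
    _ = _ := by ring

/-- Writing `μ - l = (μ - ρ) + (ρ - l)` splits a factor into a Weierstrass factor at `l / ρ`, with
quadratic error, and a term of size `|μ - ρ| / |ρ|`, summable as a product of two `ℓ₂` sequences. -/
lemma normallySummable_factorSubOne {ρ μ : ι → ℂ} (hρ : Summable fun i => (‖ρ i‖ ^ 2)⁻¹)
    (hρ0 : ∀ i, ρ i ≠ 0) (hμ : Summable fun i => ‖μ i - ρ i‖ ^ 2) :
    NormallySummable (factorSubOne ρ μ) := by
  refine ⟨fun i => ?_, fun R => ?_⟩
  · unfold factorSubOne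
    fun_prop
  refine ⟨fun i => 3 * (‖μ i - ρ i‖ ^ 2 / 1 + 1 * (‖ρ i‖ ^ 2)⁻¹) + 3 * R ^ 2 * (‖ρ i‖ ^ 2)⁻¹,
    (((hμ.div_const 1).add (hρ.mul_left 1)).mul_left 3).add (hρ.mul_left (3 * R ^ 2)), ?_⟩
  -- For all but finitely many indices this says `‖ρ i‖ > |R| + 1`, so that `‖z / ρ i‖ ≤ 1`.
  have hsmall : ∀ᶠ i in cofinite, (‖ρ i‖ ^ 2)⁻¹ < ((|R| + 1) ^ 2)⁻¹ :=
    hρ.tendsto_cofinite_zero.eventually_lt_const (by positivity)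
  filter_upwards [hsmall] with i hi z hz
  have hpos : 0 < ‖ρ i‖ := norm_pos_iff.2 (hρ0 i)
  have hR : R ≤ ‖ρ i‖ := by
    have := (inv_lt_inv₀ (by positivity) (by positivity)).1 hi
    have := lt_of_pow_lt_pow_left₀ 2 hpos.le this
    linarith [le_abs_self R]
  have hw : ‖z / ρ i‖ ≤ 1 := by
    rw [norm_div]; exact div_le_one_of_le₀ (hz.trans hR) hpos.le
  have hexp : ‖Complex.exp (z / ρ i)‖ ≤ 3 := by
    refine (Complex.norm_exp_le_exp_norm _).trans ?_
    exact (Real.exp_le_exp.2 hw).trans (by linarith [Real.exp_one_lt_d9])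
  have heq : factorSubOne ρ μ i z = (μ i - ρ i) / ρ i * Complex.exp (z / ρ i) +
      ((1 - z / ρ i) * Complex.exp (z / ρ i) - 1) := by
    have := hρ0 i
    unfold factorSubOne
    field_simp
    ring
  rw [heq]
  calc _ ≤ ‖μ i - ρ i‖ / ‖ρ i‖ * ‖Complex.exp (z / ρ i)‖ + 3 * ‖z / ρ i‖ ^ 2 := by
        refine (norm_add_le _ _).trans ?_
        rw [norm_mul, norm_div]
        gcongr
        exact norm_one_sub_mul_exp_sub_one_le hw
    _ ≤ (‖μ i - ρ i‖ ^ 2 / 1 + 1 * (‖ρ i‖ ^ 2)⁻¹) * 3 + 3 * (R / ‖ρ i‖) ^ 2 := by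
        rw [norm_div]
        gcongr
        exact div_le_of_pos _ _ one_pos
    _ = _ := by rw [div_pow]; ring

lemma analyticOrderAt_one_add_factorSubOne {ρ μ : ι → ℂ} {i : ι} (hρ0 : ρ i ≠ 0) {z : ℂ}
    (h : 1 + factorSubOne ρ μ i z = 0) :
    analyticOrderAt (fun w => 1 + factorSubOne ρ μ i w) z = 1 := by
  simp only [one_add_factorSubOne] at h ⊢
  have hz : μ i = z := by
    simpa [hρ0, Complex.exp_ne_zero, sub_eq_zero] using h
  rw [← Nat.cast_one, AnalyticAt.analyticOrderAt_eq_natCast (by fun_prop)]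
  refine ⟨fun w => -(Complex.exp (w / ρ i) / ρ i), by fun_prop (disch := assumption), ?_, ?_⟩
  · simp [hρ0, Complex.exp_ne_zero]
  · filter_upwards with w
    rw [hz]; simp only [pow_one, smul_eq_mul]; ring

lemma one_add_factorSubOne_eq_zero_iff {ρ μ : ι → ℂ} {i : ι} (hρ0 : ρ i ≠ 0) {z : ℂ} :
    1 + factorSubOne ρ μ i z = 0 ↔ μ i = z := by
  simp [one_add_factorSubOne, hρ0, Complex.exp_ne_zero, sub_eq_zero]

/-- Comparison of the canonical products over `μ` and over `ρ`. -/
lemma tprod_factor_eq_mul {ρ μ : ι → ℂ} (hρ : Summable fun i => (‖ρ i‖ ^ 2)⁻¹)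
    (hρ0 : ∀ i, ρ i ≠ 0) {l : ℂ} (hl : ∀ i, ρ i ≠ l)
    (hμl : Summable fun i => ‖(μ i - ρ i) / (ρ i - l)‖) :
    ∏' i, (μ i - l) / ρ i * Complex.exp (l / ρ i) =
      (∏' i, (ρ i - l) / ρ i * Complex.exp (l / ρ i)) *
        ∏' i, (1 + (μ i - ρ i) / (ρ i - l)) := by
  have h1 : Multipliable fun i => (ρ i - l) / ρ i * Complex.exp (l / ρ i) := by
    have := (normallySummable_factorSubOne (μ := ρ) hρ hρ0
      (by simp)).multipliable l
    simpa only [one_add_factorSubOne] using this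
  rw [← h1.tprod_mul (multipliable_one_add_of_summable hμl)]
  refine tprod_congr fun i => ?_
  have := hρ0 i
  have : ρ i - l ≠ 0 := sub_ne_zero.2 (hl i)
  field_simp
  ring

end CanonicalProducts

end DelayDirac

/-! ### The canonical products `prod1` and `prod2` -/

namespace DelayDirac

open Filter Topology Bornology Set

lemma half_mem_offInt : (1 / 2 : ℂ) ∈ offInt := by
  refine sphere_subset_offInt 0 (r := 1 / 2) (by norm_num) (by norm_num) ?_
  rw [mem_sphere_iff_norm]
  norm_num

lemma int_sub_half_ne_zero (n : ℤ) : (n : ℂ) - 1 / 2 ≠ 0 := by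
  intro h
  have h1 := half_mem_offInt n
  rw [norm_sub_rev, h] at h1
  norm_num at h1

lemma summable_inv_norm_int_sub_half_sq : Summable fun n : ℤ => (‖(n : ℂ) - 1 / 2‖ ^ 2)⁻¹ := by
  simpa only [norm_sub_rev] using summable_inv_norm_sub_sq half_mem_offInt

lemma summable_inv_norm_int_sq :
    Summable fun n : {n : ℤ // n ≠ 0} => (‖((n : ℤ) : ℂ)‖ ^ 2)⁻¹ := by
  have h := ((Real.summable_one_div_int_pow (p := 2)).2 one_lt_two).subtype {n : ℤ | n ≠ 0}
  refine h.congr fun n => ?_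
  simp

lemma int_cast_ne_zero_of_ne (n : {n : ℤ // n ≠ 0}) : ((n : ℤ) : ℂ) ≠ 0 := by
  exact_mod_cast n.2

lemma mul_tprod_ne_zero {f : ℤ → ℂ} (hf : Multipliable fun n : {n : ℤ // n ≠ 0} => f n) :
    f 0 * ∏' n : {n : ℤ // n ≠ 0}, f n = ∏' n, f n := by
  have h := Multipliable.tprod_mul_tprod_compl (f := f) (s := {0}) Multipliable.of_finite hf
  rw [← h, tprod_singleton]
  rfl

/-- Euler's product for the sine over the non-zero integers. -/
lemma tprod_int_ne_zero_eq_sin (l : ℂ) :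
    (Real.pi : ℂ) * l *
      ∏' n : {n : ℤ // n ≠ 0}, (((n : ℤ) : ℂ) - l) / ((n : ℤ) : ℂ) * Complex.exp (l / ((n : ℤ) : ℂ)) =
      Complex.sin (l * Real.pi) := by
  set g : ℤ → ℂ := fun n => if n = 0 then 1 else ((n : ℂ) - l) / n * Complex.exp (l / n) with hg
  have hgn : ∀ n : {n : ℤ // n ≠ 0},
      g n = (((n : ℤ) : ℂ) - l) / ((n : ℤ) : ℂ) * Complex.exp (l / ((n : ℤ) : ℂ)) := fun n => by
    simp [hg, n.2]
  have hm : Multipliable fun n : {n : ℤ // n ≠ 0} => g n := by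
    simp only [hgn]
    have := (normallySummable_factorSubOne
      (ρ := fun n : {n : ℤ // n ≠ 0} => ((n : ℤ) : ℂ)) (μ := fun n => ((n : ℤ) : ℂ))
      summable_inv_norm_int_sq int_cast_ne_zero_of_ne (by simp)).multipliable l
    simpa only [one_add_factorSubOne] using this
  have hm' : Multipliable g :=
    ((Multipliable.of_finite (f := g ∘ ((↑) : ({0} : Set ℤ) → ℤ))).hasProd.mul_compl
      hm.hasProd).multipliable
  -- Pairing `n` with `-n` cancels the exponentials and leaves Euler's factors `1 - l²/n²`. The
  -- value `g 0 = 1` makes the index zero, which the pairing counts twice, harmless.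
  have h1 := (hm'.hasProd.nat_mul_neg).tendsto_prod_nat
  have h2 := (h1.comp (tendsto_add_atTop_nat 1)).const_mul ((Real.pi : ℂ) * l)
  have h3 := Complex.tendsto_euler_sin_prod l
  rw [← tprod_congr hgn]
  have h4 := mul_tprod_ne_zero hm
  simp only [show g 0 = 1 by simp [hg], one_mul] at h4
  rw [h4, mul_comm l]
  simp only [show g 0 = 1 by simp [hg], mul_one] at h2
  refine tendsto_nhds_unique (h2.congr fun N => ?_) h3
  simp only [Function.comp_apply]
  rw [Finset.prod_range_succ']
  simp only [show g 0 = 1 by simp [hg], Nat.cast_zero, neg_zero, mul_one]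
  congr 1
  refine Finset.prod_congr rfl fun j _ => ?_
  have hj : ((j : ℂ) + 1) ≠ 0 := Nat.cast_add_one_ne_zero j
  have hj' : ((j : ℤ) + 1) ≠ 0 := by positivity
  simp only [hg, Nat.cast_add, Nat.cast_one, hj', if_false, neg_eq_zero, Int.cast_neg,
    Int.cast_add, Int.cast_natCast, Int.cast_one]
  have : Complex.exp (l / ((j : ℂ) + 1)) * Complex.exp (l / (-((j : ℂ) + 1))) = 1 := by
    rw [← Complex.exp_add, div_neg, add_neg_cancel, Complex.exp_zero]
  calc _ = (((j : ℂ) + 1 - l) / (j + 1)) * ((-((j : ℂ) + 1) - l) / (-(j + 1))) *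
        (Complex.exp (l / ((j : ℂ) + 1)) * Complex.exp (l / (-((j : ℂ) + 1)))) := by ring
    _ = _ := by rw [this]; field_simp; ring

lemma int_ne_of_mem_offInt {z : ℂ} (hz : z ∈ offInt) (n : ℤ) : (n : ℂ) ≠ z := by
  intro h
  have := hz n
  rw [h, sub_self, norm_zero] at this
  norm_num at this

lemma summable_norm_div_int_sub {k : ℤ → ℂ} (hk : Summable fun n => ‖k n‖ ^ 2) {z : ℂ}
    (hz : z ∈ offInt) : Summable fun n : ℤ => ‖k n / (n - z)‖ := by
  simpa only [norm_div, norm_sub_rev] using summable_norm_div_norm_sub hk hz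

variable {μ : ℤ → ℂ}

lemma normallySummable_prod1 (hμ : Summable fun n : ℤ => ‖μ n - n‖ ^ 2) :
    NormallySummable (factorSubOne (fun n : {n : ℤ // n ≠ 0} => ((n : ℤ) : ℂ)) fun n => μ n) :=
  normallySummable_factorSubOne summable_inv_norm_int_sq int_cast_ne_zero_of_ne (hμ.subtype _)

lemma prod1_eq_tprod_one_add : prod1 μ = (fun l => (Real.pi : ℂ) * (μ 0 - l)) * fun l =>
    ∏' n, (1 + factorSubOne (fun n : {n : ℤ // n ≠ 0} => ((n : ℤ) : ℂ)) (fun n => μ n) n l) := by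
  funext l
  simp only [one_add_factorSubOne, Pi.mul_apply]
  rfl

lemma differentiable_prod1 (hμ : Summable fun n : ℤ => ‖μ n - n‖ ^ 2) :
    Differentiable ℂ (prod1 μ) := by
  rw [prod1_eq_tprod_one_add]
  exact Differentiable.mul (by fun_prop) (normallySummable_prod1 hμ).differentiable_tprod

/-- The zeros of the canonical product are the members of the sequence, with multiplicity. -/
lemma analyticOrderAt_prod1 (hμ : Summable fun n : ℤ => ‖μ n - n‖ ^ 2) (z : ℂ) :
    analyticOrderAt (prod1 μ) z = {n | μ n = z}.encard := by
  rw [prod1_eq_tprod_one_add, analyticOrderAt_mul (by fun_prop)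
    ((normallySummable_prod1 hμ).differentiable_tprod.analyticAt z),
    (normallySummable_prod1 hμ).analyticOrderAt_tprod z fun i hi =>
      analyticOrderAt_one_add_factorSubOne (int_cast_ne_zero_of_ne i) hi]
  have h1 : analyticOrderAt (fun l => (Real.pi : ℂ) * (μ 0 - l)) z =
      ({n : ℤ | n = 0 ∧ μ n = z}).encard := by
    by_cases h : μ 0 = z
    · have hs : {n : ℤ | n = 0 ∧ μ n = z} = {0} := by
        ext n; simp only [mem_ofPred_eq, mem_singleton_iff]
        exact ⟨fun hn => hn.1, fun hn => ⟨hn, hn ▸ h⟩⟩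
      rw [hs, encard_singleton, ← Nat.cast_one, AnalyticAt.analyticOrderAt_eq_natCast (by fun_prop)]
      refine ⟨fun _ => -Real.pi, by fun_prop, by simp [Real.pi_ne_zero], ?_⟩
      filter_upwards with w
      rw [h]; simp only [pow_one, smul_eq_mul]; ring
    · have hs : {n : ℤ | n = 0 ∧ μ n = z} = ∅ := by
        ext n; simp only [mem_ofPred_eq, mem_empty_iff_false, iff_false, not_and]
        rintro rfl; exact h
      rw [hs, encard_empty, AnalyticAt.analyticOrderAt_eq_zero (by fun_prop)]
      simpa [Real.pi_ne_zero, sub_eq_zero] using h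
  have h2 : {i : {n : ℤ // n ≠ 0} | 1 + factorSubOne (fun n : {n : ℤ // n ≠ 0} => ((n : ℤ) : ℂ))
      (fun n => μ n) i z = 0}.encard = {n : ℤ | n ≠ 0 ∧ μ n = z}.encard := by
    rw [← Subtype.val_injective.encard_image]
    congr 1
    ext n
    constructor
    · rintro ⟨i, hi, rfl⟩
      exact ⟨i.2, (one_add_factorSubOne_eq_zero_iff (int_cast_ne_zero_of_ne i)).1 hi⟩
    · rintro ⟨hn, hz⟩
      exact ⟨⟨n, hn⟩, (one_add_factorSubOne_eq_zero_iff (int_cast_ne_zero_of_ne ⟨n, hn⟩)).2 hz, rfl⟩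
  rw [h1, h2, ← encard_union_eq]
  · congr 1
    ext n
    simp only [mem_union, mem_ofPred_eq]
    tauto
  · rw [disjoint_left]
    rintro n ⟨h, _⟩ ⟨h', _⟩
    exact h' h

/-- Termwise division by Euler's product. The sign comes from the zeroth factor `π(μ₀ - z) = -πz(1 +
μ₀/(0 - z))`. -/
lemma prod1_eq_sin_mul (hμ : Summable fun n : ℤ => ‖μ n - n‖ ^ 2) {z : ℂ} (hz : z ∈ offInt) :
    prod1 μ z = -Complex.sin (z * Real.pi) * ∏' n : ℤ, (1 + (μ n - n) / (n - z)) := by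
  have hs := summable_norm_div_int_sub hμ hz
  have hs' := hs.subtype {n : ℤ | n ≠ 0}
  rw [← mul_tprod_ne_zero (f := fun n : ℤ => 1 + (μ n - n) / (n - z))
    (multipliable_one_add_of_summable hs'), ← tprod_int_ne_zero_eq_sin z, prod1,
    tprod_factor_eq_mul (ρ := fun n : {n : ℤ // n ≠ 0} => ((n : ℤ) : ℂ)) (μ := fun n => μ n)
      summable_inv_norm_int_sq int_cast_ne_zero_of_ne (fun n => int_ne_of_mem_offInt hz n) hs']
  have hz0 : z ≠ 0 := by simpa using (int_ne_of_mem_offInt hz 0).symm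
  simp only [Int.cast_zero, sub_zero, zero_sub]
  have : (1 + μ 0 / -z) = (μ 0 - z) / (-z) := by field_simp; ring
  rw [this]
  field_simp

lemma mem_offInt_eventually : ∀ᶠ z in farFilter, z ∈ offInt :=
  eventually_farFilter.2 ⟨0, fun _ hz _ => hz⟩

lemma sin_ne_zero_of_mem_offInt {z : ℂ} (hz : z ∈ offInt) : Complex.sin (z * Real.pi) ≠ 0 := by
  rw [Ne, Complex.sin_eq_zero_iff]
  rintro ⟨k, hk⟩
  have : (Real.pi : ℂ) ≠ 0 := by exact_mod_cast Real.pi_ne_zero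
  exact int_ne_of_mem_offInt hz k (mul_right_cancel₀ this hk).symm

/-- Far from the integers the canonical product behaves like `-sin`. -/
lemma tendsto_prod1_div_sin (hμ : Summable fun n : ℤ => ‖μ n - n‖ ^ 2) :
    Tendsto (fun z => prod1 μ z / Complex.sin (z * Real.pi)) farFilter (𝓝 (-1)) := by
  have h0 : Tendsto (fun z : ℂ => ∏' n : ℤ, (1 + (μ n - n) / (n - z))) farFilter (𝓝 1) := by
    rw [tendsto_iff_norm_sub_tendsto_zero]
    have h1 := (Real.continuous_exp.tendsto' 0 1 Real.exp_zero).comp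
      (tendsto_tsum_norm_div_norm_sub hμ)
    have h2 := h1.sub_const 1
    rw [sub_self] at h2
    refine squeeze_zero' (Eventually.of_forall fun z => norm_nonneg _) ?_ h2
    filter_upwards [mem_offInt_eventually] with z hz
    refine (norm_tprod_one_add_sub_one_le (summable_norm_div_int_sub hμ hz)).trans (le_of_eq ?_)
    simp only [norm_div, norm_sub_rev (_ : ℂ) z, Function.comp_apply]
  refine (h0.neg).congr' ?_
  filter_upwards [mem_offInt_eventually] with z hz
  have := sin_ne_zero_of_mem_offInt hz
  rw [prod1_eq_sin_mul hμ hz]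
  field_simp

lemma differentiable_prod2 (hμ : Summable fun n : ℤ => ‖μ n - ((n : ℂ) - 1 / 2)‖ ^ 2) :
    Differentiable ℂ (prod2 μ) := by
  have := (normallySummable_factorSubOne (ρ := fun n : ℤ => (n : ℂ) - 1 / 2)
    summable_inv_norm_int_sub_half_sq int_sub_half_ne_zero hμ).differentiable_tprod
  simp only [one_add_factorSubOne] at this
  exact this

/-- Uses `sin 2πl = 2 sin πl cos πl`: in Euler's product for `sin 2πl` the even indices give `sin
πl`, and the odd ones form the product sought. Dividing by `sin πl` is the reason for the
hypothesis. -/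
lemma tprod_half_int_eq_cos {l : ℂ} (hl : Complex.sin (l * Real.pi) ≠ 0) :
    ∏' n : ℤ, ((n : ℂ) - 1 / 2 - l) / ((n : ℂ) - 1 / 2) * Complex.exp (l / ((n : ℂ) - 1 / 2)) =
      Complex.cos (l * Real.pi) := by
  set g : ℤ → ℂ := fun n => ((n : ℂ) - 1 / 2 - l) / ((n : ℂ) - 1 / 2) *
    Complex.exp (l / ((n : ℂ) - 1 / 2)) with hg
  have hm : Multipliable g := by
    have := (normallySummable_factorSubOne (ρ := fun n : ℤ => (n : ℂ) - 1 / 2)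
      (μ := fun n : ℤ => (n : ℂ) - 1 / 2) summable_inv_norm_int_sub_half_sq int_sub_half_ne_zero
      (by simp)).multipliable l
    simpa only [one_add_factorSubOne] using this
  -- After this shift the pairing of `k` with `-(k + 1)` matches the opposite half-integers `k +
  -- 1/2` and `-k - 1/2`.
  have h1 : HasProd (g ∘ Equiv.addRight (1 : ℤ)) (∏' n, g n) :=
    (Equiv.addRight (1 : ℤ)).hasProd_iff.2 hm.hasProd
  have h2 := h1.nat_mul_neg_add_one.tendsto_prod_nat
  have h3 : ∀ k : ℕ, (g ∘ Equiv.addRight (1 : ℤ)) k * (g ∘ Equiv.addRight (1 : ℤ)) (-(k + 1)) =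
      1 - (2 * l) ^ 2 / ((2 * k : ℕ) + 1) ^ 2 := by
    intro k
    have hk : (2 * (k : ℂ) + 1) ≠ 0 := by exact_mod_cast Nat.succ_ne_zero (2 * k)
    have e1 : ((k : ℂ) + 1 - 1 / 2) = (2 * k + 1) / 2 := by ring
    have e2 : (-((k : ℂ) + 1) + 1 - 1 / 2) = -((2 * k + 1) / 2) := by ring
    simp only [hg, Function.comp_apply, Equiv.coe_addRight, Int.cast_add, Int.cast_natCast,
      Int.cast_one, Int.cast_neg, e1, e2, Nat.cast_mul, Nat.cast_ofNat]
    have : Complex.exp (l / ((2 * (k : ℂ) + 1) / 2)) * Complex.exp (l / -((2 * (k : ℂ) + 1) / 2)) = 1 := by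
      rw [← Complex.exp_add, div_neg, add_neg_cancel, Complex.exp_zero]
    calc _ = (((2 * (k : ℂ) + 1) / 2 - l) / ((2 * k + 1) / 2)) *
          ((-((2 * (k : ℂ) + 1) / 2) - l) / (-((2 * k + 1) / 2))) *
          (Complex.exp (l / ((2 * (k : ℂ) + 1) / 2)) *
            Complex.exp (l / -((2 * (k : ℂ) + 1) / 2))) := by ring
      _ = _ := by rw [this]; field_simp; ring
  simp only [h3] at h2
  have h4 := Complex.tendsto_euler_sin_prod l
  have h5 := (Complex.tendsto_euler_sin_prod (2 * l)).comp
    (tendsto_id.const_mul_atTop' (two_pos : (0 : ℕ) < 2))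
  have h6 : ∀ N : ℕ, (Real.pi : ℂ) * (2 * l) *
      ∏ j ∈ Finset.range (2 * N), (1 - (2 * l) ^ 2 / ((j : ℂ) + 1) ^ 2) =
      2 * (∏ k ∈ Finset.range N, (1 - (2 * l) ^ 2 / ((2 * k : ℕ) + 1 : ℂ) ^ 2)) *
        ((Real.pi : ℂ) * l * ∏ j ∈ Finset.range N, (1 - l ^ 2 / ((j : ℂ) + 1) ^ 2)) := by
    intro N
    have : ∏ j ∈ Finset.range (2 * N), (1 - (2 * l) ^ 2 / ((j : ℂ) + 1) ^ 2) =
        (∏ k ∈ Finset.range N, (1 - (2 * l) ^ 2 / ((2 * k : ℕ) + 1 : ℂ) ^ 2)) *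
        ∏ j ∈ Finset.range N, (1 - l ^ 2 / ((j : ℂ) + 1) ^ 2) := by
      induction N with
      | zero => simp
      | succ N ih =>
        rw [mul_add_one, Finset.prod_range_succ, Finset.prod_range_succ, ih,
          Finset.prod_range_succ, Finset.prod_range_succ]
        have hN : ((N : ℂ) + 1) ≠ 0 := Nat.cast_add_one_ne_zero N
        have : (2 * l) ^ 2 / (((2 * N + 1 : ℕ) : ℂ) + 1) ^ 2 = l ^ 2 / ((N : ℂ) + 1) ^ 2 := by
          push_cast
          rw [show (2 * (N : ℂ) + 1 + 1) = 2 * (N + 1) by ring]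
          field_simp
        rw [this]
        ring
    rw [this]
    ring
  have h7 := tendsto_nhds_unique (h5.congr h6) ((h2.const_mul 2).mul h4)
  rw [show (Real.pi : ℂ) * (2 * l) = 2 * (l * Real.pi) by ring, Complex.sin_two_mul,
    mul_comm (Real.pi : ℂ) l] at h7
  have h8 : (2 : ℂ) * Complex.sin (l * Real.pi) ≠ 0 := mul_ne_zero two_ne_zero hl
  refine mul_left_cancel₀ h8 ?_
  rw [h7]
  ring

/-- The second canonical product is a translate of the first one. -/
lemma prod2_eq_neg_prod1 (hμ : Summable fun n : ℤ => ‖μ n - ((n : ℂ) - 1 / 2)‖ ^ 2) (l : ℂ) :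
    prod2 μ l = -prod1 (fun n => μ n + 1 / 2) (l + 1 / 2) := by
  have hμ' : Summable fun n : ℤ => ‖(fun n => μ n + 1 / 2) n - (n : ℂ)‖ ^ 2 := by
    refine hμ.congr fun n => ?_
    congr 2; ring
  have key : ∀ z : ℂ, z + 1 / 2 ∈ offInt → Complex.sin (z * Real.pi) ≠ 0 →
      prod2 μ z = -prod1 (fun n => μ n + 1 / 2) (z + 1 / 2) := by
    intro z hz hs
    have hne : ∀ n : ℤ, (n : ℂ) - 1 / 2 ≠ z := fun n h =>
      int_ne_of_mem_offInt hz n (by rw [← h]; ring)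
    have e : ∀ n : ℤ, (μ n + 1 / 2 - n) / (n - (z + 1 / 2)) =
        (μ n - ((n : ℂ) - 1 / 2)) / ((n : ℂ) - 1 / 2 - z) := fun n => by
      congr 1 <;> ring
    have hsum := summable_norm_div_int_sub hμ' hz
    simp only [e] at hsum
    rw [prod1_eq_sin_mul hμ' hz, prod2, tprod_factor_eq_mul (ρ := fun n : ℤ => (n : ℂ) - 1 / 2)
      summable_inv_norm_int_sub_half_sq int_sub_half_ne_zero hne hsum, tprod_half_int_eq_cos hs,
      show (z + 1 / 2) * (Real.pi : ℂ) = z * Real.pi + Real.pi / 2 by ring, Complex.sin_add_pi_div_two]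
    simp only [e]
    ring
  have hd1 := differentiable_prod2 hμ
  have hd2 : Differentiable ℂ fun l => -prod1 (fun n => μ n + 1 / 2) (l + 1 / 2) :=
    ((differentiable_prod1 hμ').comp (differentiable_id.add_const (1 / 2 : ℂ))).neg
  -- The formulas used for `key` exclude some points near the real axis; both sides are entire, so
  -- agreement near `i` suffices.
  have := AnalyticOnNhd.eq_of_eventuallyEq (z₀ := Complex.I)
    (hd1.differentiableOn.analyticOnNhd isOpen_univ) (hd2.differentiableOn.analyticOnNhd isOpen_univ)
    ?_
  · exact congrFun this l
  have him : ∀ᶠ z : ℂ in 𝓝 Complex.I, 1 / 2 < z.im :=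
    Complex.continuous_im.continuousAt.eventually_const_lt (by norm_num)
  filter_upwards [him] with z hz
  have hoff : ∀ w : ℂ, w.im = z.im → w ∈ offInt := by
    intro w hw n
    have := (le_abs_self _).trans (Complex.abs_im_le_norm (w - n))
    simp only [Complex.sub_im, Complex.intCast_im, sub_zero, hw] at this
    linarith
  refine key z (hoff _ ?_) (sin_ne_zero_of_mem_offInt (hoff _ rfl))
  simp

end DelayDirac

/-! ### Fourier integrals as entire functions -/

namespace DelayDirac

open Filter Topology Bornology Set MeasureTheory

section Parseval

open AddCircle

/-- **Parseval's identity** for two square integrable functions on an interval. -/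
lemma hasSum_fourierCoeffOn_mul {a b : ℝ} {u v : ℝ → ℂ} (hab : a < b)
    (hu : MemLp u 2 (volume.restrict (Ioc a b))) (hv : MemLp v 2 (volume.restrict (Ioc a b))) :
    HasSum (fun k => starRingEnd ℂ (fourierCoeffOn hab u k) * fourierCoeffOn hab v k)
      ((b - a)⁻¹ • ∫ x in a..b, starRingEnd ℂ (u x) * v x) := by
  have := Fact.mk (by linarith : 0 < b - a)
  rw [← add_sub_cancel a b] at hu hv
  have h := hu.memLp_liftIoc.haarAddCircle
  have h' := hv.memLp_liftIoc.haarAddCircle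
  have key := (fourierBasis (T := b - a)).hasSum_inner_mul_inner h.toLp h'.toLp
  convert! key using 1
  · funext k
    rw [← inner_conj_symm, ← HilbertBasis.repr_apply_apply, ← HilbertBasis.repr_apply_apply,
      fourierBasis_repr, fourierBasis_repr]
    simp [fourierCoeff_congr_ae h.coeFn_toLp, fourierCoeff_congr_ae h'.coeFn_toLp,
      fourierCoeff_liftIoc_eq]
  · rw [L2.inner_def]
    nth_rw 2 [← add_sub_cancel a b]
    rw [← AddCircle.integral_liftIoc_eq_intervalIntegral, ← AddCircle.integral_haarAddCircle]
    apply integral_congr_ae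
    filter_upwards [h.coeFn_toLp, h'.coeFn_toLp] with x hx hx'
    rw [hx, hx', RCLike.inner_apply']
    rfl

end Parseval

/-- The entire function `z ↦ ∫ u(s) exp(i z s) ds`, the integral being taken over `(c, d)`. -/
noncomputable def expInt (c d : ℝ) (u : ℝ → ℂ) (z : ℂ) : ℂ :=
  ∫ s in c..d, u s * Complex.exp (Complex.I * z * s)

lemma intervalIntegrable_mul_exp {c d : ℝ} {u : ℝ → ℂ} (hu : IntervalIntegrable u volume c d)
    (z : ℂ) : IntervalIntegrable (fun s : ℝ => u s * Complex.exp (Complex.I * z * s)) volume c d :=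
  hu.mul_continuousOn (by fun_prop)

lemma differentiable_expInt {c d : ℝ} {u : ℝ → ℂ} (hu : IntervalIntegrable u volume c d) :
    Differentiable ℂ (expInt c d u) := by
  intro z
  obtain ⟨M, hM⟩ : ∃ M : ℝ, ∀ s ∈ uIcc c d, |s| ≤ M :=
    isCompact_uIcc.exists_bound_of_continuousOn (f := fun s : ℝ => s) continuousOn_id
  have hd := (intervalIntegral.hasDerivAt_integral_of_dominated_loc_of_deriv_le
    (μ := volume) (a := c) (b := d) (𝕜 := ℂ)
    (F := fun z s => u s * Complex.exp (Complex.I * z * s))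
    (F' := fun z s => u s * (Complex.I * s * Complex.exp (Complex.I * z * s)))
    (bound := fun s => ‖u s‖ * (M * Real.exp ((‖z‖ + 1) * M)))
    (Metric.ball_mem_nhds z one_pos) (Eventually.of_forall fun w => ?_)
    (intervalIntegrable_mul_exp hu z) ?_ ?_ ?_ ?_).2
  · exact hd.differentiableAt
  · exact (intervalIntegrable_mul_exp hu w).aestronglyMeasurable_restrict_uIoc
  · exact (hu.mul_continuousOn (g := fun s : ℝ => Complex.I * s * Complex.exp (Complex.I * z * s))
      (by fun_prop)).aestronglyMeasurable_restrict_uIoc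
  · refine Eventually.of_forall fun s hs w hw => ?_
    have hs' := hM s (uIoc_subset_uIcc hs)
    have hw' : ‖w‖ ≤ ‖z‖ + 1 := by
      have h1 := mem_ball_iff_norm.1 hw
      have h2 := norm_add_le (w - z) z
      rw [sub_add_cancel] at h2
      linarith
    rw [norm_mul, norm_mul, norm_mul, Complex.norm_I, one_mul, Complex.norm_real, Real.norm_eq_abs]
    have hM0 : 0 ≤ M := (abs_nonneg s).trans hs'
    have hexp : ‖Complex.exp (Complex.I * w * s)‖ ≤ Real.exp ((‖z‖ + 1) * M) := by
      refine (Complex.norm_exp_le_exp_norm _).trans (Real.exp_le_exp.2 ?_)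
      rw [norm_mul, norm_mul, Complex.norm_I, one_mul, Complex.norm_real, Real.norm_eq_abs]
      gcongr
    gcongr
  · exact hu.norm.mul_const _
  · refine Eventually.of_forall fun s _ w _ => ?_
    have h1 : HasDerivAt (fun w : ℂ => Complex.I * w * s) (Complex.I * s) w := by
      simpa using ((hasDerivAt_id w).const_mul Complex.I).mul_const (s : ℂ)
    have h2 := h1.cexp.const_mul (u s)
    convert! h2 using 1
    ring

/-- The modulus of `exp(iz(s - e))` is `exp(Im z · (e - s))`. Taking `e = 0` gives the growth of the
integral, and taking `e` at an endpoint of the interval gives boundedness in a half-plane. -/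
lemma norm_exp_mul_expInt_le {c d e : ℝ} (hcd : c ≤ d) {u : ℝ → ℂ}
    (hu : IntervalIntegrable u volume c d) {z : ℂ} {B : ℝ}
    (h : ∀ s ∈ Ioc c d, z.im * (e - s) ≤ B) :
    ‖Complex.exp (-(Complex.I * z * e)) * expInt c d u z‖ ≤ (∫ s in c..d, ‖u s‖) * Real.exp B := by
  rw [expInt, ← intervalIntegral.integral_const_mul, ← intervalIntegral.integral_mul_const]
  refine intervalIntegral.norm_integral_le_of_norm_le hcd ?_ (hu.norm.mul_const _)
  refine Eventually.of_forall fun s hs => ?_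
  have : Complex.exp (-(Complex.I * z * e)) * (u s * Complex.exp (Complex.I * z * s)) =
      u s * Complex.exp (Complex.I * z * (s - e)) := by
    rw [mul_left_comm, ← Complex.exp_add]
    ring_nf
  rw [this, norm_mul, Complex.norm_exp]
  gcongr
  refine le_trans (le_of_eq ?_) (h s hs)
  simp only [Complex.mul_re, Complex.mul_im, Complex.I_re, Complex.I_im, Complex.sub_re,
    Complex.sub_im, Complex.ofReal_re, Complex.ofReal_im]
  ring

lemma norm_expInt_le {b : ℝ} (hb : 0 ≤ b) {u : ℝ → ℂ} (hu : IntervalIntegrable u volume (-b) b)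
    (z : ℂ) : ‖expInt (-b) b u z‖ ≤ (∫ s in -b..b, ‖u s‖) * Real.exp (b * |z.im|) := by
  have h := norm_exp_mul_expInt_le (e := 0) (by linarith) hu (z := z) (B := b * |z.im|) ?_
  · simpa using h
  · intro s hs
    have h1 : |s| ≤ b := abs_le.2 ⟨hs.1.le, hs.2⟩
    calc z.im * (0 - s) ≤ |z.im * (0 - s)| := le_abs_self _
      _ = |z.im| * |s| := by rw [abs_mul, zero_sub, abs_neg]
      _ ≤ |z.im| * b := by gcongr
      _ = _ := mul_comm _ _

lemma expTypeLE_expInt {b : ℝ} (hb : 0 ≤ b) {u : ℝ → ℂ}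
    (hu : IntervalIntegrable u volume (-b) b) : ExpTypeLE (expInt (-b) b u) b := by
  refine ⟨differentiable_expInt hu, fun ε hε => ⟨∫ s in -b..b, ‖u s‖, fun z => ?_⟩⟩
  refine (norm_expInt_le hb hu z).trans ?_
  have : 0 ≤ ∫ s in -b..b, ‖u s‖ :=
    intervalIntegral.integral_nonneg (by linarith) fun s _ => norm_nonneg _
  gcongr
  · linarith
  · exact Complex.abs_im_le_norm z

lemma intervalIntegrable_of_memLp {c d : ℝ} (hcd : c ≤ d) {u : ℝ → ℂ}
    (hu : MemLp u 2 (volume.restrict (Ioc c d))) : IntervalIntegrable u volume c d :=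
  (intervalIntegrable_iff_integrableOn_Ioc_of_le hcd).2 (hu.integrable one_le_two)

section FourierSeries

open scoped Real

lemma neg_pi_lt_pi : -π < π := by linarith [Real.pi_pos]

lemma fourierCoeffOn_eq_expInt (u : ℝ → ℂ) (k : ℤ) :
    fourierCoeffOn neg_pi_lt_pi u k = (1 / (2 * π) : ℂ) * expInt (-π) π u (-k) := by
  rw [fourierCoeffOn_eq_integral, expInt, Complex.real_smul]
  congr 1
  · push_cast; ring
  · refine intervalIntegral.integral_congr fun s _ => ?_
    simp only [fourier_coe_apply, smul_eq_mul]
    rw [mul_comm]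
    congr 2
    have : (π : ℂ) ≠ 0 := by exact_mod_cast Real.pi_ne_zero
    push_cast
    rw [show (π : ℂ) - -π = 2 * π by ring]
    field_simp

variable {u : ℝ → ℂ} (hu : MemLp u 2 (volume.restrict (Ioc (-π) π)))

include hu

lemma summable_norm_expInt_int_sq : Summable fun n : ℤ => ‖expInt (-π) π u n‖ ^ 2 := by
  have h := (hasSum_sq_fourierCoeffOn neg_pi_lt_pi hu).summable
  have h1 := ((Equiv.neg ℤ).summable_iff.2 h).mul_left ((2 * π) ^ 2)
  refine h1.congr fun n => ?_
  have : (π : ℝ) ≠ 0 := Real.pi_ne_zero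
  simp only [Function.comp_apply, Equiv.neg_apply, fourierCoeffOn_eq_expInt, Int.cast_neg, neg_neg,
    norm_mul, norm_div, norm_one, Complex.norm_real, Complex.norm_ofNat, mul_pow, div_pow, one_pow,
    Real.norm_of_nonneg Real.pi_pos.le]
  field_simp

/-- The values at the integers are, up to sign of the index and a constant, the Fourier
coefficients, so Parseval gives zero norm. -/
lemma ae_eq_zero_of_expInt_int_eq_zero (h : ∀ n : ℤ, expInt (-π) π u n = 0) :
    u =ᵐ[volume.restrict (Ioc (-π) π)] 0 := by
  have h1 := hasSum_sq_fourierCoeffOn neg_pi_lt_pi hu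
  have h2 : (fun i : ℤ => ‖fourierCoeffOn neg_pi_lt_pi u i‖ ^ 2) = fun _ => 0 := by
    funext k
    have := h (-k)
    push_cast at this
    rw [fourierCoeffOn_eq_expInt, this]
    simp
  rw [h2] at h1
  have h3 := h1.unique hasSum_zero
  have h4 : ∫ x in -π..π, ‖u x‖ ^ 2 = 0 := by
    have hp : (π - -π)⁻¹ ≠ 0 := inv_ne_zero (by linarith [Real.pi_pos])
    rcases smul_eq_zero.1 h3 with h | h
    · exact absurd h hp
    · exact h
  rw [intervalIntegral.integral_of_le neg_pi_lt_pi.le, integral_eq_zero_iff_of_nonneg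
    (fun x => by positivity) hu.integrable_norm_pow'] at h4
  filter_upwards [h4] with x hx
  simpa using hx

end FourierSeries

end DelayDirac

/-! ### Cardinal series and Riesz-Fischer -/

namespace DelayDirac

open Filter Topology Bornology Set MeasureTheory
open scoped Real

lemma conj_expInt_conj (c d : ℝ) (u : ℝ → ℂ) (x : ℝ) :
    starRingEnd ℂ (expInt c d (fun s => starRingEnd ℂ (u s)) (-x)) = expInt c d u x := by
  have hconj : ∀ s : ℝ, starRingEnd ℂ (starRingEnd ℂ (u s) * Complex.exp (Complex.I * -x * s)) =
      u s * Complex.exp (Complex.I * x * s) := fun s => by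
    simp [← Complex.exp_conj]
  simp only [expInt]
  rw [intervalIntegral.intervalIntegral_eq_integral_uIoc,
    intervalIntegral.intervalIntegral_eq_integral_uIoc, Complex.real_smul, Complex.real_smul,
    map_mul, ← integral_conj]
  simp only [hconj, Complex.conj_ofReal]

lemma expInt_exp_int {z : ℂ} {k : ℤ} (hzk : z - k ≠ 0) :
    expInt (-π) π (fun s => Complex.exp (Complex.I * z * s)) (-k) =
      2 * Complex.sin (z * π - k * π) / (z - k) := by
  have hc : Complex.I * (z - k) ≠ 0 := mul_ne_zero Complex.I_ne_zero hzk
  have : ∀ s : ℝ, Complex.exp (Complex.I * z * s) * Complex.exp (Complex.I * -k * s) =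
      Complex.exp (Complex.I * (z - k) * s) := fun s => by
    rw [← Complex.exp_add]; ring_nf
  simp only [expInt, this]
  rw [integral_exp_mul_complex hc, Complex.sin]
  have e1 : Complex.I * (z - k) * (π : ℝ) = (z * π - k * π) * Complex.I := by ring
  have e2 : Complex.I * (z - k) * ((-π : ℝ) : ℂ) = -(z * π - k * π) * Complex.I := by
    push_cast; ring
  rw [e1, e2]
  field_simp
  rw [Complex.I_sq]
  ring

lemma norm_sin_sub_int_mul_pi (w : ℂ) (k : ℤ) :
    ‖Complex.sin (w - k * π)‖ = ‖Complex.sin w‖ := by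
  have h := Complex.sin_sq_add_cos_sq ((k : ℂ) * π)
  rw [Complex.sin_int_mul_pi, zero_pow two_ne_zero, zero_add, sq_eq_one_iff] at h
  rw [Complex.sin_sub, Complex.sin_int_mul_pi, mul_zero, sub_zero, norm_mul]
  rcases h with h | h <;> simp [h]

section

variable {u : ℝ → ℂ} (hu : MemLp u 2 (volume.restrict (Ioc (-π) π)))

include hu

/-- Parseval for `conj u` against `exp(izs)` is the cardinal series `f(z) = ∑ f(k) sin π(z - k) /
(π(z - k))` of the Fourier integral `f`. Since `|sin π(z - k)| = |sin πz|`, the sine divides out;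
the factor `1/π` is dropped at the end. -/
lemma norm_expInt_div_sin_le {z : ℂ} (hz : z ∈ offInt) :
    ‖expInt (-π) π u z / Complex.sin (z * π)‖ ≤
      ∑' n : ℤ, ‖expInt (-π) π u n‖ / ‖z - n‖ := by
  have hpi : (π : ℂ) ≠ 0 := by exact_mod_cast Real.pi_ne_zero
  have hsin := sin_ne_zero_of_mem_offInt hz
  have hv : MemLp (fun s : ℝ => Complex.exp (Complex.I * z * s)) 2
      (volume.restrict (Ioc (-π) π)) := by
    have hc : Continuous fun s : ℝ => Complex.exp (Complex.I * z * s) := by fun_prop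
    obtain ⟨M, hM⟩ := (isCompact_Icc (a := -π) (b := π)).exists_bound_of_continuousOn
      hc.continuousOn
    refine MemLp.of_bound hc.aestronglyMeasurable M ?_
    filter_upwards [ae_restrict_mem measurableSet_Ioc] with s hs
    exact hM s (Ioc_subset_Icc_self hs)
  have h := hasSum_fourierCoeffOn_mul neg_pi_lt_pi hu.star hv
  have hcoef : ∀ k : ℤ, starRingEnd ℂ (fourierCoeffOn neg_pi_lt_pi (star u) k) *
      fourierCoeffOn neg_pi_lt_pi (fun s : ℝ => Complex.exp (Complex.I * z * s)) k =
      (1 / (2 * π) ^ 2 : ℂ) * (expInt (-π) π u k *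
        (2 * Complex.sin (z * π - k * π) / (z - k))) := by
    intro k
    have h1 := conj_expInt_conj (-π) π u k
    have h2 : star u = fun s => starRingEnd ℂ (u s) := rfl
    rw [Complex.ofReal_intCast] at h1
    rw [fourierCoeffOn_eq_expInt, fourierCoeffOn_eq_expInt, map_mul, h2, h1,
      expInt_exp_int (sub_ne_zero.2 (int_ne_of_mem_offInt hz k).symm)]
    simp only [map_div₀, map_one, map_mul, map_ofNat, Complex.conj_ofReal]
    ring
  have hval : (π - -π)⁻¹ • ∫ s in -π..π, starRingEnd ℂ ((star u) s) *
      Complex.exp (Complex.I * z * s) = (1 / (2 * π) : ℂ) * expInt (-π) π u z := by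
    rw [Complex.real_smul, expInt]
    congr 1
    · push_cast; rw [sub_neg_eq_add, ← two_mul, one_div]
    · simp
  simp only [hcoef] at h
  rw [hval] at h
  have hbound : ∀ k : ℤ, ‖(1 / (2 * π) ^ 2 : ℂ) * (expInt (-π) π u k *
      (2 * Complex.sin (z * π - k * π) / (z - k)))‖ =
      ‖Complex.sin (z * π)‖ / (2 * π ^ 2) * (‖expInt (-π) π u k‖ / ‖z - k‖) := by
    intro k
    simp only [norm_mul, norm_div, norm_pow, norm_one, Complex.norm_real, Complex.norm_ofNat,
      norm_sin_sub_int_mul_pi, Real.norm_of_nonneg Real.pi_pos.le]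
    field_simp
  have hk := summable_norm_div_norm_sub (summable_norm_expInt_int_sq hu) hz
  have hle := norm_tsum_le_tsum_norm (f := fun k : ℤ => (1 / (2 * π) ^ 2 : ℂ) *
    (expInt (-π) π u k * (2 * Complex.sin (z * π - k * π) / (z - k))))
    (by simp only [hbound]; exact hk.mul_left _)
  rw [h.tsum_eq] at hle
  simp only [hbound] at hle
  rw [tsum_mul_left] at hle
  have hn : ‖(1 / (2 * π) : ℂ) * expInt (-π) π u z‖ = ‖expInt (-π) π u z‖ / (2 * π) := by
    simp only [norm_mul, norm_div, norm_one, Complex.norm_real, Complex.norm_ofNat,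
      Real.norm_of_nonneg Real.pi_pos.le]
    ring
  rw [hn] at hle
  have hs : 0 < ‖Complex.sin (z * π)‖ := norm_pos_iff.2 hsin
  have hT : 0 ≤ ∑' n : ℤ, ‖expInt (-π) π u n‖ / ‖z - n‖ := tsum_nonneg fun n => by positivity
  rw [norm_div, div_le_iff₀ hs]
  have h3 := mul_le_mul_of_nonneg_left hle Real.two_pi_pos.le
  rw [mul_div_cancel₀ _ Real.two_pi_pos.ne'] at h3
  refine h3.trans ?_
  have : 2 * π * (‖Complex.sin (z * π)‖ / (2 * π ^ 2) *
      ∑' n : ℤ, ‖expInt (-π) π u n‖ / ‖z - n‖) =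
      (∑' n : ℤ, ‖expInt (-π) π u n‖ / ‖z - n‖) * ‖Complex.sin (z * π)‖ / π := by
    field_simp
  rw [this]
  exact div_le_self (mul_nonneg hT hs.le) (by linarith [Real.pi_gt_three])

/-- Far from the integers a Fourier integral over `(-π, π)` is small compared with the sine. -/
lemma tendsto_expInt_div_sin :
    Tendsto (fun z => expInt (-π) π u z / Complex.sin (z * π)) farFilter (𝓝 0) := by
  refine squeeze_zero_norm' ?_ (tendsto_tsum_norm_div_norm_sub (summable_norm_expInt_int_sq hu))
  filter_upwards [mem_offInt_eventually] with z hz using norm_expInt_div_sin_le hu hz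

end

/-- **Riesz-Fischer**: any square summable sequence consists of the values at the integers of a
Fourier integral over `(-π, π)`. -/
lemma exists_expInt_int_eq {c : ℤ → ℂ} (hc : Summable fun n => ‖c n‖ ^ 2) :
    ∃ u : ℝ → ℂ, MemLp u 2 (volume.restrict (Ioc (-π) π)) ∧
      ∀ n : ℤ, expInt (-π) π u n = c n := by
  have := Fact.mk (by linarith [Real.pi_pos] : 0 < π - -π)
  have hpi : (π : ℂ) ≠ 0 := by exact_mod_cast Real.pi_ne_zero
  -- The index is reversed because the `k`-th Fourier coefficient is the value of the integral at
  -- `-k`, divided by `2π`.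
  have hw : Memℓp (fun k : ℤ => (1 / (2 * π) : ℂ) * c (-k)) 2 := by
    refine Memℓp.const_mul (memℓp_gen ?_) _
    have h := (Equiv.neg ℤ).summable_iff.2 hc
    refine h.congr fun k => ?_
    simp
  set F := (fourierBasis (T := π - -π)).repr.symm ⟨_, hw⟩ with hF
  have hFk : ∀ k : ℤ, fourierCoeff F k = (1 / (2 * π) : ℂ) * c (-k) := fun k => by
    rw [← fourierBasis_repr, hF, LinearIsometryEquiv.apply_symm_apply]
  have hmp := AddCircle.measurePreserving_mk (π - -π) (-π)
  rw [show -π + (π - -π) = π by ring] at hmp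
  refine ⟨fun s => F (s : AddCircle (π - -π)),
    ((Lp.memLp F).of_haarAddCircle).comp_measurePreserving hmp, fun n => ?_⟩
  have h1 := hFk (-n)
  rw [fourierCoeff_eq_intervalIntegral F (-n) (-π), neg_neg, show -π + (π - -π) = π by ring,
    Complex.real_smul] at h1
  have h2 : ∫ s in -π..π, fourier n (s : AddCircle (π - -π)) • F (s : AddCircle (π - -π)) =
      expInt (-π) π (fun s => F (s : AddCircle (π - -π))) n := by
    rw [expInt]
    refine intervalIntegral.integral_congr fun s _ => ?_
    simp only [fourier_coe_apply, smul_eq_mul]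
    rw [mul_comm]
    congr 2
    push_cast
    rw [show (π : ℂ) - -π = 2 * π by ring]
    field_simp
  rw [h2] at h1
  push_cast at h1
  rw [show (π : ℂ) - -π = 2 * π by ring] at h1
  exact mul_left_cancel₀ (by simp [hpi]) h1

end DelayDirac

/-! ### The Paley-Wiener theorem -/

namespace DelayDirac

open Filter Topology Bornology Set MeasureTheory
open scoped Real

lemma expInt_indicator {c d : ℝ} (hc : -π ≤ c) (hcd : c ≤ d) (hd : d ≤ π) (u : ℝ → ℂ) (z : ℂ) :
    expInt (-π) π ((Ioc c d).indicator u) z = expInt c d u z := by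
  rw [expInt, expInt, intervalIntegral.integral_of_le neg_pi_lt_pi.le,
    intervalIntegral.integral_of_le hcd]
  have : (fun s : ℝ => (Ioc c d).indicator u s * Complex.exp (Complex.I * z * s)) =
      (Ioc c d).indicator fun s : ℝ => u s * Complex.exp (Complex.I * z * s) := by
    funext s
    by_cases hs : s ∈ Ioc c d <;> simp [hs]
  rw [this, setIntegral_indicator measurableSet_Ioc,
    inter_eq_self_of_subset_right (Ioc_subset_Ioc hc hd)]

lemma memLp_comp_neg {u : ℝ → ℂ} {b : ℝ} (hu : MemLp u 2 (volume.restrict (Ioc (-b) b))) :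
    MemLp (fun s => u (-s)) 2 (volume.restrict (Ioc (-b) b)) := by
  rw [← restrict_Ioo_eq_restrict_Ioc] at hu ⊢
  have h := (Measure.measurePreserving_neg (volume : Measure ℝ)).restrict_preimage
    (measurableSet_Ioo (a := -b) (b := b))
  have hs : Neg.neg ⁻¹' Ioo (-b) b = Ioo (-b) b := by
    ext x
    simp only [mem_preimage, mem_Ioo]
    constructor <;> rintro ⟨h1, h2⟩ <;> constructor <;> linarith
  rw [hs] at h
  exact hu.comp_measurePreserving h

lemma expInt_comp_neg (c d : ℝ) (u : ℝ → ℂ) (z : ℂ) :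
    expInt c d (fun s => u (-s)) z = expInt (-d) (-c) u (-z) := by
  rw [expInt, expInt, ← intervalIntegral.integral_comp_neg]
  refine intervalIntegral.integral_congr fun s _ => ?_
  simp

lemma expInt_eq_zero_of_ae {c d : ℝ} (hcd : c ≤ d) {u : ℝ → ℂ}
    (h : ∀ᵐ s ∂volume.restrict (Ioc c d), u s = 0) (z : ℂ) : expInt c d u z = 0 := by
  rw [expInt, intervalIntegral.integral_of_le hcd]
  refine integral_eq_zero_of_ae ?_
  filter_upwards [h] with s hs
  simp [hs]

/-- A function that is of exponential type at most `b` and bounded on the real line is, after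
multiplication by `exp (-i c z)` with `c > b`, bounded in the lower half plane. -/
lemma norm_exp_mul_le_of_expTypeLE {f : ℂ → ℂ} {b c A : ℝ} (hf : ExpTypeLE f b) (hbc : b < c)
    (hc : 0 ≤ c) (hA : ∀ x : ℝ, ‖f x‖ ≤ A) {z : ℂ} (hz : z.im ≤ 0) :
    ‖Complex.exp (-(Complex.I * z * c)) * f z‖ ≤ A := by
  obtain ⟨hd, hexp⟩ := hf
  -- Spending the whole room `c - b` gives growth rate exactly `c`, which `exp(-cw)` absorbs on the
  -- positive axis.
  obtain ⟨C, hC⟩ := hexp (c - b) (by linarith)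
  simp only [add_sub_cancel] at hC
  have hC0 : 0 ≤ C := by
    have := (norm_nonneg _).trans (hC 0)
    simpa using this
  -- The substitution `w = iz` turns the lower half-plane into the right one. There
  -- Phragmén-Lindelöf needs order less than two, boundedness on the positive axis, and the bound
  -- `A` on the imaginary axis, which corresponds to real `z`.
  set G : ℂ → ℂ := fun w => Complex.exp (-(w * c)) * f (-(Complex.I * w)) with hG
  have hGd : Differentiable ℂ G := by
    have : Differentiable ℂ fun w : ℂ => f (-(Complex.I * w)) := hd.comp (by fun_prop)
    exact Differentiable.mul (by fun_prop) this
  have hnI : ∀ w : ℂ, ‖-(Complex.I * w)‖ = ‖w‖ := fun w => by simp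
  have h := PhragmenLindelof.right_half_plane_of_bounded_on_real (f := G) (C := A)
    (z := Complex.I * z) hGd.diffContOnCl ⟨1, by norm_num, 2 * c, ?_⟩ ?_ ?_ (by simpa using hz)
  · have h1 : -(Complex.I * (Complex.I * z)) = z := by
      rw [← mul_assoc, Complex.I_mul_I]; ring
    simpa only [hG, h1] using h
  · refine Asymptotics.IsBigO.of_bound C (Eventually.of_forall fun w => ?_)
    rw [Real.norm_of_nonneg (Real.exp_pos _).le, Real.rpow_one, norm_mul]
    have h1 : ‖Complex.exp (-(w * c))‖ ≤ Real.exp (c * ‖w‖) := by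
      refine (Complex.norm_exp_le_exp_norm _).trans (Real.exp_le_exp.2 ?_)
      rw [norm_neg, norm_mul, Complex.norm_real, Real.norm_of_nonneg hc, mul_comm]
    have h2 := hC (-(Complex.I * w))
    rw [hnI] at h2
    calc _ ≤ Real.exp (c * ‖w‖) * (C * Real.exp (c * ‖w‖)) := by gcongr
      _ = C * (Real.exp (c * ‖w‖) * Real.exp (c * ‖w‖)) := by ring
      _ = _ := by rw [← Real.exp_add]; ring_nf
  · refine isBoundedUnder_of_eventually_le (a := C) ?_
    filter_upwards [eventually_ge_atTop 0] with x hx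
    have h2 := hC (-(Complex.I * x))
    rw [hnI, Complex.norm_real, Real.norm_of_nonneg hx] at h2
    have h1 : ‖Complex.exp (-((x : ℂ) * c))‖ = Real.exp (-(x * c)) := by
      rw [Complex.norm_exp]
      simp
    rw [hG, norm_mul, h1]
    calc _ ≤ Real.exp (-(x * c)) * (C * Real.exp (c * x)) := by gcongr
      _ = C * (Real.exp (-(x * c)) * Real.exp (c * x)) := by ring
      _ = C := by rw [← Real.exp_add, mul_comm x c, neg_add_cancel, Real.exp_zero, mul_one]
  · intro x
    have h1 : -(Complex.I * (x * Complex.I)) = x := by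
      rw [mul_left_comm, Complex.I_mul_I]; ring
    have h2 : ‖Complex.exp (-((x : ℂ) * Complex.I * c))‖ = 1 := by
      rw [Complex.norm_exp]
      simp
    rw [hG]
    simp only [h1, norm_mul, h2, one_mul]
    exact hA x

section PaleyWiener

variable {u : ℝ → ℂ} (hu : MemLp u 2 (volume.restrict (Ioc (-π) π)))

include hu

/-- The function `exp(-icz) ∫_c^π u(s) exp(izs) ds` is bounded in the upper half-plane because `s ≥
c`. In the lower one it is the difference of `exp(-icz)` times the full integral, bounded by
Phragmén-Lindelöf, and `exp(-icz) ∫_{-π}^c`, bounded because `s ≤ c`. By Liouville it is a constant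
`K`. The Fourier integral of `u` cut off to `(c, π]` then has modulus `|K|` at every integer, and
square summability forces `K = 0`. -/
lemma ae_eq_zero_of_expTypeLE {b c : ℝ} (hb : 0 ≤ b) (hf : ExpTypeLE (expInt (-π) π u) b)
    (hbc : b < c) : ∀ᵐ s ∂volume.restrict (Ioc c π), u s = 0 := by
  rcases le_or_gt π c with hc | hc
  · simp [Ioc_eq_empty (not_lt.2 hc)]
  have hpi := Real.pi_pos
  have hi := intervalIntegrable_of_memLp neg_pi_lt_pi.le hu
  have hi1 : IntervalIntegrable u volume (-π) c := hi.mono_set (by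
    rw [uIcc_of_le (by linarith), uIcc_of_le (by linarith)]; exact Icc_subset_Icc_right hc.le)
  have hi2 : IntervalIntegrable u volume c π := hi.mono_set (by
    rw [uIcc_of_le (by linarith), uIcc_of_le (by linarith)]; exact Icc_subset_Icc_left (by linarith))
  set e : ℂ → ℂ := fun z => Complex.exp (-(Complex.I * z * c)) with he
  have hsplit : ∀ z, expInt (-π) c u z + expInt c π u z = expInt (-π) π u z := fun z =>
    intervalIntegral.integral_add_adjacent_intervals (intervalIntegrable_mul_exp hi1 z)
      (intervalIntegrable_mul_exp hi2 z)
  have hA : ∀ x : ℝ, ‖expInt (-π) π u x‖ ≤ ∫ s in -π..π, ‖u s‖ := fun x => by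
    simpa using norm_expInt_le hpi.le hi (x : ℂ)
  have hbdd : ∀ z, ‖e z * expInt c π u z‖ ≤ (∫ s in c..π, ‖u s‖) +
      ((∫ s in -π..π, ‖u s‖) + ∫ s in -π..c, ‖u s‖) := by
    intro z
    have n1 : 0 ≤ ∫ s in c..π, ‖u s‖ := intervalIntegral.integral_nonneg hc.le fun s _ => norm_nonneg _
    have n2 : 0 ≤ ∫ s in -π..π, ‖u s‖ :=
      intervalIntegral.integral_nonneg neg_pi_lt_pi.le fun s _ => norm_nonneg _
    have n3 : 0 ≤ ∫ s in -π..c, ‖u s‖ :=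
      intervalIntegral.integral_nonneg (by linarith) fun s _ => norm_nonneg _
    rcases le_total 0 z.im with hz | hz
    · have := norm_exp_mul_expInt_le (e := c) hc.le hi2 (z := z) (B := 0)
        fun s hs => mul_nonpos_of_nonneg_of_nonpos hz (by linarith [hs.1])
      rw [Real.exp_zero, mul_one] at this
      linarith
    · have h1 := norm_exp_mul_expInt_le (e := c) (by linarith) hi1 (z := z) (B := 0)
        fun s hs => mul_nonpos_of_nonpos_of_nonneg hz (by linarith [hs.2])
      rw [Real.exp_zero, mul_one] at h1
      have h2 := norm_exp_mul_le_of_expTypeLE hf hbc (by linarith) hA hz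
      have h3 : e z * expInt c π u z = e z * expInt (-π) π u z - e z * expInt (-π) c u z := by
        rw [← hsplit]; ring
      rw [h3]
      have := norm_sub_le (e z * expInt (-π) π u z) (e z * expInt (-π) c u z)
      simp only [he] at this ⊢
      linarith
  have hdiff : Differentiable ℂ fun z => e z * expInt c π u z :=
    Differentiable.mul (by simp only [he]; fun_prop) (differentiable_expInt hi2)
  obtain ⟨K, hK⟩ := hdiff.exists_eq_const_of_bounded
    (isBounded_iff_forall_norm_le.2 ⟨_, by rintro _ ⟨w, rfl⟩; exact hbdd w⟩)
  set v := (Ioc c π).indicator u with hv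
  have hvL : MemLp v 2 (volume.restrict (Ioc (-π) π)) := hu.indicator measurableSet_Ioc
  have hvK : ∀ z : ℂ, expInt (-π) π v z = K * Complex.exp (Complex.I * z * c) := by
    intro z
    have h1 := congrFun hK z
    simp only [Function.const_apply, he, Complex.exp_neg] at h1
    rw [hv, expInt_indicator (by linarith) hc.le le_rfl, ← h1]
    field_simp [Complex.exp_ne_zero]
  have hK0 : K = 0 := by
    have h1 := summable_norm_expInt_int_sq hvL
    have h2 : ∀ n : ℤ, ‖expInt (-π) π v n‖ ^ 2 = ‖K‖ ^ 2 := fun n => by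
      rw [hvK, norm_mul, Complex.norm_exp]
      simp
    simp only [h2] at h1
    have := h1.tendsto_cofinite_zero
    rw [tendsto_const_nhds_iff] at this
    simpa using this
  have hv0 := ae_eq_zero_of_expInt_int_eq_zero hvL fun n => by rw [hvK, hK0, zero_mul]
  have hv1 := ae_restrict_of_ae_restrict_of_subset
    (Ioc_subset_Ioc_left (by linarith : -π ≤ c)) hv0
  filter_upwards [hv1, ae_restrict_mem measurableSet_Ioc] with s hs hsm
  simpa [hv, hsm] using hs

lemma ae_eq_zero_Ioc_of_expTypeLE {b : ℝ} (hb : 0 ≤ b) (hf : ExpTypeLE (expInt (-π) π u) b) :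
    ∀ᵐ s ∂volume.restrict (Ioc b π), u s = 0 := by
  have h : ∀ n : ℕ, ∀ᵐ s ∂volume.restrict (Ioc (b + 1 / ((n : ℝ) + 1)) π), u s = 0 := fun n =>
    ae_eq_zero_of_expTypeLE hu hb hf (lt_add_of_pos_right b (by positivity))
  refine ae_restrict_of_ae_restrict_of_subset ?_ (ae_restrict_iUnion_iff _ _ |>.2 h)
  intro s hs
  obtain ⟨n, hn⟩ := exists_nat_one_div_lt (sub_pos.2 hs.1)
  exact mem_iUnion.2 ⟨n, by linarith, hs.2⟩

/-- **Paley-Wiener**: a Fourier integral over `(-π, π)` that has exponential type at most `b` is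
a Fourier integral over `(-b, b)`. -/
theorem expInt_eq_of_expTypeLE {b : ℝ} (hb : 0 ≤ b) (hbpi : b ≤ π)
    (hf : ExpTypeLE (expInt (-π) π u) b) (z : ℂ) :
    expInt (-π) π u z = expInt (-b) b u z := by
  have hpi := Real.pi_pos
  have hi := intervalIntegrable_of_memLp neg_pi_lt_pi.le hu
  have hsub : ∀ {x y : ℝ}, -π ≤ x → x ≤ y → y ≤ π → IntervalIntegrable u volume x y :=
    fun h1 h2 h3 => hi.mono_set (by
      rw [uIcc_of_le h2, uIcc_of_le neg_pi_lt_pi.le]; exact Icc_subset_Icc h1 h3)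
  have hi1 := intervalIntegrable_mul_exp (hsub le_rfl (neg_le_neg hbpi) (by linarith)) z
  have hi2 := intervalIntegrable_mul_exp (hsub (neg_le_neg hbpi) (by linarith : -b ≤ b) hbpi) z
  have hi3 := intervalIntegrable_mul_exp (hsub (by linarith : -π ≤ b) hbpi le_rfl) z
  have hright := expInt_eq_zero_of_ae hbpi (ae_eq_zero_Ioc_of_expTypeLE hu hb hf) z
  -- The left end of the support follows from the right end by reflection `s ↦ -s`.
  have hf' : ExpTypeLE (expInt (-π) π fun s => u (-s)) b := by
    have he : (expInt (-π) π fun s => u (-s)) = fun z => expInt (-π) π u (-z) := by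
      funext w
      rw [expInt_comp_neg, neg_neg]
    rw [he]
    refine ⟨hf.1.comp differentiable_neg, fun ε hε => ?_⟩
    obtain ⟨C, hC⟩ := hf.2 ε hε
    exact ⟨C, fun w => by simpa using hC (-w)⟩
  have hleft := expInt_eq_zero_of_ae hbpi
    (ae_eq_zero_Ioc_of_expTypeLE (memLp_comp_neg hu) hb hf') (-z)
  rw [expInt_comp_neg, neg_neg] at hleft
  have h1 := intervalIntegral.integral_add_adjacent_intervals hi1 hi2
  have h2 := intervalIntegral.integral_add_adjacent_intervals (hi1.trans hi2) hi3
  simp only [expInt] at hleft hright ⊢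
  rw [← h2, ← h1, hleft, hright, zero_add, add_zero]

end PaleyWiener

/-! ### Canonical products as Fourier integral perturbations of the sine -/

lemma norm_sin_le_exp_norm (w : ℂ) : ‖Complex.sin w‖ ≤ Real.exp ‖w‖ := by
  have h : ∀ v : ℂ, ‖v‖ = ‖w‖ → ‖Complex.exp v‖ ≤ Real.exp ‖w‖ := fun v hv =>
    hv ▸ Complex.norm_exp_le_exp_norm v
  have h1 := h (-w * Complex.I) (by simp)
  have h2 := h (w * Complex.I) (by simp)
  rw [Complex.sin, norm_div, norm_mul, Complex.norm_I, mul_one, Complex.norm_ofNat]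
  have := norm_sub_le (Complex.exp (-w * Complex.I)) (Complex.exp (w * Complex.I))
  linarith

lemma norm_sin_mul_pi_le_of_mem_sphere {n : ℤ} {z : ℂ} (hz : z ∈ Metric.sphere (n : ℂ) (1 / 2)) :
    ‖Complex.sin (z * π)‖ ≤ Real.exp (π / 2) := by
  rw [← norm_sin_sub_int_mul_pi _ n]
  refine (norm_sin_le_exp_norm _).trans (Real.exp_le_exp.2 (le_of_eq ?_))
  rw [mem_sphere_iff_norm] at hz
  rw [← sub_mul, norm_mul, hz, Complex.norm_real, Real.norm_of_nonneg Real.pi_pos.le]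
  ring

lemma tendsto_norm_int_cofinite : Tendsto (fun n : ℤ => ‖(n : ℂ)‖) cofinite atTop := by
  have h := tendsto_norm_cocompact_atTop (E := ℤ)
  rw [cocompact_eq_cofinite] at h
  exact h.congr fun n => by rw [Complex.norm_intCast, Int.norm_eq_abs]

/-- A property that holds far from the integers holds on all but finitely many of the circles of
radius `1/2` about the integers. -/
lemma eventually_forall_mem_sphere {p : ℂ → Prop} (h : ∀ᶠ z in farFilter, p z) :
    ∀ᶠ n : ℤ in cofinite, ∀ z ∈ Metric.sphere (n : ℂ) (1 / 2), p z := by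
  obtain ⟨R, hR⟩ := eventually_farFilter.1 h
  filter_upwards [tendsto_norm_int_cofinite.eventually_ge_atTop (R + 1)] with n hn z hz
  refine hR z (sphere_subset_offInt n (by norm_num) (by norm_num) hz) ?_
  rw [mem_sphere_iff_norm] at hz
  have := norm_sub_norm_le (n : ℂ) z
  rw [norm_sub_rev, hz] at this
  linarith

section

variable {μ : ℤ → ℂ} (hμ : Summable fun n : ℤ => ‖μ n - n‖ ^ 2)

include hμ

lemma prod1_apply_self (n : ℤ) : prod1 μ (μ n) = 0 := by
  refine apply_eq_zero_of_analyticOrderAt_ne_zero ?_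
  rw [analyticOrderAt_prod1 hμ, encard_ne_zero]
  exact ⟨n, rfl⟩

lemma eventually_norm_sub_int_le {δ : ℝ} (hδ : 0 < δ) : ∀ᶠ n : ℤ in cofinite, ‖μ n - n‖ ≤ δ := by
  filter_upwards [hμ.tendsto_cofinite_zero.eventually_lt_const (by positivity : 0 < δ ^ 2)] with n hn
  exact (lt_of_pow_lt_pow_left₀ 2 hδ.le hn).le

/-- The zero `μ n` near `n` gives `prod1 μ n = (n - μ n) q(n)` with an entire quotient `q`. On the
circle of radius `1/2` about `n` the product is at most `2 exp(π/2)` and the distance to `μ n` at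
least `1/4`, so the maximum principle gives `|q(n)| ≤ 8 exp(π/2)`. This holds for all but finitely
many `n`. -/
lemma summable_norm_prod1_int_sq : Summable fun n : ℤ => ‖prod1 μ n‖ ^ 2 := by
  have hfar : ∀ᶠ z in farFilter, ‖prod1 μ z‖ ≤ 2 * ‖Complex.sin (z * π)‖ := by
    filter_upwards [(tendsto_prod1_div_sin hμ).norm.eventually_le_const
      (by simp : ‖(-1 : ℂ)‖ < 2), mem_offInt_eventually] with z hz hoff
    rwa [norm_div, div_le_iff₀ (norm_pos_iff.2 (sin_ne_zero_of_mem_offInt hoff))] at hz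
  refine Summable.of_norm_bounded_eventually (hμ.mul_left ((8 * Real.exp (π / 2)) ^ 2)) ?_
  filter_upwards [eventually_forall_mem_sphere hfar, eventually_norm_sub_int_le hμ
    (by norm_num : (0 : ℝ) < 1 / 4)] with n hn hn4
  rw [Real.norm_of_nonneg (by positivity), ← mul_pow]
  have hq : Differentiable ℂ (dslope (prod1 μ) (μ n)) := by
    rw [← differentiableOn_univ, Complex.differentiableOn_dslope univ_mem, differentiableOn_univ]
    exact differentiable_prod1 hμ
  have hpq : ∀ z, prod1 μ z = (z - μ n) * dslope (prod1 μ) (μ n) z := fun z => by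
    have := sub_smul_dslope (prod1 μ) (μ n) z
    rw [prod1_apply_self hμ, sub_zero, smul_eq_mul] at this
    exact this.symm
  have hbound := norm_le_of_norm_le_sphere hq (c := n) (r := 1 / 2) (C := 8 * Real.exp (π / 2))
    (by norm_num) (fun z hz => ?_) (Metric.mem_closedBall_self (by norm_num))
  · rw [hpq, norm_mul, norm_sub_rev, mul_comm (8 * Real.exp (π / 2))]
    gcongr
  · have h1 := hn z hz
    have h2 := norm_sin_mul_pi_le_of_mem_sphere hz
    rw [hpq, norm_mul] at h1
    rw [mem_sphere_iff_norm] at hz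
    have h3 : 1 / 4 ≤ ‖z - μ n‖ := by
      have := norm_sub_norm_le (z - n) (μ n - n)
      rw [sub_sub_sub_cancel_right, hz] at this
      linarith
    have h4 : 1 / 4 * ‖dslope (prod1 μ) (μ n) z‖ ≤ ‖z - μ n‖ * ‖dslope (prod1 μ) (μ n) z‖ := by
      gcongr
    linarith

end

lemma differentiable_sin_mul_pi : Differentiable ℂ fun z : ℂ => Complex.sin (z * π) := by
  fun_prop

lemma tendsto_sin_div_sin :
    Tendsto (fun z : ℂ => Complex.sin (z * π) / Complex.sin (z * π)) farFilter (𝓝 1) := by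
  refine tendsto_const_nhds.congr' ?_
  filter_upwards [mem_offInt_eventually] with z hz
  rw [div_self (sin_ne_zero_of_mem_offInt hz)]

/-- The order of a zero of the sine is at most that of any function vanishing at the integers. -/
lemma analyticOrderAt_sin_le {F : ℂ → ℂ} (hF : Differentiable ℂ F) (h : ∀ n : ℤ, F n = 0) (z : ℂ) :
    analyticOrderAt (fun z : ℂ => Complex.sin (z * π)) z ≤ analyticOrderAt F z := by
  have hs := differentiable_sin_mul_pi.analyticAt z
  by_cases h0 : Complex.sin (z * π) = 0
  · have h1 : analyticOrderAt (fun z : ℂ => Complex.sin (z * π)) z = 1 := by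
      refine hs.analyticOrderAt_eq_one_of_zero_deriv_ne_zero h0 ?_
      have hd : HasDerivAt (fun z : ℂ => Complex.sin (z * π)) (Complex.cos (z * π) * π) z :=
        (hasDerivAt_mul_const (π : ℂ)).csin
      rw [hd.deriv]
      have hcos : Complex.cos (z * π) ≠ 0 := fun hc => by
        have := Complex.sin_sq_add_cos_sq (z * π)
        rw [h0, hc] at this
        norm_num at this
      exact mul_ne_zero hcos (by exact_mod_cast Real.pi_ne_zero)
    rw [h1, Order.one_le_iff_ne_zero, (hF.analyticAt z).analyticOrderAt_ne_zero]
    obtain ⟨k, hk⟩ := Complex.sin_eq_zero_iff.1 h0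
    have : z = k := mul_right_cancel₀ (by exact_mod_cast Real.pi_ne_zero : (π : ℂ) ≠ 0) hk
    rw [this, h]
  · rw [hs.analyticOrderAt_eq_zero.2 h0]
    exact zero_le

/-- If the canonical product differs from `-sin` by a function of exponential type at most `b`,
then this function is a Fourier integral over `(-b, b)`. -/
theorem exists_prod1_add_sin_eq_expInt {μ : ℤ → ℂ} (hμ : Summable fun n : ℤ => ‖μ n - n‖ ^ 2)
    {b : ℝ} (hb : 0 ≤ b) (hbpi : b ≤ π)
    (htype : ExpTypeLE (fun l => prod1 μ l + Complex.sin (l * π)) b) :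
    ∃ u : ℝ → ℂ, MemLp u 2 (volume.restrict (Ioc (-b) b)) ∧
      ∀ z, prod1 μ z + Complex.sin (z * π) = expInt (-b) b u z := by
  obtain ⟨u, hu, hun⟩ := exists_expInt_int_eq (summable_norm_prod1_int_sq hμ)
  have hi := intervalIntegrable_of_memLp neg_pi_lt_pi.le hu
  have hFd : Differentiable ℂ fun l => prod1 μ l + Complex.sin (l * π) - expInt (-π) π u l :=
    htype.1.sub (differentiable_expInt hi)
  have key : ∀ z, prod1 μ z + Complex.sin (z * π) = expInt (-π) π u z := by
    intro z
    -- The difference vanishes at all integers by the choice of `u`, so it is a multiple of the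
    -- sine. Its ratio to the sine tends to `-1 + 1 - 0 = 0` far from the integers, hence the
    -- multiple is zero.
    have h := eq_mul_of_analyticOrderAt_le hFd differentiable_sin_mul_pi
      (analyticOrderAt_sin_le hFd fun n => by simp [hun, Complex.sin_int_mul_pi])
      (cF := -1 + 1 - 0) (cG := 1) ?_ tendsto_sin_div_sin one_ne_zero z
    · rw [neg_add_cancel, sub_zero, zero_div, zero_mul] at h
      exact sub_eq_zero.1 h
    · refine (((tendsto_prod1_div_sin hμ).add tendsto_sin_div_sin).sub
        (tendsto_expInt_div_sin hu)).congr fun z => ?_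
      rw [sub_div, add_div]
  refine ⟨u, hu.mono_measure (Measure.restrict_mono (Ioc_subset_Ioc (neg_le_neg hbpi) hbpi) le_rfl),
    fun z => ?_⟩
  rw [key, expInt_eq_of_expTypeLE hu hb hbpi]
  have : (fun l => prod1 μ l + Complex.sin (l * π)) = expInt (-π) π u := funext key
  rwa [← this]

end DelayDirac

/-! ### Zeros of a perturbed sine near one integer -/

namespace DelayDirac

open Filter Topology Bornology Set MeasureTheory
open scoped Real

/-- The value `1/3` is small enough for the derivative estimate below, which needs `2/5 + π/3 ≤
π/2`. -/
lemma norm_cos_sub_one_le {w : ℂ} (hw : ‖w‖ ≤ π / 4) : ‖Complex.cos w - 1‖ ≤ 1 / 3 := by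
  have hpi := Real.pi_lt_d2
  have h1 : ‖w‖ ≤ 0.7875 := hw.trans (by linarith)
  have h2 := Complex.cos_bound (x := w) (by linarith)
  have h3 : Complex.cos w - 1 = (Complex.cos w - (1 - w ^ 2 / 2)) - w ^ 2 / 2 := by ring
  have h4 : ‖w ^ 2 / 2‖ = ‖w‖ ^ 2 / 2 := by simp
  rw [h3]
  refine (norm_sub_le _ _).trans ?_
  rw [h4]
  have h5 : ‖w‖ ^ 2 ≤ 0.7875 ^ 2 := by gcongr
  have h6 : ‖w‖ ^ 4 ≤ 0.7875 ^ 4 := by gcongr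
  norm_num at h5 h6
  linarith

lemma norm_cos_int_mul_pi (n : ℤ) : ‖Complex.cos (n * π)‖ = 1 := by
  have h := Complex.sin_sq_add_cos_sq ((n : ℂ) * π)
  rw [Complex.sin_int_mul_pi, zero_pow two_ne_zero, zero_add, sq_eq_one_iff] at h
  rcases h with h | h <;> simp [h]

section Perturbation

variable {f : ℂ → ℂ} (hf : Differentiable ℂ f) {n : ℤ}
  (hfn : ∀ z ∈ Metric.sphere (n : ℂ) (1 / 2), ‖f z‖ ≤ 1 / 10)

include hf hfn

/-- Cauchy's estimate on the circle of radius `1/4` about `z`, which stays in the disc of radius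
`1/2` about `n`: `(1/10) / (1/4) = 2/5`. -/
lemma norm_deriv_le_of_norm_le_sphere {z : ℂ} (hz : z ∈ Metric.closedBall (n : ℂ) (1 / 4)) :
    ‖deriv f z‖ ≤ 2 / 5 := by
  have h := Complex.norm_deriv_le_of_forall_mem_sphere_norm_le (c := z) (R := 1 / 4) (C := 1 / 10)
    (f := f) (by norm_num) hf.diffContOnCl fun w hw => ?_
  · norm_num at h ⊢; exact h
  · refine norm_le_of_norm_le_sphere hf (by norm_num : (0 : ℝ) < 1 / 2) hfn ?_
    rw [mem_closedBall_iff_norm] at hz ⊢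
    rw [mem_sphere_iff_norm] at hw
    have := norm_add_le (w - z) (z - n)
    rw [sub_add_sub_cancel, hw] at this
    linarith

/-- Near an integer, `-sin + f` is a small perturbation of a linear function. -/
lemma norm_deriv_perturbation_le {z : ℂ} (hz : z ∈ Metric.closedBall (n : ℂ) (1 / 4)) :
    ‖deriv (fun z => -Complex.sin (z * π) + f z + Complex.cos (n * π) * π * z) z‖ ≤ π / 2 := by
  have hcosn := norm_cos_int_mul_pi n
  have hd : HasDerivAt (fun z => -Complex.sin (z * π) + f z + Complex.cos (n * π) * π * z)
      (-(Complex.cos (z * π) * π) + deriv f z + Complex.cos (n * π) * π) z := by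
    exact (((hasDerivAt_mul_const (π : ℂ)).csin.fun_neg).fun_add (hf z).hasDerivAt).fun_add
      (hasDerivAt_const_mul (Complex.cos (n * π) * π))
  have hcos : Complex.cos (z * π) = Complex.cos (n * π) * Complex.cos ((z - n) * π) := by
    have : z * π = n * π + (z - n) * π := by ring
    rw [this, Complex.cos_add, Complex.sin_int_mul_pi]
    ring
  have he : -(Complex.cos (z * π) * π) + deriv f z + Complex.cos (n * π) * π =
      deriv f z - Complex.cos (n * π) * π * (Complex.cos ((z - n) * π) - 1) := by
    rw [hcos]; ring
  have hw : ‖(z - n) * (π : ℂ)‖ ≤ π / 4 := by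
    rw [mem_closedBall_iff_norm] at hz
    rw [norm_mul, Complex.norm_real, Real.norm_of_nonneg Real.pi_pos.le]
    nlinarith [Real.pi_pos]
  rw [hd.deriv, he]
  refine (norm_sub_le _ _).trans ?_
  rw [norm_mul, norm_mul, hcosn, one_mul, Complex.norm_real, Real.norm_of_nonneg Real.pi_pos.le]
  have h1 := norm_deriv_le_of_norm_le_sphere hf hfn hz
  have h2 := mul_le_mul_of_nonneg_left (norm_cos_sub_one_le hw) Real.pi_pos.le
  linarith [Real.pi_gt_three]

/-- The linear part stretches distances by exactly `π` and the remainder is `π/2`-Lipschitz. The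
resulting expansion gives both the uniqueness of the zero and its distance to `n`. -/
lemma norm_sub_le_norm_sub_perturbation {z w : ℂ} (hz : z ∈ Metric.closedBall (n : ℂ) (1 / 4))
    (hw : w ∈ Metric.closedBall (n : ℂ) (1 / 4)) :
    π / 2 * ‖z - w‖ ≤ ‖(-Complex.sin (z * π) + f z) - (-Complex.sin (w * π) + f w)‖ := by
  have hd : Differentiable ℂ fun z => -Complex.sin (z * π) + f z + Complex.cos (n * π) * π * z :=
    (differentiable_sin_mul_pi.neg.add hf).add (by fun_prop)
  have hcosn := norm_cos_int_mul_pi n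
  have h := (convex_closedBall (n : ℂ) (1 / 4)).norm_image_sub_le_of_norm_deriv_le
    (fun x _ => hd x) (fun x hx => norm_deriv_perturbation_le hf hfn hx) hw hz
  have h1 : ‖Complex.cos (n * π) * π * (z - w)‖ = π * ‖z - w‖ := by
    rw [norm_mul, norm_mul, hcosn, one_mul, Complex.norm_real, Real.norm_of_nonneg Real.pi_pos.le]
  have h2 : Complex.cos (n * π) * π * (z - w) =
      (-Complex.sin (z * π) + f z + Complex.cos (n * π) * π * z -
        (-Complex.sin (w * π) + f w + Complex.cos (n * π) * π * w)) -
      ((-Complex.sin (z * π) + f z) - (-Complex.sin (w * π) + f w)) := by ring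
  rw [h2] at h1
  have h3 := norm_sub_le (-Complex.sin (z * π) + f z + Complex.cos (n * π) * π * z -
        (-Complex.sin (w * π) + f w + Complex.cos (n * π) * π * w))
      ((-Complex.sin (z * π) + f z) - (-Complex.sin (w * π) + f w))
  rw [h1] at h3
  linarith

/-- Near an integer, `-sin + f` has exactly one zero, which is simple. -/
lemma exists_zero_perturbation : ∃ z : ℂ, ‖z - n‖ ≤ ‖f n‖ ∧ ‖z - n‖ ≤ 1 / 10 ∧
    analyticOrderAt (fun z => -Complex.sin (z * π) + f z) z = 1 ∧
    ∀ w ∈ Metric.closedBall (n : ℂ) (1 / 4), -Complex.sin (w * π) + f w = 0 → w = z := by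
  have hD : Differentiable ℂ fun z => -Complex.sin (z * π) + f z :=
    differentiable_sin_mul_pi.neg.add hf
  have hn : (n : ℂ) ∈ Metric.closedBall (n : ℂ) (1 / 4) := Metric.mem_closedBall_self (by norm_num)
  have hfn0 : ‖f n‖ ≤ 1 / 10 := norm_le_of_norm_le_sphere hf (by norm_num) hfn
    (Metric.mem_closedBall_self (by norm_num))
  have hDn : -Complex.sin ((n : ℂ) * π) + f n = f n := by
    rw [Complex.sin_int_mul_pi, neg_zero, zero_add]
  have hpi := Real.pi_gt_three
  have hsph : ∀ z ∈ Metric.sphere (n : ℂ) (1 / 4),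
      π / 8 ≤ ‖(-Complex.sin (z * π) + f z) - (-Complex.sin (n * π) + f n)‖ := by
    intro z hz
    have := norm_sub_le_norm_sub_perturbation hf hfn (Metric.sphere_subset_closedBall hz) hn
    rw [mem_sphere_iff_norm.1 hz] at this
    linarith
  -- Quantitative open mapping: the image of the disc contains the ball of radius `π/16` about the
  -- value `f n` at the centre. It contains `0` since `|f n| ≤ 1/10 < π/16`.
  have himg := (hD.diffContOnCl (s := Metric.ball (n : ℂ) (1 / 4))).ball_subset_image_closedBall
    (by norm_num) hsph ?_
  · obtain ⟨z, hz, hz0⟩ := himg (show (0 : ℂ) ∈ _ by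
      rw [mem_ball_iff_norm, zero_sub, norm_neg]
      rw [hDn]
      linarith)
    have hdist : ‖z - n‖ ≤ ‖f n‖ := by
      have := norm_sub_le_norm_sub_perturbation hf hfn hz hn
      dsimp only at hz0
      rw [hz0, hDn, zero_sub, norm_neg] at this
      nlinarith [norm_nonneg (z - n)]
    refine ⟨z, hdist, hdist.trans hfn0, ?_, fun w hw hw0 => ?_⟩
    -- At a multiple zero the derivative of the function with the linear term added would have
    -- modulus `π`, against the bound `π/2`.
    · refine (hD.analyticAt z).analyticOrderAt_eq_one_of_zero_deriv_ne_zero hz0 fun h0 => ?_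
      have h1 := norm_deriv_perturbation_le hf hfn hz
      have h2 : HasDerivAt (fun z => -Complex.sin (z * π) + f z + Complex.cos (n * π) * π * z)
          (0 + Complex.cos (n * π) * π) z := by
        have := (hD z).hasDerivAt
        rw [h0] at this
        exact this.fun_add (hasDerivAt_const_mul (Complex.cos (n * π) * π))
      have hcosn := norm_cos_int_mul_pi n
      rw [h2.deriv, zero_add, norm_mul, hcosn, one_mul, Complex.norm_real,
        Real.norm_of_nonneg Real.pi_pos.le] at h1
      linarith
    · have := norm_sub_le_norm_sub_perturbation hf hfn hw hz
      dsimp only at hz0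
      rw [hw0, hz0, sub_zero, norm_zero] at this
      have h1 : ‖w - z‖ ≤ 0 := by nlinarith [norm_nonneg (w - z)]
      exact sub_eq_zero.1 (norm_le_zero_iff.1 h1)
  · have hev : ∀ᶠ z in 𝓝[≠] (n : ℂ), -Complex.sin (z * π) + f z ≠ -Complex.sin (n * π) + f n := by
      filter_upwards [mem_nhdsWithin_of_mem_nhds (Metric.closedBall_mem_nhds (n : ℂ)
        (by norm_num : (0 : ℝ) < 1 / 4)), self_mem_nhdsWithin] with z hz hzn heq
      have := norm_sub_le_norm_sub_perturbation hf hfn hz hn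
      rw [heq, sub_self, norm_zero] at this
      have h1 : ‖z - n‖ ≤ 0 := by nlinarith [norm_nonneg (z - n)]
      exact hzn (sub_eq_zero.1 (norm_le_zero_iff.1 h1))
    exact hev.frequently.filter_mono nhdsWithin_le_nhds

end Perturbation

end DelayDirac

/-! ### Numbering the zeros -/

namespace DelayDirac

open Filter Topology Bornology Set MeasureTheory
open scoped Real

/-- A bijection between cofinite sets of integers extends to an injection of the integers in one
of the two directions. -/
lemma exists_injective_extension {T : Set ℤ} (hT : T.Finite) {σ : ℤ → ℤ} (hσ : InjOn σ Tᶜ)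
    (hM : (σ '' Tᶜ)ᶜ.Finite) :
    (∃ s : ℤ → ℤ, s.Injective ∧ ∀ n ∉ T, s n = σ n) ∨
      ∃ τ : ℤ → ℤ, τ.Injective ∧ ∀ n ∉ T, τ (σ n) = n := by
  classical
  set M := (σ '' Tᶜ)ᶜ
  have := hT.fintype
  have := hM.fintype
  -- The finite sets `T` of unassigned indices and `M` of unused values are compared in size; the
  -- smaller one is embedded in the larger.
  rcases le_total (Fintype.card T) (Fintype.card M) with hle | hle
  · obtain ⟨g⟩ := Function.Embedding.nonempty_of_card_le hle
    refine Or.inl ⟨fun n => if h : n ∈ T then (g ⟨n, h⟩ : ℤ) else σ n, fun m n hmn => ?_,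
      fun n hn => dif_neg hn⟩
    have hg : ∀ (m : T) (n : ℤ), n ∉ T → (g m : ℤ) ≠ σ n := fun m n hn h =>
      (g m).2 (h ▸ mem_image_of_mem σ hn)
    by_cases hm : m ∈ T <;> by_cases hn : n ∈ T <;> simp only [hm, hn, dite_true, dite_false] at hmn
    · simpa using g.injective (Subtype.ext hmn)
    · exact absurd hmn (hg ⟨m, hm⟩ n hn)
    · exact absurd hmn.symm (hg ⟨n, hn⟩ m hm)
    · exact hσ hm hn hmn
  · obtain ⟨g⟩ := Function.Embedding.nonempty_of_card_le hle
    have hex : ∀ m, m ∉ M → ∃ n, n ∈ Tᶜ ∧ σ n = m := fun m hm => by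
      simpa [M] using hm
    refine Or.inr ⟨fun m => if h : m ∈ M then (g ⟨m, h⟩ : ℤ) else (hex m h).choose,
      fun m n hmn => ?_, fun n hn => ?_⟩
    · by_cases hm : m ∈ M <;> by_cases hn : n ∈ M <;>
        simp only [hm, hn, dite_true, dite_false] at hmn
      · simpa using g.injective (Subtype.ext hmn)
      · exact absurd (g ⟨m, hm⟩).2 (hmn ▸ (hex n hn).choose_spec.1)
      · exact absurd (g ⟨n, hn⟩).2 (hmn ▸ (hex m hm).choose_spec.1)
      · rw [← (hex m hm).choose_spec.2, hmn, (hex n hn).choose_spec.2]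
    · have hm : σ n ∉ M := fun h => h (mem_image_of_mem σ hn)
      simp only [hm, dite_false]
      exact hσ (hex _ hm).choose_spec.1 hn (hex _ hm).choose_spec.2

/-- A sequence whose fibers are counted by the orders of zeros of an analytic function, nowhere
locally zero, has finitely many members in each compact set. -/
lemma finite_mem_of_isCompact {D : ℂ → ℂ} (hD : Differentiable ℂ D)
    (hD0 : ∀ z, analyticOrderAt D z ≠ ⊤) {lam : ℤ → ℂ}
    (hlam : ∀ z, analyticOrderAt D z = {n | lam n = z}.encard) {K : Set ℂ} (hK : IsCompact K) :
    {n | lam n ∈ K}.Finite := by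
  have hfib : ∀ z, {n | lam n = z}.Finite := fun z => by
    rw [← encard_ne_top_iff, ← hlam]; exact hD0 z
  refine hK.induction_on (p := fun K => {n | lam n ∈ K}.Finite) (by simp)
    (fun s t hst ht => ht.subset fun n hn => hst hn)
    (fun s t hs ht => (hs.union ht).subset fun n hn => hn) fun z _ => ?_
  have hz : ∀ᶠ w in 𝓝[≠] z, D w ≠ 0 := by
    rcases (hD.analyticAt z).eventually_eq_zero_or_eventually_ne_zero with h | h
    · exact absurd (analyticOrderAt_eq_top.2 h) (hD0 z)
    · exact h
  refine ⟨_, mem_nhdsWithin_of_mem_nhds (eventually_nhdsWithin_iff.1 hz), ?_⟩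
  refine (hfib z).subset fun n hn => ?_
  by_contra hne
  refine hn hne ?_
  refine apply_eq_zero_of_analyticOrderAt_ne_zero ?_
  rw [hlam, encard_ne_zero]
  exact ⟨n, rfl⟩

/-- An injection between finite sets of equal size is onto; this is applied in each fibre of `α`. -/
lemma surjective_of_encard_fiber_eq {ι κ : Type*} {s : ι → κ} (hs : s.Injective) {α : κ → ℂ}
    (hfin : ∀ z, {m | α m = z}.encard ≠ ⊤)
    (h : ∀ z, {n | α (s n) = z}.encard = {m | α m = z}.encard) : s.Surjective := by
  intro m
  have hsub : s '' {n | α (s n) = α m} ⊆ {k | α k = α m} := by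
    rintro _ ⟨n, hn, rfl⟩; exact hn
  have heq := ((encard_ne_top_iff.1 (hfin (α m))).subset hsub).eq_of_subset_of_encard_le hsub
    (by rw [hs.encard_image, h])
  have hm : m ∈ {k | α k = α m} := rfl
  rw [← heq] at hm
  obtain ⟨n, _, hn⟩ := hm
  exact ⟨n, hn⟩

lemma encard_fiber_comp_le {ι κ : Type*} {s : ι → κ} (hs : s.Injective) (α : κ → ℂ) (z : ℂ) :
    {n | α (s n) = z}.encard ≤ {m | α m = z}.encard := by
  rw [← hs.encard_image]
  refine encard_le_encard ?_
  rintro _ ⟨n, hn, rfl⟩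
  exact hn

/-- The sequence of the zeros of a perturbation `-sin + f` of the sine can be numbered so that it
is asymptotically close to the integers, and then the perturbation is the canonical product. -/
theorem exists_perm_prod1_eq {f : ℂ → ℂ} (hf : Differentiable ℂ f)
    (hlim : Tendsto (fun z => f z / Complex.sin (z * π)) farFilter (𝓝 0))
    (hsum : Summable fun n : ℤ => ‖f n‖ ^ 2) {lam : ℤ → ℂ}
    (hlam : ∀ z, analyticOrderAt (fun z => -Complex.sin (z * π) + f z) z =
      {n | lam n = z}.encard) :
    ∃ s : Equiv.Perm ℤ, (Summable fun n : ℤ => ‖lam (s n) - n‖ ^ 2) ∧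
      ∀ z, prod1 (lam ∘ s) z = -Complex.sin (z * π) + f z := by
  set D : ℂ → ℂ := fun z => -Complex.sin (z * π) + f z with hDdef
  have hD : Differentiable ℂ D := differentiable_sin_mul_pi.neg.add hf
  have hDlim : Tendsto (fun z => D z / Complex.sin (z * π)) farFilter (𝓝 (-1)) := by
    have := tendsto_sin_div_sin.neg.add hlim
    rw [add_zero] at this
    refine this.congr fun z => ?_
    rw [hDdef]; ring
  have hD0 := analyticOrderAt_ne_top_of_tendsto hD hDlim (by norm_num)
  have hroot : ∀ m, D (lam m) = 0 := fun m =>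
    apply_eq_zero_of_analyticOrderAt_ne_zero (by rw [hlam, encard_ne_zero]; exact ⟨m, rfl⟩)
  have hsmall : ∀ᶠ n : ℤ in cofinite, ∀ z ∈ Metric.sphere (n : ℂ) (1 / 2), ‖f z‖ ≤ 1 / 10 := by
    have h1 : ∀ᶠ z in farFilter, ‖f z‖ ≤ 1 / 10 / Real.exp (π / 2) * ‖Complex.sin (z * π)‖ := by
      filter_upwards [(tendsto_zero_iff_norm_tendsto_zero.1 hlim).eventually_le_const
        (by positivity : 0 < 1 / 10 / Real.exp (π / 2)), mem_offInt_eventually] with z hz hoff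
      rwa [norm_div, div_le_iff₀ (norm_pos_iff.2 (sin_ne_zero_of_mem_offInt hoff))] at hz
    filter_upwards [eventually_forall_mem_sphere h1] with n hn z hz
    refine (hn z hz).trans ?_
    have := mul_le_mul_of_nonneg_left (norm_sin_mul_pi_le_of_mem_sphere hz)
      (by positivity : 0 ≤ 1 / 10 / Real.exp (π / 2))
    rwa [div_mul_cancel₀ _ (Real.exp_pos _).ne'] at this
  set T : Set ℤ := {n | ¬∀ z ∈ Metric.sphere (n : ℂ) (1 / 2), ‖f z‖ ≤ 1 / 10} with hTdef
  have hT : T.Finite := eventually_cofinite.1 hsmall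
  have hTn : ∀ n, n ∉ T → ∀ z ∈ Metric.sphere (n : ℂ) (1 / 2), ‖f z‖ ≤ 1 / 10 := fun n hn => by
    simpa [hTdef] using hn
  -- A simple zero has a fibre with one element, so the zero near `n` determines a unique index `m`.
  -- For `n ∈ T` the choice `0` is a dummy.
  have hex : ∀ n, ∃ m, n ∉ T → ‖lam m - n‖ ≤ ‖f n‖ ∧ ‖lam m - n‖ ≤ 1 / 10 ∧
      ∀ k, lam k ∈ Metric.closedBall (n : ℂ) (1 / 4) → k = m := by
    intro n
    by_cases hn : n ∈ T
    · exact ⟨0, fun h => absurd hn h⟩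
    obtain ⟨z, hz1, hz2, hz3, hz4⟩ := exists_zero_perturbation hf (hTn n hn)
    rw [hlam, encard_eq_one] at hz3
    obtain ⟨m, hm⟩ := hz3
    have hmz : lam m = z := by
      have : m ∈ {n | lam n = z} := by rw [hm]; rfl
      exact this
    refine ⟨m, fun _ => ⟨hmz ▸ hz1, hmz ▸ hz2, fun k hk => ?_⟩⟩
    have : k ∈ {n | lam n = z} := hz4 _ hk (hroot k)
    rwa [hm] at this
  choose σ hσ using hex
  have hσinj : InjOn σ Tᶜ := by
    intro m hm n hn hmn
    have h1 := (hσ m hm).2.1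
    have h2 := (hσ n hn).2.1
    rw [hmn] at h1
    by_contra hne
    have h3 : (1 : ℝ) ≤ ‖((m - n : ℤ) : ℂ)‖ := by
      rw [Complex.norm_intCast]
      exact_mod_cast Int.one_le_abs (sub_ne_zero.2 hne)
    have h4 : ((m - n : ℤ) : ℂ) = (lam (σ n) - n) - (lam (σ n) - m) := by push_cast; ring
    have h5 := norm_sub_le (lam (σ n) - n) (lam (σ n) - m)
    rw [← h4] at h5
    linarith
  -- Unused zeros lie in a compact set. Those in `offInt` are bounded because `D / sin` tends to
  -- `-1`, and one close to an integer outside `T` would have been used.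
  have hM : (σ '' Tᶜ)ᶜ.Finite := by
    obtain ⟨R, hR⟩ := eventually_farFilter.1 (hDlim.eventually_ne (by norm_num : (-1 : ℂ) ≠ 0))
    have hK : IsCompact (Metric.closedBall (0 : ℂ) R ∪
        ⋃ n ∈ T, Metric.closedBall (n : ℂ) (1 / 4)) :=
      (isCompact_closedBall _ _).union (hT.isCompact_biUnion fun n _ => isCompact_closedBall _ _)
    refine (finite_mem_of_isCompact hD hD0 hlam hK).subset fun m hm => ?_
    by_cases hoff : lam m ∈ offInt
    · left
      rw [mem_closedBall_zero_iff]
      by_contra hlt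
      exact hR _ hoff (not_le.1 hlt).le (by rw [hroot, zero_div])
    · right
      obtain ⟨n, hn⟩ : ∃ n : ℤ, ‖lam m - n‖ < 1 / 4 := by simpa [offInt] using hoff
      have hb : lam m ∈ Metric.closedBall (n : ℂ) (1 / 4) := mem_closedBall_iff_norm.2 hn.le
      refine mem_iUnion₂.2 ⟨n, ?_, hb⟩
      by_contra hnT
      exact hm ⟨n, hnT, ((hσ n hnT).2.2 m hb).symm⟩
  have hsummable : ∀ {μ : ℤ → ℂ}, (∀ n ∉ T, μ n = lam (σ n)) →
      Summable fun n : ℤ => ‖μ n - n‖ ^ 2 := by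
    intro μ hμ
    refine Summable.of_norm_bounded_eventually hsum ?_
    filter_upwards [hT.compl_mem_cofinite] with n hn
    rw [Real.norm_of_nonneg (by positivity), hμ n hn]
    have := (hσ n hn).1
    gcongr
  -- No count of zeros in large contours is needed: each alternative makes one of `D` and a
  -- canonical product divide the other. As both ratios to the sine tend to `-1`, they coincide, and
  -- equality of the orders then makes the injection a bijection.
  rcases exists_injective_extension hT hσinj hM with ⟨s, hs, hsσ⟩ | ⟨τ, hτ, hτσ⟩
  · have hμ : Summable fun n : ℤ => ‖(lam ∘ s) n - n‖ ^ 2 := hsummable fun n hn => by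
      rw [Function.comp_apply, hsσ n hn]
    have heq : ∀ z, D z = prod1 (lam ∘ s) z := fun z => by
      have := eq_mul_of_analyticOrderAt_le hD (differentiable_prod1 hμ) (fun z => ?_) hDlim
        (tendsto_prod1_div_sin hμ) (by norm_num) z
      · simpa using this
      · rw [analyticOrderAt_prod1 hμ, hlam]
        exact encard_fiber_comp_le hs lam z
    have hsurj : s.Surjective := surjective_of_encard_fiber_eq hs (α := lam)
      (fun z => by rw [← hlam]; exact hD0 z) fun z => by
        rw [← hlam, funext heq, analyticOrderAt_prod1 hμ]
        rfl
    exact ⟨Equiv.ofBijective s ⟨hs, hsurj⟩, hμ, fun z => (heq z).symm⟩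
  -- Positions not reached by `τ` are provisionally filled with the integers themselves, which does
  -- not affect the `ℓ₂` condition; surjectivity of `τ` later shows that there are none.
  · set μ : ℤ → ℂ := Function.extend τ lam fun n => n
    have hμτ : ∀ m, μ (τ m) = lam m := fun m => hτ.extend_apply _ _ _
    have hμ : Summable fun n : ℤ => ‖μ n - n‖ ^ 2 := hsummable fun n hn => by
      rw [← hμτ, hτσ n hn]
    have heq : ∀ z, prod1 μ z = D z := fun z => by
      have := eq_mul_of_analyticOrderAt_le (differentiable_prod1 hμ) hD (fun z => ?_)
        (tendsto_prod1_div_sin hμ) hDlim (by norm_num) z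
      · simpa using this
      · rw [analyticOrderAt_prod1 hμ, hlam]
        simpa only [hμτ] using encard_fiber_comp_le hτ μ z
    have hsurj : τ.Surjective := surjective_of_encard_fiber_eq hτ (α := μ)
      (fun z => by rw [← analyticOrderAt_prod1 hμ, funext heq]; exact hD0 z) fun z => by
        simp only [hμτ]
        rw [← analyticOrderAt_prod1 hμ, ← hlam, funext heq]
    set e := (Equiv.ofBijective τ ⟨hτ, hsurj⟩).symm
    have he : lam ∘ e = μ := by
      funext n
      rw [Function.comp_apply, ← hμτ]
      congr 1
      exact Equiv.ofBijective_apply_symm_apply τ ⟨hτ, hsurj⟩ n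
    refine ⟨e, ?_, fun z => by rw [he]; exact heq z⟩
    exact hμ.congr fun n => by rw [← congrFun he n]; rfl

end DelayDirac

/-! ### Explicit solution of the delayed system -/

namespace DelayDirac

open Filter Topology Set MeasureTheory
open scoped Real

lemma absolutelyContinuousOnInterval_const {E : Type*} [NormedAddCommGroup E] [NormedSpace ℝ E]
    (e : E) (c d : ℝ) : AbsolutelyContinuousOnInterval (fun _ => e) c d :=
  (contDiffOn_const (𝕜 := ℝ)).absolutelyContinuousOnInterval

lemma absolutelyContinuousOnInterval_apply {ι : Type*} [Fintype ι] {y : ℝ → ι → ℂ} {c d : ℝ}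
    (hy : AbsolutelyContinuousOnInterval y c d) (i : ι) :
    AbsolutelyContinuousOnInterval (fun x => y x i) c d :=
  squeeze_zero (fun _ => Finset.sum_nonneg fun _ _ => dist_nonneg)
    (fun _ => Finset.sum_le_sum fun _ _ => dist_le_pi_dist _ _ i) hy

/-- Real and imaginary parts reduce this to integrals of real functions. -/
lemma absolutelyContinuousOnInterval_integral {f : ℝ → ℂ} {c d : ℝ}
    (hf : IntervalIntegrable f volume c d) :
    AbsolutelyContinuousOnInterval (fun x => ∫ t in c..x, f t) c d := by
  have hre : IntervalIntegrable (fun t => (f t).re) volume c d := ⟨hf.1.re, hf.2.re⟩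
  have him : IntervalIntegrable (fun t => (f t).im) volume c d := ⟨hf.1.im, hf.2.im⟩
  have h := ((hre.absolutelyContinuousOnInterval_intervalIntegral left_mem_uIcc).smul
    (absolutelyContinuousOnInterval_const (1 : ℂ) c d)).add
    ((him.absolutelyContinuousOnInterval_intervalIntegral left_mem_uIcc).smul
    (absolutelyContinuousOnInterval_const Complex.I c d))
  have hof : ∀ {g : ℝ → ℝ} {x : ℝ}, ((∫ t in c..x, g t : ℝ) : ℂ) = ∫ t in c..x, (g t : ℂ) :=
    intervalIntegral.integral_ofReal.symm
  have heq : ∀ x ∈ uIcc c d, ((fun x => ∫ t in c..x, (f t).re) • fun _ => (1 : ℂ)) x +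
      ((fun x => ∫ t in c..x, (f t).im) • fun _ => Complex.I) x = ∫ t in c..x, f t := by
    intro x hx
    have hsub : uIcc c x ⊆ uIcc c d := uIcc_subset_uIcc_left hx
    have h1 : IntervalIntegrable (fun t => ((f t).re : ℂ)) volume c x :=
      ⟨(hre.mono_set hsub).1.ofReal, (hre.mono_set hsub).2.ofReal⟩
    have h2 : IntervalIntegrable (fun t => ((f t).im : ℂ)) volume c x :=
      ⟨(him.mono_set hsub).1.ofReal, (him.mono_set hsub).2.ofReal⟩
    simp only [Pi.smul_apply', Complex.real_smul, mul_one, hof]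
    rw [← intervalIntegral.integral_mul_const, ← intervalIntegral.integral_add h1 (h2.mul_const _)]
    exact intervalIntegral.integral_congr fun t _ => Complex.re_add_im _
  rw [absolutelyContinuousOnInterval_iff] at h ⊢
  intro ε hε
  obtain ⟨δ, hδ, hE⟩ := h ε hε
  refine ⟨δ, hδ, fun E hEd hElt => ?_⟩
  convert hE E hEd hElt using 1
  refine Finset.sum_congr rfl fun i hi => ?_
  have hmem := hEd.1 i hi
  rw [← heq _ hmem.1, ← heq _ hmem.2]
  rfl

/-- An absolutely continuous function is the integral of its derivative. -/
lemma eq_add_integral_of_ae_hasDerivAt {w g : ℝ → ℂ} {d : ℝ} (hd : 0 ≤ d)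
    (hw : AbsolutelyContinuousOnInterval w 0 d) (hg : IntervalIntegrable g volume 0 d)
    (hwg : ∀ᵐ x ∂volume.restrict (Ioo 0 d), HasDerivAt w (g x) x) {x : ℝ} (hx : x ∈ Icc 0 d) :
    w x = w 0 + ∫ t in (0 : ℝ)..x, g t := by
  have hac := hw.sub (absolutelyContinuousOnInterval_integral hg)
  obtain ⟨C, hC⟩ := hac.const_of_ae_hasDerivAt_zero (by
    have h0 : ∀ᵐ x : ℝ, x ≠ 0 := by simp [ae_iff, measure_singleton]
    have h1 : ∀ᵐ x : ℝ, x ≠ d := by simp [ae_iff, measure_singleton]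
    filter_upwards [(ae_restrict_iff' measurableSet_Ioo).1 hwg, hg.ae_hasDerivAt_integral, h0, h1]
      with x h2 h3 h4 h5 hx
    have hx' := hx
    rw [uIcc_of_le hd] at hx'
    have := (h2 ⟨lt_of_le_of_ne hx'.1 h4.symm, lt_of_le_of_ne hx'.2 h5⟩).sub
      (h3 hx 0 left_mem_uIcc)
    rwa [sub_self] at this)
  rw [uIcc_of_le hd] at hC
  have hC0 := hC 0 ⟨le_rfl, hd⟩
  have hCx := hC x hx
  simp only [Pi.sub_apply, intervalIntegral.integral_same, sub_zero] at hC0 hCx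
  rw [hC0, ← hCx]; ring

namespace IsPotential

variable {a : ℝ} {p q : ℝ → ℂ}

lemma add (hp : IsPotential a p) (hq : IsPotential a q) : IsPotential a fun x => p x + q x :=
  ⟨hp.memLp.add hq.memLp, by
    filter_upwards [hp.eq_zero, hq.eq_zero] with x h1 h2
    rw [h1, h2, add_zero]⟩

lemma const_mul (hp : IsPotential a p) (c : ℂ) : IsPotential a fun x => c * p x :=
  ⟨hp.memLp.const_mul c, by
    filter_upwards [hp.eq_zero] with x h1
    rw [h1, mul_zero]⟩

lemma intervalIntegrable (hp : IsPotential a p) : IntervalIntegrable p volume 0 π := by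
  rw [intervalIntegrable_iff_integrableOn_Ioo_of_le Real.pi_pos.le]
  exact hp.memLp.integrable one_le_two

end IsPotential

/-- The function `V` which satisfies `V'(x) = -i l V(x) - f(x) exp(i l (x - a))`, `V(0) = 1`. -/
noncomputable def wave (a : ℝ) (f : ℝ → ℂ) (l : ℂ) (x : ℝ) : ℂ :=
  Complex.exp (-(Complex.I * l * x)) *
    (1 - ∫ t in (0 : ℝ)..x, f t * Complex.exp (Complex.I * l * (2 * t - a)))

section Wave

variable {a : ℝ} {f : ℝ → ℂ}

lemma wave_zero (l : ℂ) : wave a f l 0 = 1 := by simp [wave]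

lemma intervalIntegrable_wave (hf : IsPotential a f) (l : ℂ) :
    IntervalIntegrable (fun t : ℝ => f t * Complex.exp (Complex.I * l * (2 * t - a))) volume 0 π :=
  hf.intervalIntegrable.mul_continuousOn (by fun_prop)

lemma wave_of_le (hf : IsPotential a f) (l : ℂ) {x : ℝ} (hx0 : 0 ≤ x) (hx : x ≤ a) :
    wave a f l x = Complex.exp (-(Complex.I * l * x)) := by
  have : ∫ t in (0 : ℝ)..x, f t * Complex.exp (Complex.I * l * (2 * t - a)) = 0 := by
    rw [intervalIntegral.integral_of_le hx0, integral_Ioc_eq_integral_Ioo]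
    refine integral_eq_zero_of_ae ?_
    filter_upwards [ae_restrict_of_ae_restrict_of_subset (Ioo_subset_Ioo_right hx) hf.eq_zero]
      with t ht
    simp [ht]
  rw [wave, this, sub_zero, mul_one]

lemma absolutelyContinuousOnInterval_exp (c : ℂ) (d e : ℝ) :
    AbsolutelyContinuousOnInterval (fun x : ℝ => Complex.exp (c * x)) d e :=
  ContDiffOn.absolutelyContinuousOnInterval
    (((contDiff_const.mul Complex.ofRealCLM.contDiff).cexp).contDiffOn)

lemma absolutelyContinuousOnInterval_wave (hf : IsPotential a f) (l : ℂ) :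
    AbsolutelyContinuousOnInterval (wave a f l) 0 π := by
  have h := (absolutelyContinuousOnInterval_exp (-(Complex.I * l)) 0 π).smul
    ((absolutelyContinuousOnInterval_const (1 : ℂ) 0 π).sub
      (absolutelyContinuousOnInterval_integral (intervalIntegrable_wave hf l)))
  have heq : wave a f l = (fun x : ℝ => Complex.exp (-(Complex.I * l) * x)) • ((fun _ => (1 : ℂ)) -
      fun x : ℝ => ∫ t in (0 : ℝ)..x, f t * Complex.exp (Complex.I * l * (2 * t - a))) := by
    funext x
    simp [wave]
  rw [heq]
  exact h

lemma ae_hasDerivAt_wave (hf : IsPotential a f) (l : ℂ) :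
    ∀ᵐ x : ℝ ∂volume.restrict (Ioo 0 π), HasDerivAt (wave a f l)
      (-(Complex.I * l) * wave a f l x - f x * Complex.exp (Complex.I * l * (x - a))) x := by
  rw [ae_restrict_iff' measurableSet_Ioo]
  filter_upwards [(intervalIntegrable_wave hf l).ae_hasDerivAt_integral] with x hx hx0
  have hmem : x ∈ uIcc 0 π := by
    rw [uIcc_of_le Real.pi_pos.le]; exact Ioo_subset_Icc_self hx0
  have h1 := (hx hmem 0 left_mem_uIcc).const_sub 1
  have h2 : HasDerivAt (fun x : ℝ => Complex.exp (-(Complex.I * l * x)))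
      (Complex.exp (-(Complex.I * l * x)) * -(Complex.I * l * 1)) x :=
    (((hasDerivAt_id x).ofReal_comp.const_mul (Complex.I * l)).neg).cexp
  refine (h2.mul h1).congr_deriv ?_
  have h3 : Complex.exp (Complex.I * l * (x - a)) =
      Complex.exp (-(Complex.I * l * x)) * Complex.exp (Complex.I * l * (2 * x - a)) := by
    rw [← Complex.exp_add]; congr 1; ring
  rw [h3, wave]
  ring

/-- A solution of the equation for `wave`, whose delayed argument is known where `f ≠ 0`. -/
lemma eq_mul_wave_of_ae_hasDerivAt (hf : IsPotential a f) (l c : ℂ) {d : ℝ} (hd : 0 ≤ d)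
    (hdpi : d ≤ π) {v : ℝ → ℂ} (hv : AbsolutelyContinuousOnInterval v 0 d) (hv0 : v 0 = c)
    (hvd : ∀ᵐ x : ℝ ∂volume.restrict (Ioo 0 d), HasDerivAt v
      (-(Complex.I * l) * v x - f x * (c * Complex.exp (Complex.I * l * (x - a)))) x)
    {x : ℝ} (hx : x ∈ Icc 0 d) : v x = c * wave a f l x := by
  have hint : IntervalIntegrable
      (fun t : ℝ => -(c * (f t * Complex.exp (Complex.I * l * (2 * t - a))))) volume 0 d :=
    (((intervalIntegrable_wave hf l).mono_set (by
      rw [uIcc_of_le hd, uIcc_of_le Real.pi_pos.le]; exact Icc_subset_Icc_right hdpi)).const_mul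
        c).neg
  -- Integrating factor `exp(ilx)`.
  have h := eq_add_integral_of_ae_hasDerivAt hd
    ((absolutelyContinuousOnInterval_exp (Complex.I * l) 0 d).smul hv) hint (by
      filter_upwards [hvd] with x hx
      have h2 : HasDerivAt (fun x : ℝ => Complex.exp (Complex.I * l * x))
          (Complex.exp (Complex.I * l * x) * (Complex.I * l * 1)) x :=
        ((hasDerivAt_id x).ofReal_comp.const_mul (Complex.I * l)).cexp
      refine (h2.mul hx).congr_deriv ?_
      have h3 : Complex.exp (Complex.I * l * (2 * x - a)) =
          Complex.exp (Complex.I * l * x) * Complex.exp (Complex.I * l * (x - a)) := by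
        rw [← Complex.exp_add]; congr 1; ring
      rw [h3]
      ring) hx
  simp only [Pi.smul_apply', smul_eq_mul, hv0, intervalIntegral.integral_neg,
    intervalIntegral.integral_const_mul, Complex.ofReal_zero, mul_zero, Complex.exp_zero,
    one_mul] at h
  have h4 : Complex.exp (-(Complex.I * l * x)) * Complex.exp (Complex.I * l * x) = 1 := by
    rw [← Complex.exp_add, neg_add_cancel, Complex.exp_zero]
  calc v x = Complex.exp (-(Complex.I * l * x)) * (Complex.exp (Complex.I * l * x) * v x) := by
        rw [← mul_assoc, h4, one_mul]
    _ = _ := by rw [h, wave]; ring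

end Wave

section Solution

variable {a : ℝ} {p q : ℝ → ℂ}

lemma IsPotential.alpha (hp : IsPotential a p) (hq : IsPotential a q) :
    IsPotential a fun x => p x + Complex.I * q x := hp.add (hq.const_mul _)

lemma IsPotential.beta (hp : IsPotential a p) (hq : IsPotential a q) :
    IsPotential a fun x => p x - Complex.I * q x := by
  simpa [sub_eq_add_neg] using hp.add (hq.const_mul (-Complex.I))

/-- The combinations `v 1 ± i v 0` diagonalize `matB`, while `matQ` exchanges them, so they are
coupled only through the delayed value `w`. The second equation is the first with `l` replaced by
`-l` and `q` by `-q`, so `wave` serves for both. -/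
lemma equation_iff (l : ℂ) (x : ℝ) (u v w : Fin 2 → ℂ) :
    Matrix.mulVec matB u + Matrix.mulVec (matQ p q x) w = l • v ↔
      u 1 + Complex.I * u 0 = -(Complex.I * l) * (v 1 + Complex.I * v 0) -
        (p x + Complex.I * q x) * (w 1 - Complex.I * w 0) ∧
      u 1 - Complex.I * u 0 = -(Complex.I * -l) * (v 1 - Complex.I * v 0) -
        (p x - Complex.I * q x) * (w 1 + Complex.I * w 0) := by
  rw [funext_iff, Fin.forall_fin_two]
  simp only [matB, matQ, Matrix.mulVec, dotProduct, Fin.sum_univ_two, Pi.add_apply, Matrix.of_apply,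
    Matrix.cons_val_zero, Matrix.cons_val_one, Matrix.cons_val', Matrix.cons_val_fin_one,
    Pi.smul_apply, smul_eq_mul]
  have hI := Complex.I_mul_I
  constructor
  · rintro ⟨h0, h1⟩
    constructor
    · linear_combination h0 - Complex.I * h1 + (l * v 0 - q x * w 0) * hI
    · linear_combination h0 + Complex.I * h1 + (l * v 0 - q x * w 0) * hI
  · rintro ⟨h0, h1⟩
    constructor
    · linear_combination (h0 + h1) / 2 - (l * v 0 - q x * w 0) * hI
    · linear_combination Complex.I / 2 * (h0 - h1) + (p x * w 0 - q x * w 1 - u 0 - l * v 1) * hI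

/-- The solution vanishing in the first component at zero is a multiple of an explicit one. -/
lemma IsSolution.eq_mul_wave {l : ℂ} {y : ℝ → Fin 2 → ℂ} (ha0 : 0 ≤ a) (hapi : a ≤ π)
    (ha : π ≤ 2 * a)
    (hp : IsPotential a p) (hq : IsPotential a q) (hy : IsSolution a p q l y) (hy0 : y 0 0 = 0) :
    ∀ x ∈ Icc 0 π,
      y x 1 + Complex.I * y x 0 = y 0 1 * wave a (fun x => p x + Complex.I * q x) l x ∧
      y x 1 - Complex.I * y x 0 = y 0 1 * wave a (fun x => p x - Complex.I * q x) (-l) x := by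
  have hac0 := absolutelyContinuousOnInterval_apply hy.absCont 0
  have hac1 := absolutelyContinuousOnInterval_apply hy.absCont 1
  have hacI := (absolutelyContinuousOnInterval_const Complex.I 0 π).smul hac0
  have hP : AbsolutelyContinuousOnInterval (fun x => y x 1 + Complex.I * y x 0) 0 π :=
    hac1.add hacI
  have hM : AbsolutelyContinuousOnInterval (fun x => y x 1 - Complex.I * y x 0) 0 π :=
    hac1.sub hacI
  have hder : ∀ᵐ x ∂volume.restrict (Ioo 0 π),
      HasDerivAt (fun x => y x 1 + Complex.I * y x 0) (-(Complex.I * l) * (y x 1 + Complex.I * y x 0)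
        - (p x + Complex.I * q x) * (y (x - a) 1 - Complex.I * y (x - a) 0)) x ∧
      HasDerivAt (fun x => y x 1 - Complex.I * y x 0)
        (-(Complex.I * -l) * (y x 1 - Complex.I * y x 0)
        - (p x - Complex.I * q x) * (y (x - a) 1 + Complex.I * y (x - a) 0)) x := by
    filter_upwards [hy.equation] with x hx
    have hd := hasDerivAt_pi.1 hx.1.hasDerivAt
    have he := (equation_iff l x _ _ _).1 hx.2
    exact ⟨((hd 1).add ((hd 0).const_mul _)).congr_deriv he.1,
      ((hd 1).sub ((hd 0).const_mul _)).congr_deriv he.2⟩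
  have hA := hp.alpha hq
  have hB := hp.beta hq
  have hsub : uIcc 0 a ⊆ uIcc 0 π := by
    rw [uIcc_of_le ha0, uIcc_of_le Real.pi_pos.le]; exact Icc_subset_Icc_right hapi
  have hfirst : ∀ x ∈ Icc 0 a,
      y x 1 + Complex.I * y x 0 = y 0 1 * Complex.exp (-(Complex.I * l * x)) ∧
      y x 1 - Complex.I * y x 0 = y 0 1 * Complex.exp (-(Complex.I * -l * x)) := by
    intro x hx
    have hder' := ae_restrict_of_ae_restrict_of_subset (Ioo_subset_Ioo_right hapi) hder
    rw [← wave_of_le hA l hx.1 hx.2, ← wave_of_le hB (-l) hx.1 hx.2]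
    constructor
    · refine eq_mul_wave_of_ae_hasDerivAt hA l _ ha0 hapi (hP.mono hsub) (by simp [hy0]) ?_ hx
      filter_upwards [hder', hA.eq_zero] with x h1 h2
      rw [h2, zero_mul, sub_zero]
      have := h1.1
      rwa [h2, zero_mul, sub_zero] at this
    · refine eq_mul_wave_of_ae_hasDerivAt hB (-l) _ ha0 hapi (hM.mono hsub) (by simp [hy0]) ?_ hx
      filter_upwards [hder', hB.eq_zero] with x h1 h2
      rw [h2, zero_mul, sub_zero]
      have := h1.2
      rwa [h2, zero_mul, sub_zero] at this
  -- For `x < a` the delayed argument is negative and `y` is unconstrained there; the vanishing of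
  -- the potential removes it. For `x ≥ a` the hypothesis `π ≤ 2a` puts `x - a` in `[0, a]`, where
  -- `hfirst` applies.
  have hzero : ∀ {f : ℝ → ℂ}, IsPotential a f →
      ∀ᵐ x ∂volume.restrict (Ioo 0 π), x < a → f x = 0 := by
    intro f hf
    rw [ae_restrict_iff' measurableSet_Ioo]
    filter_upwards [(ae_restrict_iff' measurableSet_Ioo).1 hf.eq_zero] with x h1 h2 h3
      using h1 ⟨h2.1, h3⟩
  intro x hx
  constructor
  · refine eq_mul_wave_of_ae_hasDerivAt hA l _ Real.pi_pos.le le_rfl hP (by simp [hy0]) ?_ hx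
    filter_upwards [hder, hzero hA, ae_restrict_mem measurableSet_Ioo] with x h1 h2 hx
    refine h1.1.congr_deriv ?_
    rcases lt_or_ge x a with hxa | hxa
    · rw [h2 hxa]; ring
    · rw [(hfirst (x - a) ⟨by linarith, by linarith [hx.2]⟩).2]
      congr 4; push_cast; ring
  · refine eq_mul_wave_of_ae_hasDerivAt hB (-l) _ Real.pi_pos.le le_rfl hM (by simp [hy0]) ?_ hx
    filter_upwards [hder, hzero hB, ae_restrict_mem measurableSet_Ioo] with x h1 h2 hx
    refine h1.2.congr_deriv ?_
    rcases lt_or_ge x a with hxa | hxa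
    · rw [h2 hxa]; ring
    · rw [(hfirst (x - a) ⟨by linarith, by linarith [hx.2]⟩).1]
      congr 4; push_cast; ring

/-- The solution with the value `(0, 1)` at zero. -/
noncomputable def sol (a : ℝ) (p q : ℝ → ℂ) (l : ℂ) (x : ℝ) : Fin 2 → ℂ :=
  wave a (fun x => p x + Complex.I * q x) l x • ![-Complex.I / 2, 1 / 2] +
    wave a (fun x => p x - Complex.I * q x) (-l) x • ![Complex.I / 2, 1 / 2]

lemma sol_plus (l : ℂ) (x : ℝ) : sol a p q l x 1 + Complex.I * sol a p q l x 0 =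
    wave a (fun x => p x + Complex.I * q x) l x := by
  simp [sol]
  linear_combination (-wave a (fun x => p x + Complex.I * q x) l x / 2 +
    wave a (fun x => p x - Complex.I * q x) (-l) x / 2) * Complex.I_mul_I

lemma sol_minus (l : ℂ) (x : ℝ) : sol a p q l x 1 - Complex.I * sol a p q l x 0 =
    wave a (fun x => p x - Complex.I * q x) (-l) x := by
  simp [sol]
  linear_combination (wave a (fun x => p x + Complex.I * q x) l x / 2 -
    wave a (fun x => p x - Complex.I * q x) (-l) x / 2) * Complex.I_mul_I

lemma sol_zero (l : ℂ) : sol a p q l 0 = Pi.single 1 1 := by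
  funext i
  fin_cases i
  · simp [sol, wave_zero]; ring
  · simp [sol, wave_zero]; ring

lemma isSolution_sol (ha : π ≤ 2 * a)
    (hp : IsPotential a p) (hq : IsPotential a q) (l : ℂ) : IsSolution a p q l (sol a p q l) := by
  have hA := hp.alpha hq
  have hB := hp.beta hq
  refine ⟨((absolutelyContinuousOnInterval_wave hA l).smul
    (absolutelyContinuousOnInterval_const _ 0 π)).add
    ((absolutelyContinuousOnInterval_wave hB (-l)).smul
    (absolutelyContinuousOnInterval_const _ 0 π)), ?_⟩
  have hzero : ∀ {f : ℝ → ℂ}, IsPotential a f →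
      ∀ᵐ x ∂volume.restrict (Ioo 0 π), x < a → f x = 0 := by
    intro f hf
    rw [ae_restrict_iff' measurableSet_Ioo]
    filter_upwards [(ae_restrict_iff' measurableSet_Ioo).1 hf.eq_zero] with x h1 h2 h3
      using h1 ⟨h2.1, h3⟩
  filter_upwards [ae_hasDerivAt_wave hA l, ae_hasDerivAt_wave hB (-l), hzero hA, hzero hB,
    ae_restrict_mem measurableSet_Ioo] with x h1 h2 h3 h4 hx
  have hd := (h1.smul_const ![-Complex.I / 2, 1 / 2]).add (h2.smul_const ![Complex.I / 2, 1 / 2])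
  have hd' : HasDerivAt (sol a p q l) _ x := hd
  refine ⟨hd'.differentiableAt, ?_⟩
  rw [hd'.deriv, equation_iff, sol_plus, sol_minus, sol_plus, sol_minus]
  have h5 : (p x + Complex.I * q x) * wave a (fun x => p x - Complex.I * q x) (-l) (x - a) =
      (p x + Complex.I * q x) * Complex.exp (Complex.I * l * (x - a)) := by
    rcases lt_or_ge x a with hxa | hxa
    · rw [h3 hxa]; ring
    · rw [wave_of_le hB _ (by linarith) (by linarith [hx.2])]
      congr 2; push_cast; ring
  have h6 : (p x - Complex.I * q x) * wave a (fun x => p x + Complex.I * q x) l (x - a) =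
      (p x - Complex.I * q x) * Complex.exp (Complex.I * -l * (x - a)) := by
    rcases lt_or_ge x a with hxa | hxa
    · rw [h4 hxa]; ring
    · rw [wave_of_le hA _ (by linarith) (by linarith [hx.2])]
      congr 2; push_cast; ring
  rw [h5, h6]
  simp only [Pi.add_apply, Pi.smul_apply, smul_eq_mul, Matrix.cons_val_zero, Matrix.cons_val_one,
    Matrix.cons_val_fin_one]
  generalize (-(Complex.I * l) * wave a (fun x => p x + Complex.I * q x) l x -
    (p x + Complex.I * q x) * Complex.exp (Complex.I * l * (x - a))) = A
  generalize (-(Complex.I * -l) * wave a (fun x => p x - Complex.I * q x) (-l) x -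
    (p x - Complex.I * q x) * Complex.exp (Complex.I * -l * (x - a))) = B
  constructor
  · linear_combination (-A / 2 + B / 2) * Complex.I_mul_I
  · linear_combination (A / 2 - B / 2) * Complex.I_mul_I

lemma IsSolution.eq_smul_sol {l : ℂ} {y : ℝ → Fin 2 → ℂ} (ha0 : 0 ≤ a) (hapi : a ≤ π)
    (ha : π ≤ 2 * a) (hp : IsPotential a p) (hq : IsPotential a q) (hy : IsSolution a p q l y)
    (hy0 : y 0 0 = 0) {x : ℝ} (hx : x ∈ Icc 0 π) : y x = y 0 1 • sol a p q l x := by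
  obtain ⟨h1, h2⟩ := hy.eq_mul_wave ha0 hapi ha hp hq hy0 x hx
  rw [← sol_plus] at h1
  rw [← sol_minus] at h2
  funext i
  fin_cases i
  · simp
    linear_combination -Complex.I / 2 * (h1 - h2) +
      (y x 0 - y 0 1 * sol a p q l x 0) * Complex.I_mul_I
  · simp
    linear_combination (h1 + h2) / 2

/-- Solutions of the initial value problem are unique on `[0, π]`, so the definition leaves no
choice for `D`. -/
lemma isCharacteristicFunction_iff (ha0 : 0 ≤ a) (hapi : a ≤ π) (ha : π ≤ 2 * a)
    (hp : IsPotential a p) (hq : IsPotential a q) (j : Fin 2) {D : ℂ → ℂ} :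
    IsCharacteristicFunction a p q 0 j D ↔ ∀ l, D l = sol a p q l π j := by
  refine forall_congr' fun l => ⟨?_, fun h => ⟨_, isSolution_sol ha hp hq l, sol_zero l, h⟩⟩
  rintro ⟨y, hy, hy0, hD⟩
  have h0 : y 0 = Pi.single 1 1 := hy0
  have := hy.eq_smul_sol ha0 hapi ha hp hq (by simp [h0]) (right_mem_Icc.2 Real.pi_pos.le)
  rw [hD, this, h0]
  simp

lemma isEigenvalue_iff (ha0 : 0 ≤ a) (hapi : a ≤ π) (ha : π ≤ 2 * a)
    (hp : IsPotential a p) (hq : IsPotential a q) (j : Fin 2) (l : ℂ) :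
    IsEigenvalue a p q 0 j l ↔ sol a p q l π j = 0 := by
  constructor
  · rintro ⟨y, hy, hy0, hyj, x, hx, hne⟩
    rw [hy.eq_smul_sol ha0 hapi ha hp hq hy0 (right_mem_Icc.2 Real.pi_pos.le), Pi.smul_apply,
      smul_eq_mul, mul_eq_zero] at hyj
    refine hyj.resolve_left fun h => hne ?_
    rw [hy.eq_smul_sol ha0 hapi ha hp hq hy0 hx, h, zero_smul]
  · intro h
    refine ⟨_, isSolution_sol ha hp hq l, by simp [sol_zero], h, 0,
      left_mem_Icc.2 Real.pi_pos.le, by simp [sol_zero]⟩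

end Solution

end DelayDirac

/-! ### Potentials and densities of the characteristic functions -/

namespace DelayDirac

open Filter Topology Set MeasureTheory
open scoped Real

lemma memLp_comp_affine {u : ℝ → ℂ} {S T : Set ℝ} (hS : MeasurableSet S) (hT : MeasurableSet T)
    {k m : ℝ} (hk : k ≠ 0) (hST : ∀ x ∈ T, k * x + m ∈ S) (hu : MemLp u 2 (volume.restrict S)) :
    MemLp (fun x => u (k * x + m)) 2 (volume.restrict T) := by
  have h1 := (memLp_indicator_iff_restrict hS).2 hu
  have hmap : Measure.map (fun x => k * x + m) volume = ENNReal.ofReal |k⁻¹| • volume := by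
    have : (fun x => k * x + m) = (fun x => x + m) ∘ fun x => k * x := rfl
    rw [this, ← Measure.map_map (measurable_add_const m) (measurable_const_mul k),
      Real.map_volume_mul_left hk, Measure.map_smul, map_add_right_eq_self]
  have h2 : MemLp (S.indicator u ∘ fun x => k * x + m) 2 volume := by
    refine MemLp.comp_of_map ?_ (by fun_prop)
    rw [hmap]
    exact h1.smul_measure ENNReal.ofReal_ne_top
  refine (memLp_congr_ae ?_).1 (h2.restrict T)
  filter_upwards [ae_restrict_mem hT] with x hx
  simp [hST x hx]

lemma memLp_mul_exp {u : ℝ → ℂ} {S : Set ℝ} (hu : MemLp u 2 (volume.restrict S)) (k : ℝ) :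
    MemLp (fun s : ℝ => u s * Complex.exp (Complex.I * k * s)) 2 (volume.restrict S) := by
  refine hu.congr_norm (hu.1.mul (Continuous.aestronglyMeasurable (by fun_prop))) ?_
  refine .of_forall fun s => ?_
  rw [norm_mul, mul_assoc, mul_comm Complex.I, ← Complex.ofReal_mul, Complex.norm_exp_ofReal_mul_I,
    mul_one]

/-- Modulating the density translates the spectral parameter; shifts by `±1/2` exchange sine and
cosine problems while keeping the support and the `L₂` property. -/
lemma expInt_mul_exp (c d : ℝ) (u : ℝ → ℂ) (k z : ℂ) :
    expInt c d (fun s => u s * Complex.exp (Complex.I * k * s)) z = expInt c d u (z + k) := by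
  refine intervalIntegral.integral_congr fun s _ => ?_
  simp only []
  rw [mul_assoc, ← Complex.exp_add]
  congr 2; ring

lemma expInt_const_mul (c d : ℝ) (u : ℝ → ℂ) (k z : ℂ) :
    expInt c d (fun s => k * u s) z = k * expInt c d u z := by
  simp only [expInt, mul_assoc, intervalIntegral.integral_const_mul]

lemma expInt_add {c d : ℝ} {u v : ℝ → ℂ} (hu : IntervalIntegrable u volume c d)
    (hv : IntervalIntegrable v volume c d) (z : ℂ) :
    expInt c d (fun s => u s + v s) z = expInt c d u z + expInt c d v z := by
  rw [expInt, expInt, expInt, ← intervalIntegral.integral_add (intervalIntegrable_mul_exp hu z)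
    (intervalIntegrable_mul_exp hv z)]
  exact intervalIntegral.integral_congr fun s _ => add_mul _ _ _

/-- The density of the characteristic function which comes from a potential. -/
noncomputable def density (a : ℝ) (f : ℝ → ℂ) (s : ℝ) : ℂ := f (2⁻¹ * s + (a + π) / 2) / 2

section Density

variable {a : ℝ} {f p q : ℝ → ℂ}

lemma memLp_density (ha0 : 0 ≤ a) (hf : IsPotential a f) :
    MemLp (density a f) 2 (volume.restrict (Ioc (-(π - a)) (π - a))) := by
  have hf' : MemLp f 2 (volume.restrict (Ioc 0 π)) := by
    rw [← restrict_Ioo_eq_restrict_Ioc]; exact hf.memLp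
  have h := memLp_comp_affine (k := 2⁻¹) (m := (a + π) / 2) measurableSet_Ioc measurableSet_Ioc
    (by norm_num) (fun x (hx : x ∈ Ioc (-(π - a)) (π - a)) =>
      show _ ∈ Ioc 0 π from ⟨by linarith [hx.1], by linarith [hx.2]⟩) hf'
  refine (h.const_mul (2⁻¹ : ℂ)).congr_norm (h.const_mul (2⁻¹ : ℂ)).1 (.of_forall fun s => rfl)
    |>.ae_eq (.of_forall fun s => ?_)
  rw [density, div_eq_inv_mul (f _)]

/-- The substitution `t = s/2 + (a + π)/2` carries `(-(π - a), π - a)` to `(a, π)` and gives `2t - a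
= s + π`, so the prefactor `exp(-iλπ)` cancels. -/
lemma wave_pi (ha0 : 0 ≤ a) (hapi : a ≤ π) (hf : IsPotential a f) (l : ℂ) :
    wave a f l π =
      Complex.exp (-(Complex.I * l * π)) - expInt (-(π - a)) (π - a) (density a f) l := by
  have hint := intervalIntegrable_wave hf l
  have hsub1 : uIcc 0 a ⊆ uIcc 0 π := by
    rw [uIcc_of_le ha0, uIcc_of_le Real.pi_pos.le]; exact Icc_subset_Icc_right hapi
  have hsub2 : uIcc a π ⊆ uIcc 0 π := by
    rw [uIcc_of_le hapi, uIcc_of_le Real.pi_pos.le]; exact Icc_subset_Icc_left ha0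
  have hz : ∫ t in (0 : ℝ)..a, f t * Complex.exp (Complex.I * l * (2 * t - a)) = 0 := by
    rw [intervalIntegral.integral_of_le ha0, integral_Ioc_eq_integral_Ioo]
    refine integral_eq_zero_of_ae ?_
    filter_upwards [hf.eq_zero] with t ht
    simp [ht]
  rw [wave, ← intervalIntegral.integral_add_adjacent_intervals (hint.mono_set hsub1)
    (hint.mono_set hsub2), hz, zero_add, mul_sub, mul_one]
  congr 1
  have hsubst := intervalIntegral.integral_comp_div_add (a := -(π - a)) (b := π - a)
    (fun t : ℝ => f t * Complex.exp (Complex.I * l * (2 * t - a)))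
    (two_ne_zero (α := ℝ)) ((a + π) / 2)
  rw [show -(π - a) / 2 + (a + π) / 2 = a by ring, show (π - a) / 2 + (a + π) / 2 = π by ring,
    Complex.real_smul] at hsubst
  have h2 : ∫ t in a..π, f t * Complex.exp (Complex.I * l * (2 * t - a)) = 2⁻¹ *
      ∫ s in (-(π - a))..(π - a), f (s / 2 + (a + π) / 2) *
        Complex.exp (Complex.I * l * (2 * ((s / 2 + (a + π) / 2 : ℝ) : ℂ) - a)) := by
    rw [hsubst]; push_cast; ring
  rw [h2, ← mul_assoc, ← intervalIntegral.integral_const_mul, expInt]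
  refine intervalIntegral.integral_congr fun s _ => ?_
  simp only [density]
  have h3 : Complex.exp (Complex.I * l * (2 * ((s / 2 + (a + π) / 2 : ℝ) : ℂ) - a)) =
      Complex.exp (Complex.I * l * π) * Complex.exp (Complex.I * l * s) := by
    rw [← Complex.exp_add]; congr 1; push_cast; ring
  have h4 : Complex.exp (-(Complex.I * l * π)) * Complex.exp (Complex.I * l * π) = 1 := by
    rw [← Complex.exp_add, neg_add_cancel, Complex.exp_zero]
  rw [h3, show s / 2 + (a + π) / 2 = 2⁻¹ * s + (a + π) / 2 by ring]
  linear_combination (f (2⁻¹ * s + (a + π) / 2) / 2 * Complex.exp (Complex.I * l * s)) * h4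

/-- The density of the characteristic function for the boundary condition `y₁(π) = 0`. -/
noncomputable def density1 (a : ℝ) (p q : ℝ → ℂ) (s : ℝ) : ℂ :=
  Complex.I / 2 * density a (fun x => p x + Complex.I * q x) s +
    -Complex.I / 2 * density a (fun x => p x - Complex.I * q x) (-s)

/-- The density of the characteristic function for the boundary condition `y₂(π) = 0`. -/
noncomputable def density2 (a : ℝ) (p q : ℝ → ℂ) (s : ℝ) : ℂ :=
  -1 / 2 * density a (fun x => p x + Complex.I * q x) s +
    -1 / 2 * density a (fun x => p x - Complex.I * q x) (-s)

lemma memLp_density1 (ha0 : 0 ≤ a) (hp : IsPotential a p) (hq : IsPotential a q) :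
    MemLp (density1 a p q) 2 (volume.restrict (Ioc (-(π - a)) (π - a))) :=
  ((memLp_density ha0 (hp.alpha hq)).const_mul _).add
    ((memLp_comp_neg (memLp_density ha0 (hp.beta hq))).const_mul _)

lemma memLp_density2 (ha0 : 0 ≤ a) (hp : IsPotential a p) (hq : IsPotential a q) :
    MemLp (density2 a p q) 2 (volume.restrict (Ioc (-(π - a)) (π - a))) :=
  ((memLp_density ha0 (hp.alpha hq)).const_mul _).add
    ((memLp_comp_neg (memLp_density ha0 (hp.beta hq))).const_mul _)

/-- Reflecting the second density turns its Fourier integral at `-l` into one at `l`, so that both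
waves combine in a single integral. -/
lemma expInt_density_linear (ha0 : 0 ≤ a) (hapi : a ≤ π) (hp : IsPotential a p)
    (hq : IsPotential a q) (c d l : ℂ) :
    expInt (-(π - a)) (π - a) (fun s => c * density a (fun x => p x + Complex.I * q x) s +
      d * density a (fun x => p x - Complex.I * q x) (-s)) l =
    c * (Complex.exp (-(Complex.I * l * π)) - wave a (fun x => p x + Complex.I * q x) l π) +
      d * (Complex.exp (Complex.I * l * π) -
        wave a (fun x => p x - Complex.I * q x) (-l) π) := by
  have hb : -(π - a) ≤ π - a := by linarith
  have h1 := intervalIntegrable_of_memLp hb (memLp_density ha0 (hp.alpha hq))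
  have h2 := intervalIntegrable_of_memLp hb (memLp_comp_neg (memLp_density ha0 (hp.beta hq)))
  rw [expInt_add (h1.const_mul c) (h2.const_mul d), expInt_const_mul, expInt_const_mul,
    expInt_comp_neg, neg_neg, wave_pi ha0 hapi (hp.alpha hq), wave_pi ha0 hapi (hp.beta hq)]
  rw [show -(Complex.I * -l * π) = Complex.I * l * π by ring]
  ring

lemma sol_pi_zero (ha0 : 0 ≤ a) (hapi : a ≤ π) (hp : IsPotential a p) (hq : IsPotential a q)
    (l : ℂ) : sol a p q l π 0 =
      -Complex.sin (l * π) + expInt (-(π - a)) (π - a) (density1 a p q) l := by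
  unfold density1
  rw [expInt_density_linear ha0 hapi hp hq, Complex.sin,
    show -(l * π) * Complex.I = -(Complex.I * l * π) by ring,
    show l * π * Complex.I = Complex.I * l * π by ring]
  simp [sol]
  ring

lemma sol_pi_one (ha0 : 0 ≤ a) (hapi : a ≤ π) (hp : IsPotential a p) (hq : IsPotential a q)
    (l : ℂ) : sol a p q l π 1 =
      Complex.cos (l * π) + expInt (-(π - a)) (π - a) (density2 a p q) l := by
  unfold density2
  rw [expInt_density_linear ha0 hapi hp hq, Complex.cos,
    show -(l * π) * Complex.I = -(Complex.I * l * π) by ring,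
    show l * π * Complex.I = Complex.I * l * π by ring]
  simp [sol]
  ring

/-- Inverts the affine change of variable; the factor `2` undoes the division in `density`. The
closed interval in the indicator gives equality at every point, endpoints included. -/
lemma exists_isPotential_density_eq {u : ℝ → ℂ}
    (hu : MemLp u 2 (volume.restrict (Ioc (-(π - a)) (π - a)))) :
    ∃ f, IsPotential a f ∧ ∀ s ∈ Icc (-(π - a)) (π - a), density a f s = u s := by
  refine ⟨(Icc a π).indicator fun t => 2 * u (2 * t + -(a + π)), ⟨?_, ?_⟩, fun s hs => ?_⟩
  · rw [← restrict_Ioo_eq_restrict_Ioc] at hu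
    have h := memLp_comp_affine (k := 2) (m := -(a + π)) measurableSet_Ioo measurableSet_Ioo
      (by norm_num) (fun x (hx : x ∈ Ioo a π) =>
        show _ ∈ Ioo (-(π - a)) (π - a) from ⟨by linarith [hx.1], by linarith [hx.2]⟩) hu
    rw [restrict_Ioo_eq_restrict_Icc] at h
    exact ((memLp_indicator_iff_restrict measurableSet_Icc).2 (h.const_mul 2)).restrict _
  · filter_upwards [ae_restrict_mem measurableSet_Ioo] with x hx
    exact indicator_of_notMem (fun h => absurd hx.2 (not_lt.2 h.1)) _
  · have hmem : 2⁻¹ * s + (a + π) / 2 ∈ Icc a π := ⟨by linarith [hs.1], by linarith [hs.2]⟩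
    rw [density, indicator_of_mem hmem]
    rw [show 2 * (2⁻¹ * s + (a + π) / 2) + -(a + π) = s by ring]
    ring

/-- Solving the linear system: the densities of `p + iq` at `s` and of `p - iq` at `-s` must be `-i
u₁ - u₂` and `i u₁ - u₂`. Then `p` and `q` are recovered from `f = p + iq` and `g = p - iq`. -/
lemma exists_isPotential_density_pair {u₁ u₂ : ℝ → ℂ}
    (hu₁ : MemLp u₁ 2 (volume.restrict (Ioc (-(π - a)) (π - a))))
    (hu₂ : MemLp u₂ 2 (volume.restrict (Ioc (-(π - a)) (π - a)))) :
    ∃ p q, IsPotential a p ∧ IsPotential a q ∧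
      (∀ s ∈ Icc (-(π - a)) (π - a), density1 a p q s = u₁ s) ∧
      ∀ s ∈ Icc (-(π - a)) (π - a), density2 a p q s = u₂ s := by
  obtain ⟨f, hf, hfu⟩ := exists_isPotential_density_eq
    ((hu₁.const_mul (-Complex.I)).add (hu₂.const_mul (-1)))
  obtain ⟨g, hg, hgu⟩ := exists_isPotential_density_eq
    (memLp_comp_neg ((hu₁.const_mul Complex.I).add (hu₂.const_mul (-1))))
  refine ⟨fun x => 2⁻¹ * f x + 2⁻¹ * g x, fun x => -Complex.I / 2 * f x + Complex.I / 2 * g x,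
    (hf.const_mul _).add (hg.const_mul _), (hf.const_mul _).add (hg.const_mul _), ?_⟩
  have hI := Complex.I_mul_I
  have h1 : (fun x => 2⁻¹ * f x + 2⁻¹ * g x +
      Complex.I * (-Complex.I / 2 * f x + Complex.I / 2 * g x)) = f := by
    funext x; linear_combination (-f x / 2 + g x / 2) * hI
  have h2 : (fun x => 2⁻¹ * f x + 2⁻¹ * g x -
      Complex.I * (-Complex.I / 2 * f x + Complex.I / 2 * g x)) = g := by
    funext x; linear_combination (f x / 2 - g x / 2) * hI
  have hneg : ∀ s ∈ Icc (-(π - a)) (π - a), -s ∈ Icc (-(π - a)) (π - a) := fun s hs =>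
    ⟨by linarith [hs.2], by linarith [hs.1]⟩
  constructor <;> intro s hs
  · rw [density1, h1, h2, hfu s hs, hgu _ (hneg s hs)]
    simp only [Pi.add_apply, neg_neg]
    linear_combination (-u₁ s) * hI
  · rw [density2, h1, h2, hfu s hs, hgu _ (hneg s hs)]
    simp only [Pi.add_apply, neg_neg]
    ring

lemma expInt_congr {b : ℝ} (hb : 0 ≤ b) {u v : ℝ → ℂ} (h : ∀ s ∈ Icc (-b) b, u s = v s) (z : ℂ) :
    expInt (-b) b u z = expInt (-b) b v z := by
  refine intervalIntegral.integral_congr fun s hs => ?_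
  rw [uIcc_of_le (by linarith)] at hs
  simp only [h s hs]

end Density

lemma memℓp_two_iff_summable_sq {g : ℤ → ℂ} : Memℓp g 2 ↔ Summable fun n => ‖g n‖ ^ 2 := by
  rw [memℓp_gen_iff (by norm_num)]
  simp

/-- The clause on eigenvalues follows from the one on orders: eigenvalues are the zeros of the
characteristic function, that is, the points with a nonempty fibre. -/
lemma isSpectrum_iff {a : ℝ} {p q : ℝ → ℂ} (ha0 : 0 ≤ a) (hapi : a ≤ π) (ha : π ≤ 2 * a)
    (hp : IsPotential a p) (hq : IsPotential a q) (j : Fin 2)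
    (hD : Differentiable ℂ fun l => sol a p q l π j) {lam : ℤ → ℂ} :
    IsSpectrum a p q 0 j lam ↔
      ∀ z, analyticOrderAt (fun l => sol a p q l π j) z = {n | lam n = z}.encard := by
  constructor
  · rintro ⟨-, D, hDc, h⟩
    rwa [funext ((isCharacteristicFunction_iff ha0 hapi ha hp hq j).1 hDc)] at h
  · refine fun h => ⟨fun z => ?_, _, (isCharacteristicFunction_iff ha0 hapi ha hp hq j).2
      fun _ => rfl, h⟩
    rw [isEigenvalue_iff ha0 hapi ha hp hq]
    have h1 := (hD.analyticAt z).analyticOrderAt_ne_zero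
    rw [h z, encard_ne_zero] at h1
    exact h1.symm

lemma encard_fiber_comp_perm (lam : ℤ → ℂ) (s : Equiv.Perm ℤ) (z : ℂ) :
    {n | (lam ∘ s) n = z}.encard = {n | lam n = z}.encard := by
  have : {n | (lam ∘ s) n = z} = s ⁻¹' {n | lam n = z} := rfl
  rw [this, encard_preimage_of_bijective s.bijective]

lemma analyticOrderAt_neg_comp_sub (D : ℂ → ℂ) (k z : ℂ) :
    analyticOrderAt (fun w => -D (w - k)) z = analyticOrderAt D (z - k) := by
  have hg : AnalyticAt ℂ (fun w => w - k) z := by fun_prop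
  have h1 : analyticOrderAt (D ∘ fun w => w - k) z = analyticOrderAt D (z - k) :=
    analyticOrderAt_comp_of_deriv_ne_zero hg (by simp)
  rw [← h1]
  exact analyticOrderAt_neg

lemma cos_sub_half_mul_pi (z : ℂ) : Complex.cos ((z - 1 / 2) * π) = Complex.sin (z * π) := by
  rw [show (z - 1 / 2) * π = z * π - π / 2 by ring, Complex.cos_sub_pi_div_two]

lemma analyticOrderAt_prod2 {μ : ℤ → ℂ}
    (hμ : Summable fun n : ℤ => ‖μ n - ((n : ℂ) - 1 / 2)‖ ^ 2) (z : ℂ) :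
    analyticOrderAt (prod2 μ) z = {n | μ n = z}.encard := by
  have hμ' : Summable fun n : ℤ => ‖μ n + 1 / 2 - n‖ ^ 2 := by
    refine hμ.congr fun n => ?_
    congr 2; ring
  have heq : prod2 μ = fun w => -prod1 (fun n => μ n + 1 / 2) (w - -(1 / 2)) := by
    funext w
    rw [prod2_eq_neg_prod1 hμ, sub_neg_eq_add]
  rw [heq, analyticOrderAt_neg_comp_sub, analyticOrderAt_prod1 hμ']
  simp

/-! ### Spectra of the sine and cosine problems -/

section SineType

variable {b : ℝ} (hb : 0 ≤ b) (hbpi : b ≤ π)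
include hb hbpi

/-- The canonical product over the zeros of a Paley-Wiener perturbation of the sine. -/
lemma exists_perm_prod1_eq_neg_sin_add_expInt {u : ℝ → ℂ}
    (hu : MemLp u 2 (volume.restrict (Ioc (-b) b))) {lam : ℤ → ℂ}
    (hlam : ∀ z, analyticOrderAt (fun z => -Complex.sin (z * π) + expInt (-b) b u z) z =
      {n | lam n = z}.encard) :
    ∃ s : Equiv.Perm ℤ, (Summable fun n => ‖lam (s n) - n‖ ^ 2) ∧
      ∀ z, prod1 (lam ∘ s) z = -Complex.sin (z * π) + expInt (-b) b u z := by
  have hv : MemLp ((Ioc (-b) b).indicator u) 2 (volume.restrict (Ioc (-π) π)) :=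
    ((memLp_indicator_iff_restrict measurableSet_Ioc).2 hu).restrict _
  have heq : ∀ z, expInt (-π) π ((Ioc (-b) b).indicator u) z = expInt (-b) b u z :=
    expInt_indicator (by linarith) (by linarith) hbpi u
  have hlim := tendsto_expInt_div_sin hv
  have hsum := summable_norm_expInt_int_sq hv
  simp only [heq] at hlim hsum
  exact exists_perm_prod1_eq
    (differentiable_expInt (intervalIntegrable_of_memLp (by linarith) hu)) hlim hsum hlam

/-- The canonical product over the zeros of a Paley-Wiener perturbation of the cosine. -/
lemma exists_perm_prod2_eq_cos_add_expInt {u : ℝ → ℂ}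
    (hu : MemLp u 2 (volume.restrict (Ioc (-b) b))) {lam : ℤ → ℂ}
    (hlam : ∀ z, analyticOrderAt (fun z => Complex.cos (z * π) + expInt (-b) b u z) z =
      {n | lam n = z}.encard) :
    ∃ s : Equiv.Perm ℤ, (Summable fun n : ℤ => ‖lam (s n) - ((n : ℂ) - 1 / 2)‖ ^ 2) ∧
      ∀ z, prod2 (lam ∘ s) z = Complex.cos (z * π) + expInt (-b) b u z := by
  -- Translated by `1/2` and negated, the perturbed cosine becomes a perturbed sine whose density is
  -- `-u(s) exp(-is/2)`.
  have hshift : ∀ z, -Complex.sin (z * π) + expInt (-b) b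
      (fun s => -1 * (u s * Complex.exp (Complex.I * ((-1 / 2 : ℝ) : ℂ) * s))) z =
      -(Complex.cos ((z - 1 / 2) * π) + expInt (-b) b u (z - 1 / 2)) := fun z => by
    rw [expInt_const_mul, expInt_mul_exp, cos_sub_half_mul_pi]
    rw [show z + ((-1 / 2 : ℝ) : ℂ) = z - 1 / 2 by push_cast; ring]
    ring
  obtain ⟨s, hs, hprod⟩ := exists_perm_prod1_eq_neg_sin_add_expInt hb hbpi
    ((memLp_mul_exp hu (-1 / 2)).const_mul (-1)) (lam := fun n => lam n + 1 / 2) fun z => by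
      simp only [hshift]
      rw [analyticOrderAt_neg_comp_sub fun z => Complex.cos (z * π) + expInt (-b) b u z, hlam]
      simp only [eq_sub_iff_add_eq]
  have hs' : Summable fun n : ℤ => ‖lam (s n) - ((n : ℂ) - 1 / 2)‖ ^ 2 := by
    refine hs.congr fun n => ?_
    congr 2; ring
  refine ⟨s, hs', fun z => ?_⟩
  rw [prod2_eq_neg_prod1 (μ := lam ∘ s) hs']
  have := hprod (z + 1 / 2)
  rw [hshift, add_sub_cancel_right] at this
  rw [← neg_neg (Complex.cos (z * π) + expInt (-b) b u z), ← this]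
  rfl

/-- A canonical product which differs from the cosine by a function of small type. -/
lemma exists_prod2_eq_cos_add_expInt {μ : ℤ → ℂ}
    (hμ : Summable fun n : ℤ => ‖μ n - ((n : ℂ) - 1 / 2)‖ ^ 2)
    (htype : ExpTypeLE (fun l => prod2 μ l - Complex.cos (l * π)) b) :
    ∃ u, MemLp u 2 (volume.restrict (Ioc (-b) b)) ∧
      ∀ z, prod2 μ z = Complex.cos (z * π) + expInt (-b) b u z := by
  have hμ' : Summable fun n : ℤ => ‖μ n + 1 / 2 - n‖ ^ 2 := by
    refine hμ.congr fun n => ?_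
    congr 2; ring
  have heq : ∀ z, prod1 (fun n => μ n + 1 / 2) z + Complex.sin (z * π) =
      -(prod2 μ (z - 1 / 2) - Complex.cos ((z - 1 / 2) * π)) := fun z => by
    rw [prod2_eq_neg_prod1 hμ, sub_add_cancel]
    linear_combination -cos_sub_half_mul_pi z
  obtain ⟨u, hu, hprod⟩ := exists_prod1_add_sin_eq_expInt hμ' hb hbpi (by
    obtain ⟨hd, hC⟩ := htype
    simp only [heq]
    refine ⟨(hd.comp (differentiable_id.sub_const (1 / 2))).neg, fun ε hε => ?_⟩
    obtain ⟨C, hC⟩ := hC ε hε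
    -- Translation by `1/2` costs only a constant factor in the growth bound. The absolute value of
    -- `C` makes that bound monotone.
    refine ⟨|C| * Real.exp ((b + ε) * (1 / 2)), fun z => ?_⟩
    rw [norm_neg]
    refine (hC _).trans ?_
    rw [mul_assoc, ← Real.exp_add, ← mul_add]
    have h1 : ‖z - 1 / 2‖ ≤ 1 / 2 + ‖z‖ := by
      have := norm_sub_le z (1 / 2)
      norm_num at this ⊢
      linarith
    have h2 : 0 ≤ b + ε := by linarith
    gcongr
    exact le_abs_self C)
  refine ⟨_, (memLp_mul_exp hu (1 / 2)).const_mul (-1), fun z => ?_⟩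
  rw [expInt_const_mul, expInt_mul_exp]
  rw [show z + ((1 / 2 : ℝ) : ℂ) = z + 1 / 2 by push_cast; ring, ← hprod, heq,
    add_sub_cancel_right]
  ring

end SineType

end DelayDirac

theorem theorem5 (a : ℝ) (ha : Real.pi / 2 ≤ a) (ha' : a < Real.pi) (lam₁ lam₂ : ℤ → ℂ) :
    (∃ p q : ℝ → ℂ, DelayDirac.IsPotential a p ∧ DelayDirac.IsPotential a q ∧
        DelayDirac.IsSpectrum a p q 0 0 lam₁ ∧ DelayDirac.IsSpectrum a p q 0 1 lam₂) ↔
      ∃ s₁ s₂ : Equiv.Perm ℤ,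
        DelayDirac.SpectralConditions a (lam₁ ∘ s₁) (lam₂ ∘ s₂) := by
  open DelayDirac in
  have hpi := Real.pi_pos
  have ha0 : 0 ≤ a := by linarith
  have ha2 : Real.pi ≤ 2 * a := by linarith
  have hb : 0 ≤ Real.pi - a := by linarith
  have hbpi : Real.pi - a ≤ Real.pi := by linarith
  have hbb : -(Real.pi - a) ≤ Real.pi - a := by linarith
  constructor
  · rintro ⟨p, q, hp, hq, h1, h2⟩
    have hu1 := memLp_density1 ha0 hp hq
    have hu2 := memLp_density2 ha0 hp hq
    have hd1 := differentiable_expInt (intervalIntegrable_of_memLp hbb hu1)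
    have hd2 := differentiable_expInt (intervalIntegrable_of_memLp hbb hu2)
    have e1 := funext (sol_pi_zero ha0 ha'.le hp hq)
    have e2 := funext (sol_pi_one ha0 ha'.le hp hq)
    rw [isSpectrum_iff ha0 ha'.le ha2 hp hq 0 (by rw [e1]; fun_prop), e1] at h1
    rw [isSpectrum_iff ha0 ha'.le ha2 hp hq 1 (by rw [e2]; fun_prop), e2] at h2
    obtain ⟨s₁, hs₁, hprod1⟩ := exists_perm_prod1_eq_neg_sin_add_expInt hb hbpi hu1 h1
    obtain ⟨s₂, hs₂, hprod2⟩ := exists_perm_prod2_eq_cos_add_expInt hb hbpi hu2 h2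
    refine ⟨s₁, s₂, memℓp_two_iff_summable_sq.2 hs₁, memℓp_two_iff_summable_sq.2 hs₂, ?_, ?_⟩
    · convert expTypeLE_expInt hb (intervalIntegrable_of_memLp hbb hu1) using 2 with l
      rw [hprod1]; ring
    · convert expTypeLE_expInt hb (intervalIntegrable_of_memLp hbb hu2) using 2 with l
      rw [hprod2]; ring
  · rintro ⟨s₁, s₂, h⟩
    have hs₁ := memℓp_two_iff_summable_sq.1 h.asymp1
    have hs₂ := memℓp_two_iff_summable_sq.1 h.asymp2
    obtain ⟨u₁, hu₁, hprod1⟩ := exists_prod1_add_sin_eq_expInt hs₁ hb hbpi h.type1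
    obtain ⟨u₂, hu₂, hprod2⟩ := exists_prod2_eq_cos_add_expInt hb hbpi hs₂ h.type2
    -- The two densities are independent, so a single potential realizes both spectra.
    obtain ⟨p, q, hp, hq, hpu, hqu⟩ := exists_isPotential_density_pair hu₁ hu₂
    have e1 : (fun l => sol a p q l Real.pi 0) = prod1 (lam₁ ∘ s₁) := by
      funext l
      rw [sol_pi_zero ha0 ha'.le hp hq, expInt_congr hb hpu, ← hprod1]; ring
    have e2 : (fun l => sol a p q l Real.pi 1) = prod2 (lam₂ ∘ s₂) := by
      funext l
      rw [sol_pi_one ha0 ha'.le hp hq, expInt_congr hb hqu, ← hprod2]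
    refine ⟨p, q, hp, hq, ?_, ?_⟩
    · rw [isSpectrum_iff ha0 ha'.le ha2 hp hq 0 (by rw [e1]; exact differentiable_prod1 hs₁), e1]
      intro z
      rw [analyticOrderAt_prod1 hs₁, encard_fiber_comp_perm]
    · rw [isSpectrum_iff ha0 ha'.le ha2 hp hq 1 (by rw [e2]; exact differentiable_prod2 hs₂), e2]
      intro z
      rw [analyticOrderAt_prod2 hs₂, encard_fiber_comp_perm]
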